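/- **Setting.** Let $n=n_r\to\infty$ and $p=p_r\to\infty$ along a sequence $r\in\mathbb N$ (all objects below may depend on $r$). Let $\varepsilon_i\in\mathbb R^p$, $i\in\mathbb Z$, be i.i.d., $\mathcal F_i=(\dots,\varepsilon_{i-1},\varepsilon_i)$, let $H=(H_1,\dots,H_p)$ be jointly measurable and $X_i^\circ(t)=H(\mathcal F_i;t)$, $t\in[0,1]$; one observes $X_i=H(\mathcal F_i;i/n)$, $1\le i\le n$. Put $\sigma_{jk}(t)=\mathbb E[H_j(\mathcal F_0;t)H_k(\mathcal F_0;t)]$, $\Sigma(t)=(\sigma_{jk}(t))$, $\Omega(t)=\Sigma(t)^{-1}=(\omega_{jk}(t))$, $\mathcal E(t)=\{(j,k):\omega_{jk}(t)\neq0\}$ and $\mathcal E^*(t;u)=\{(j,k):|\omega_{jk}(t)|>u\}$. Write $\|Z\|_a=(\mathbb E|Z|^a)^{1/a}$. Let $X^\circ_{ij,\{m\}}(t)$ be $X^\circ_{ij}(t)$ with $\varepsilon_{i-m}$ replaced by an independent copy, and $$\theta_{m,a,j}=\sup_{0\le t\le1}\|X^\circ_{ij}(t)-X^\circ_{ij,\{m\}}(t)\|_a,\qquad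 \|X_{\cdot,j}\|_{a,A}=\sup_{m\ge0}(m+1)^A\sum_{i\ge m}\theta_{i,a,j}.$$ **Assumptions.** Fix constants $q>2$, $A>0$, $\nu$, $L$, $L'$, $C_1,C_2>0$ and a kernel $K$, none of them depending on $n,p$. 1. $\mathbb E X^\circ_{ij}(t)=0$ and $\mathbb E|X^\circ_{ij}(t)|^{2q}\le\nu$ for all $t\in[0,1]$ and all $j$, and $\max_j\|X_{\cdot,j}\|_{2q,A}<\infty$. 2. (No break points.) For all $j,k$: $\|H_j(\mathcal F_0;t)-H_j(\mathcal F_0;t')\|_2\le L|t-t'|$ for $t,t'\in[0,1)$, and $\sigma_{jk}\in\mathcal C^2[0,1)$ with $|\sigma_{jk}''|\le L'$. 3. For all $t\in[0,1]$, $\Sigma(t)$ is invertible and $\max_k\sum_j|\omega_{jk}(t)|\le\kappa_p$, where $\kappa_p$ may vary with $n,p$. 4. $K$ is non-negative, symmetric, vanishes outside $[-1,1]$, is Lipschitz continuous on $[-1,1]$, and $\int_{-1}^1K=1$. **Estimator.** Let $N_X=\max_j\|X_{\cdot,j}\|_{4,A}$, $M_{X,q}=(\sum_j\|X_{\cdot,j}\|_{2q,A}^q)^{1/q}$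 and $J_{q,A}(n,p)=M_{X,q}(p\,\varpi_{q,A}(n))^{1/q}$, where $\varpi_{q,A}(n)=n$, $n(\log n)^{1+2q}$, $n^{q/2-Aq}$ if $A>\frac12-\frac1q$, $A=\frac12-\frac1q$, $A<\frac12-\frac1q$, respectively. Take the bandwidth $$b=b_\sharp=C_1\big(n^{-1}J_{q,A}(n,p)\big)^{1/3}+C_2N_X^{1/3}n^{-1/6}(\log p)^{1/6},$$ and suppose that $b_\sharp\to0$ and $nb_\sharp\to\infty$. Let $t_i=i/n$ and $$\hat\Sigma(t)=\sum_{i=1}^nw(t,t_i)X_iX_i^\top,\qquad w(t,t_i)=\frac{K(|t_i-t|/b)}{\sum_{l=1}^nK(|t_l-t|/b)}.$$ Let $\hat\Omega_\lambda(t)=(\hat\omega_{jk}(t))$ be any minimizer of $\sum_{j,k}|\Theta_{jk}|$ over the matrices $\Theta\in\mathbb R^{p\times p}$ with $\max_{j,k}|(\hat\Sigma(t)\Theta-\mathrm{Id}_p)_{jk}|\le\lambda$ (an arbitrary matrix if there is no such $\Theta$). Put $\tilde\omega_{jk}(t)=\min(\hat\omega_{jk}(t),\hat\omega_{kj}(t))$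 and $\hat g_{jk}(t;u)=\mathbf 1\{|\tilde\omega_{jk}(t)|\ge u\}$. **Claim.** There is a constant $C>0$ such that for every constant $C'$ there is a constant $C_{0,\min}>0$, all of them depending only on $q,A,\nu,L,L',C_1,C_2,K$ (and $C_{0,\min}$ also on $C'$), such that the following holds for every constant $C_0\ge C_{0,\min}$. If $$C\kappa_p\Big(b_\sharp^2+\frac{J_{q,A}(n,p)}{nb_\sharp}+\frac{N_X(n\log p)^{1/2}}{nb_\sharp}\Big)\le\lambda\le C'\kappa_pb_\sharp^2$$ and $u_\sharp=C_0\kappa_p^2b_\sharp^2\to0$, then, as $n,p\to\infty$, $$\mathbb P\Big(\sup_{t\in[b_\sharp,1-b_\sharp]}\sum_{(j,k)\in\mathcal E^c(t)}\mathbf 1\{\hat g_{jk}(t;u_\sharp)\ne0\}\ne0\Big)\to0,$$ $$\mathbb P\Big(\sup_{t\in[b_\sharp,1-b_\sharp]}\sum_{(j,k)\in\mathcal E^*(t;2u_\sharp)}\mathbf 1\{\hat g_{jk}(t;u_\sharp)=0\}\ne0\Big)\to0.$$ (Probabilities are outer probabilities where events are not measurable.) -/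

import Mathlib

open MeasureTheory ProbabilityTheory Filter Topology
open scoped ENNReal

noncomputable section

/-! Smoothing kernels -/

/-- A regular kernel: non-negative, symmetric, supported in `[-1,1]`, Lipschitz continuous on
`[-1,1]`, with integral one. (Jumps at `-1` and `1` are allowed, so that the uniform kernel
is covered.) -/
structure IsRegularKernel (K : ℝ → ℝ) : Prop where
  nonneg : ∀ u, 0 ≤ K u
  symm : ∀ u, K (-u) = K u
  support : ∀ u, u ∉ Set.Icc (-1 : ℝ) 1 → K u = 0
  lipschitz : ∃ C : NNReal, LipschitzOnWith C K (Set.Icc (-1 : ℝ) 1)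
  integral_eq_one : ∫ u in (-1 : ℝ)..1, K u = 1

/-! The time series model -/

/-- The data of the model `X°_i(t) = H(F_i; t)`, where `F_i = (…, ε_{i-1}, ε_i)`, in dimension `p`:
the common law of the i.i.d. innovations `ε_i` in `ℝ^p`, and the jointly measurable function `H`.
A past `F_i` is encoded as the sequence `m ↦ ε_{i-m}`. -/
structure CausalModel (p : ℕ) where
  law : Measure (Fin p → ℝ)
  isProbabilityMeasure_law : IsProbabilityMeasure law
  H : (ℕ → Fin p → ℝ) → ℝ → Fin p → ℝ
  measurable_H : Measurable (Function.uncurry H)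

attribute [instance] CausalModel.isProbabilityMeasure_law

namespace CausalModel

variable {p : ℕ} (M : CausalModel p)

/-- The law of the past `F_0` (hence of every `F_i`): i.i.d. innovations. -/
def pastLaw : Measure (ℕ → Fin p → ℝ) := Measure.infinitePi (fun _ : ℕ => M.law)

/-- The joint law of a past and of one further independent innovation. -/
def coupledLaw : Measure ((ℕ → Fin p → ℝ) × (Fin p → ℝ)) := M.pastLaw.prod M.law

/-- The uniform functional dependence measure
`θ_{m,a,j} = sup_{0 ≤ t ≤ 1} ‖X°_{ij}(t) - X°_{ij,{m}}(t)‖_a`: the innovation at lag `m` is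
replaced by an independent copy. The law of this difference does not depend on `i`. -/
def theta (m : ℕ) (a : ℝ) (j : Fin p) : ℝ≥0∞ :=
  ⨆ t ∈ Set.Icc (0 : ℝ) 1,
    eLpNorm (fun z : (ℕ → Fin p → ℝ) × (Fin p → ℝ) =>
      M.H z.1 t j - M.H (Function.update z.1 m z.2) t j) (ENNReal.ofReal a) M.coupledLaw

/-- `Θ_{m,a,j} = ∑_{i ≥ m} θ_{i,a,j}`. -/
def bigTheta (m : ℕ) (a : ℝ) (j : Fin p) : ℝ≥0∞ := ∑' i : ℕ, M.theta (m + i) a j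

/-- The dependence adjusted norm `‖X_{·,j}‖_{a,A} = sup_{m ≥ 0} (m+1)^A Θ_{m,a,j}`. -/
def dan (a A : ℝ) (j : Fin p) : ℝ≥0∞ :=
  ⨆ m : ℕ, ENNReal.ofReal (((m : ℝ) + 1) ^ A) * M.bigTheta m a j

/-- `sup_{t ∈ [0,1]} max_j E |X°_j(t)|^a`. -/
def momentSup (a : ℝ) : ℝ≥0∞ :=
  ⨆ t ∈ Set.Icc (0 : ℝ) 1, ⨆ j : Fin p, ∫⁻ s, ‖M.H s t j‖ₑ ^ a ∂M.pastLaw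

/-- `N_X = max_j ‖X_{·,j}‖_{4,A}`. -/
def NX (A : ℝ) : ℝ := (⨆ j : Fin p, M.dan 4 A j).toReal

/-- `M_{X,q} = (∑_j ‖X_{·,j}‖_{2q,A}^q)^{1/q}`. -/
def MX (q A : ℝ) : ℝ := ((∑ j : Fin p, M.dan (2 * q) A j ^ q) ^ (1 / q)).toReal

/-- The covariance matrix function `Σ(t)`. -/
def cov (t : ℝ) : Matrix (Fin p) (Fin p) ℝ :=
  Matrix.of fun j k => ∫ s, M.H s t j * M.H s t k ∂M.pastLaw

/-- The precision matrix function `Ω(t) = Σ(t)⁻¹`. -/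
def prec (t : ℝ) : Matrix (Fin p) (Fin p) ℝ := (M.cov t)⁻¹

/-- The edge set `E(t) = {(j,k) : ω_{jk}(t) ≠ 0}`. -/
def edges (t : ℝ) : Set (Fin p × Fin p) := {e | M.prec t e.1 e.2 ≠ 0}

/-- The significant edges `E*(t;u) = {(j,k) : |ω_{jk}(t)| > u}`. -/
def sigEdges (t u : ℝ) : Set (Fin p × Fin p) := {e | u < |M.prec t e.1 e.2|}

/-- Mean zero, moments of order `2q` at most `ν`, finite dependence adjusted norms. -/
structure DependenceCondition (q A ν : ℝ) : Prop where
  mean_zero : ∀ t ∈ Set.Icc (0 : ℝ) 1, ∀ j, ∫ s, M.H s t j ∂M.pastLaw = 0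
  moment_le : M.momentSup (2 * q) ≤ ENNReal.ofReal ν
  dan_lt_top : ∀ j, M.dan (2 * q) A j < ⊤

/-- Smoothness without break points: stochastic Lipschitz continuity on `[0,1)` with constant
`L`, and `σ_{jk} ∈ C²[0,1)` with second derivatives bounded by `L'`. -/
structure SmoothnessCondition (L L' : ℝ) : Prop where
  lipschitz : ∀ t ∈ Set.Ico (0 : ℝ) 1, ∀ t' ∈ Set.Ico (0 : ℝ) 1, ∀ j,
    eLpNorm (fun s => M.H s t j - M.H s t' j) 2 M.pastLaw ≤ ENNReal.ofReal (L * |t - t'|)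
  contDiffOn : ∀ j k, ContDiffOn ℝ 2 (fun t => M.cov t j k) (Set.Ico (0 : ℝ) 1)
  deriv2_le : ∀ j k, ∀ t ∈ Set.Ico (0 : ℝ) 1,
    |iteratedDerivWithin 2 (fun t => M.cov t j k) (Set.Ico (0 : ℝ) 1) t| ≤ L'

/-- The precision matrix exists, and `|Ω(t)|_{L¹} = max_k ∑_j |ω_{jk}(t)| ≤ κ` on `[0,1]`. -/
structure SparsityCondition (κ : ℝ) : Prop where
  isUnit_det : ∀ t ∈ Set.Icc (0 : ℝ) 1, IsUnit (M.cov t).det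
  colSum_le : ∀ t ∈ Set.Icc (0 : ℝ) 1, ∀ k, ∑ j, |M.prec t j k| ≤ κ

/-- `ε` is a two-sided i.i.d. sequence with the innovation law of the model. -/
structure IsInnovations {Ω : Type*} [MeasurableSpace Ω] (P : Measure Ω)
    (ε : ℤ → Ω → Fin p → ℝ) : Prop where
  measurable : ∀ i, Measurable (ε i)
  map_eq : ∀ i, P.map (ε i) = M.law
  indep : iIndepFun ε P

/-- The observations `X_{i,n} = H(F_i; i/n)`. -/
def obs {Ω : Type*} (ε : ℤ → Ω → Fin p → ℝ) (n : ℕ) (ω : Ω) (i : ℕ) : Fin p → ℝ :=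
  M.H (fun m : ℕ => ε ((i : ℤ) - (m : ℤ)) ω) ((i : ℝ) / (n : ℝ))

end CausalModel

/-! Rates -/

/-- `ϖ_{q,A}(n)`. -/
def varpi (q A : ℝ) (n : ℕ) : ℝ :=
  if 1 / 2 - 1 / q < A then (n : ℝ)
  else if A = 1 / 2 - 1 / q then (n : ℝ) * Real.log n ^ (1 + 2 * q)
  else (n : ℝ) ^ (q / 2 - A * q)

/-- `J_{q,A}(n,p) = M_{X,q} (p ϖ_{q,A}(n))^{1/q}`. -/
def JqA {p : ℕ} (M : CausalModel p) (q A : ℝ) (n : ℕ) : ℝ :=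
  M.MX q A * ((p : ℝ) * varpi q A n) ^ (1 / q)

/-- The optimal bandwidth
`b_♯ = C₁ (n⁻¹ J_{q,A}(n,p))^{1/3} + C₂ N_X^{1/3} n^{-1/6} (log p)^{1/6}`. -/
def bSharp {p : ℕ} (M : CausalModel p) (q A C₁ C₂ : ℝ) (n : ℕ) : ℝ :=
  C₁ * (JqA M q A n / (n : ℝ)) ^ (1 / 3 : ℝ)
    + C₂ * M.NX A ^ (1 / 3 : ℝ) * (n : ℝ) ^ (-(1 / 6) : ℝ) * Real.log p ^ (1 / 6 : ℝ)

/-- `b² + B_n⁻¹ J_{q,A}(n,p) + N_X B_n⁻¹ (n log p)^{1/2}` with `B_n = n b`. -/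
def uniformRate {p : ℕ} (M : CausalModel p) (q A : ℝ) (n : ℕ) (b : ℝ) : ℝ :=
  b ^ 2 + JqA M q A n / ((n : ℝ) * b)
    + M.NX A * Real.sqrt ((n : ℝ) * Real.log p) / ((n : ℝ) * b)

/-! The estimators -/

/-- `K_b(u,v) = K(|u-v|/b)/b`. -/
def scaledKernel (K : ℝ → ℝ) (b u v : ℝ) : ℝ := K (|u - v| / b) / b

/-- The weights `w(t,t_i)`, `t_i = i/n`. -/
def kernelWeight (K : ℝ → ℝ) (n : ℕ) (b t : ℝ) (i : ℕ) : ℝ :=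
  scaledKernel K b ((i : ℝ) / n) t / ∑ l ∈ Finset.Icc 1 n, scaledKernel K b ((l : ℝ) / n) t

/-- The kernel estimator `Σ̂(t) = ∑_{i=1}^n w(t,t_i) X_i X_iᵀ`. -/
def covHat {p : ℕ} (K : ℝ → ℝ) (n : ℕ) (b : ℝ) (X : ℕ → Fin p → ℝ) (t : ℝ) :
    Matrix (Fin p) (Fin p) ℝ :=
  ∑ i ∈ Finset.Icc 1 n, kernelWeight K n b t i • Matrix.vecMulVec (X i) (X i)

/-- The CLIME constraint `|S Θ - Id|_∞ ≤ lam` (entrywise maximum). -/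
def ClimeFeasible {p : ℕ} (S : Matrix (Fin p) (Fin p) ℝ) (lam : ℝ)
    (Θ : Matrix (Fin p) (Fin p) ℝ) : Prop :=
  ∀ j k, |(S * Θ - 1) j k| ≤ lam

/-- `Θ` minimizes the entrywise norm `|Θ|_1 = ∑_{j,k} |Θ_{jk}|` under the CLIME constraint. -/
def IsClimeSolution {p : ℕ} (S : Matrix (Fin p) (Fin p) ℝ) (lam : ℝ)
    (Θ : Matrix (Fin p) (Fin p) ℝ) : Prop :=
  ClimeFeasible S lam Θ ∧
    ∀ Θ', ClimeFeasible S lam Θ' → ∑ j, ∑ k, |Θ j k| ≤ ∑ j, ∑ k, |Θ' j k|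

/-- The symmetrized entry `ω̃_{jk} = min(ω̂_{jk}, ω̂_{kj})`. -/
def omegaTilde {p : ℕ} (Θ : Matrix (Fin p) (Fin p) ℝ) (e : Fin p × Fin p) : ℝ :=
  min (Θ e.1 e.2) (Θ e.2 e.1)

/-- The thresholded graph `ĝ_{jk}(u) = 1{|ω̃_{jk}| ≥ u}`. -/
def gHat {p : ℕ} (Θ : Matrix (Fin p) (Fin p) ℝ) (u : ℝ) (e : Fin p × Fin p) : ℕ :=
  open Classical in if u ≤ |omegaTilde Θ e| then 1 else 0

/-- The number of pairs outside `E` at which `ĝ ≠ 0`. -/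
def falseCount {p : ℕ} (E : Set (Fin p × Fin p)) (g : Fin p × Fin p → ℕ) : ℕ :=
  open Classical in ∑ e with e ∉ E, if g e ≠ 0 then 1 else 0

/-- The number of pairs in `E` at which `ĝ = 0`. -/
def missedCount {p : ℕ} (E : Set (Fin p × Fin p)) (g : Fin p × Fin p → ℕ) : ℕ :=
  open Classical in ∑ e with e ∈ E, if g e = 0 then 1 else 0

end

noncomputable section

/-! ### Constrained `ℓ¹` minimization -/

section Clime

variable {p : ℕ}

/-! Everything rests on one probabilistic estimate,
`CausalModel.exists_tendsto_measure_covHat_deviation`: with probability tending to one, all entries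
of `Σ̂(t) - Σ(t)` are at most a constant times `uniformRate`, simultaneously for `t ∈ [b, 1-b]`. The
rest is deterministic. On that event `κ` times the error is at most `λ`, so `Ω(t)` is feasible. The
`ℓ¹` program separates over columns, so every column sum of its minimizer is at most `κ`, and hence
`|Ω̂ - Ω| ≤ 2κλ ≤ 2C'κ²b² < u`. Thresholding at `u` then separates the zero entries from those above
`2u` (`SparsityCondition.counts_eq_zero`).

The bias of `Σ̂` is of order `b²` by Taylor expansion and the symmetry of the kernel, up to boundary
and discretization terms of order `N_X/(nb)`. For the stochastic part, summation by parts bounds the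
kernel average by sums of centred products `X_{ij} X_{ik}` over intervals of length about `2nb`. The
supremum over `t` thus costs nothing, and what is needed is a bound uniform over all pairs and all
such intervals, `exists_measure_sum_Ico_deviation_le`.

There each product is decomposed by lag: `lagAvg k` keeps the last `k` innovations and integrates
out the others. The contribution of a single lag, read backwards in time, has the orthogonality of
martingale differences and is controlled in norm by the dependence measure, so its sum over `n`
times has norm of order `√n θ_m` (`exists_eLpNorm_sum_lag_le`). The lags fall into three ranges.

Dyadic layers `[k, 2k)` are cut into blocks of length `2k`. Blocks of equal parity are independent,
and truncation, a Fuk–Nagaev inequality and Etemadi's inequality give a Gaussian term plus a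
polynomial term (`exists_layer_bound`). The lags below a slowly growing `L` would leave a polynomial
term of order one. They are handled instead by a truncation valid for all pairs at once, which gains
a factor `1/p` (`exists_lower_layer_bound`). For the lags above `W`, comparable to `nb`, an interval
meets boundedly many blocks of length `W`, and chaining inside each block is enough
(`exists_remainder_bound`).

The layers share the deviation level through weights of bounded sum. Their choice depends on the
sign of `q/2 - 1 - Aq`, and this is where the three regimes of `varpi` enter
(`exists_layer_weights`). -/

lemma exists_isClimeSolution {S Θ₀ : Matrix (Fin p) (Fin p) ℝ} {lam : ℝ}
    (h₀ : ClimeFeasible S lam Θ₀) : ∃ Θ, IsClimeSolution S lam Θ := by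
  classical
  set c : ℝ := ∑ j, ∑ k, |Θ₀ j k| with hc
  let obj : (Fin p → Fin p → ℝ) → ℝ := fun Θ => ∑ j, ∑ k, |Θ j k|
  have hobj : Continuous obj := by fun_prop
  let F : Set (Fin p → Fin p → ℝ) :=
    {Θ | ClimeFeasible S lam (Matrix.of Θ)}
  have hFc : IsClosed F := by
    have : F = ⋂ j, ⋂ k, {Θ : Fin p → Fin p → ℝ |
        |(∑ l, S j l * Θ l k) - (1 : Matrix (Fin p) (Fin p) ℝ) j k| ≤ lam} := by
      ext Θ
      simp [F, ClimeFeasible, Matrix.mul_apply, Matrix.sub_apply]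
    rw [this]
    refine isClosed_iInter fun j => isClosed_iInter fun k => isClosed_le ?_ continuous_const
    fun_prop
  -- The feasible set need not be bounded. The minimum is sought in the box of radius `c`, the
  -- objective value at `Θ₀`; a matrix outside it has a larger objective.
  let B : Set (Fin p → Fin p → ℝ) :=
    Set.pi Set.univ fun _ => Set.pi Set.univ fun _ => Set.Icc (-c) c
  have hB : IsCompact B :=
    isCompact_univ_pi fun _ => isCompact_univ_pi fun _ => isCompact_Icc
  have hle : ∀ (Θ : Fin p → Fin p → ℝ) j k, |Θ j k| ≤ obj Θ := fun Θ j k =>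
    (Finset.single_le_sum (f := fun k => |Θ j k|) (fun _ _ => abs_nonneg _)
      (Finset.mem_univ k)).trans
      (Finset.single_le_sum (f := fun j => ∑ k, |Θ j k|)
        (fun _ _ => Finset.sum_nonneg fun _ _ => abs_nonneg _) (Finset.mem_univ j))
  have hmemB : ∀ Θ, obj Θ ≤ c → Θ ∈ B := fun Θ hΘ j _ k _ =>
    abs_le.1 ((hle Θ j k).trans hΘ)
  obtain ⟨Θ, hΘ, hmin⟩ := (hB.inter_right hFc).exists_isMinOn
    ⟨fun j k => Θ₀ j k, hmemB _ le_rfl, h₀⟩ hobj.continuousOn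
  refine ⟨Matrix.of Θ, hΘ.2, fun Θ' hΘ' => ?_⟩
  by_cases hc' : obj (fun j k => Θ' j k) ≤ c
  · exact hmin ⟨hmemB _ hc', hΘ'⟩
  · exact (hmin (a := fun j k => Θ₀ j k) ⟨hmemB _ le_rfl, h₀⟩).trans (not_le.1 hc').le

/-- Both the objective and the constraint separate over columns: exchanging one column for that of
another feasible matrix stays feasible, and minimality then compares this column alone. -/
lemma IsClimeSolution.colSum_le {S Θ Θ' : Matrix (Fin p) (Fin p) ℝ} {lam : ℝ}
    (h : IsClimeSolution S lam Θ) (h' : ClimeFeasible S lam Θ') (k : Fin p) :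
    ∑ j, |Θ j k| ≤ ∑ j, |Θ' j k| := by
  classical
  have hf : ClimeFeasible S lam (Θ.updateCol k fun j => Θ' j k) := by
    intro j l
    have e : (S * Θ.updateCol k fun j => Θ' j k) j l
        = if l = k then (S * Θ') j k else (S * Θ) j l := by
      simp only [Matrix.mul_apply, Matrix.updateCol_apply]
      split_ifs <;> rfl
    rw [Matrix.sub_apply, e]
    split_ifs with hl
    · subst hl; exact h' j l
    · exact h.1 j l
  have key := h.2 _ hf
  rw [Finset.sum_comm, Finset.sum_comm (f := fun j l => |Θ.updateCol k (fun j => Θ' j k) j l|),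
    ← Finset.add_sum_erase _ _ (Finset.mem_univ k),
    ← Finset.add_sum_erase _ (fun l => ∑ j, |Θ.updateCol k (fun j => Θ' j k) j l|)
      (Finset.mem_univ k)] at key
  have e : ∀ l ∈ Finset.univ.erase k, ∑ j, |Θ.updateCol k (fun j => Θ' j k) j l|
      = ∑ j, |Θ j l| := by
    intro l hl
    simp [Finset.ne_of_mem_erase hl]
  rw [Finset.sum_congr rfl e] at key
  have e' : ∀ j, Θ.updateCol k (fun j => Θ' j k) j k = Θ' j k := fun j => by simp
  simp only [e'] at key
  linarith

lemma abs_mul_apply_le_of_colSum {D Θ : Matrix (Fin p) (Fin p) ℝ} {δ κ : ℝ} (hδ : 0 ≤ δ)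
    (hD : ∀ j k, |D j k| ≤ δ) (hΘ : ∀ k, ∑ j, |Θ j k| ≤ κ) (j k : Fin p) :
    |(D * Θ) j k| ≤ δ * κ := by
  rw [Matrix.mul_apply]
  calc |∑ l, D j l * Θ l k| ≤ ∑ l, |D j l * Θ l k| := Finset.abs_sum_le_sum_abs _ _
    _ ≤ ∑ l, δ * |Θ l k| := by
        refine Finset.sum_le_sum fun l _ => ?_
        rw [abs_mul]
        exact mul_le_mul_of_nonneg_right (hD j l) (abs_nonneg _)
    _ = δ * ∑ l, |Θ l k| := by rw [Finset.mul_sum]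
    _ ≤ δ * κ := mul_le_mul_of_nonneg_left (hΘ k) hδ

/-- Since `S Θ = 1`, the residual is `(Sh - S) Θ`. This is where the lower bound on `λ` is needed.
-/
lemma climeFeasible_of_approx {S Sh Θ : Matrix (Fin p) (Fin p) ℝ} {lam δ κ : ℝ}
    (hSΘ : S * Θ = 1) (hΘ : ∀ k, ∑ j, |Θ j k| ≤ κ) (hδ : 0 ≤ δ)
    (hS : ∀ j k, |Sh j k - S j k| ≤ δ) (hlam : δ * κ ≤ lam) :
    ClimeFeasible Sh lam Θ := by
  intro j k
  have e : Sh * Θ - 1 = (Sh - S) * Θ := by rw [Matrix.sub_mul, hSΘ]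
  rw [e]
  exact (abs_mul_apply_le_of_colSum hδ (fun j k => hS j k) hΘ j k).trans hlam

/-- The minimizer inherits the column bound `κ`, so replacing `Sh` by `S` changes its residual by at
most `δκ ≤ λ`. Multiplying the residual, now at most `2λ`, by `Θ` costs another factor `κ`. -/
lemma IsClimeSolution.abs_sub_le {S Sh Θ Θh : Matrix (Fin p) (Fin p) ℝ} {lam δ κ : ℝ}
    (hsymm : Θ.transpose = Θ) (hΘS : Θ * S = 1) (hΘ : ∀ k, ∑ j, |Θ j k| ≤ κ)
    (hδ : 0 ≤ δ) (hS : ∀ j k, |Sh j k - S j k| ≤ δ) (hlam : δ * κ ≤ lam)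
    (hsol : IsClimeSolution Sh lam Θh) (j k : Fin p) :
    |Θh j k - Θ j k| ≤ 2 * κ * lam := by
  have hSΘ : S * Θ = 1 := mul_eq_one_comm.1 hΘS
  have hfeas := climeFeasible_of_approx hSΘ hΘ hδ hS hlam
  have hcol : ∀ k, ∑ j, |Θh j k| ≤ κ := fun k => (hsol.colSum_le hfeas k).trans (hΘ k)
  have hlam0 : 0 ≤ lam := (abs_nonneg _).trans (hsol.1 j k)
  have hres : ∀ j k, |(S * Θh - 1) j k| ≤ 2 * lam := by
    intro j k
    have e : S * Θh - 1 = (Sh * Θh - 1) - (Sh - S) * Θh := by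
      rw [Matrix.sub_mul]; abel
    rw [e, Matrix.sub_apply]
    calc _ ≤ |(Sh * Θh - 1) j k| + |((Sh - S) * Θh) j k| := abs_sub _ _
      _ ≤ lam + δ * κ :=
        add_le_add (hsol.1 j k) (abs_mul_apply_le_of_colSum hδ (fun j k => hS j k) hcol j k)
      _ ≤ 2 * lam := by linarith
  -- The natural identity `Θh - Θ = Θ (S Θh - 1)` would call for row sums of `Θ`; transposing it, by
  -- symmetry of `Θ`, makes the column sums available.
  have e : Θh - Θ = ((S * Θh - 1).transpose * Θ).transpose := by
    rw [Matrix.transpose_mul, Matrix.transpose_transpose, hsymm, Matrix.mul_sub,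
      ← Matrix.mul_assoc, hΘS, Matrix.one_mul, Matrix.mul_one]
  have := abs_mul_apply_le_of_colSum (D := (S * Θh - 1).transpose) (by positivity)
    (fun j k => hres k j) hΘ k j
  rw [← Matrix.sub_apply, e, Matrix.transpose_apply]
  linarith

lemma falseCount_eq_zero {E : Set (Fin p × Fin p)} {g : Fin p × Fin p → ℕ}
    (h : ∀ e, e ∉ E → g e = 0) : falseCount E g = 0 := by
  classical
  unfold falseCount
  refine Finset.sum_eq_zero fun e he => ?_
  rw [Finset.mem_filter] at he
  simp [h e he.2]

lemma missedCount_eq_zero {E : Set (Fin p × Fin p)} {g : Fin p × Fin p → ℕ}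
    (h : ∀ e ∈ E, g e ≠ 0) : missedCount E g = 0 := by
  classical
  unfold missedCount
  refine Finset.sum_eq_zero fun e he => ?_
  rw [Finset.mem_filter] at he
  simp [h e he.2]

lemma abs_omegaTilde_sub_le {Θ Θh : Matrix (Fin p) (Fin p) ℝ} {c : ℝ}
    (hsymm : Θ.transpose = Θ) (h : ∀ j k, |Θh j k - Θ j k| ≤ c) (e : Fin p × Fin p) :
    |omegaTilde Θh e - Θ e.1 e.2| ≤ c := by
  have h1 := h e.1 e.2
  have h2 := h e.2 e.1
  have h3 : Θ e.2 e.1 = Θ e.1 e.2 := congr_fun (congr_fun hsymm e.1) e.2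
  rw [h3] at h2
  unfold omegaTilde
  rcases min_choice (Θh e.1 e.2) (Θh e.2 e.1) with h | h <;> rw [h] <;> assumption

end Clime

/-! ### Elementary inequalities -/

section Elementary

lemma exp_le_one_add_add_sq (v : ℝ) : Real.exp v ≤ 1 + v + v ^ 2 * Real.exp |v| := by
  rcases le_or_gt |v| 1 with h | h
  · have h1 := (abs_le.1 (Real.abs_exp_sub_one_sub_id_le h)).2
    have h2 : 1 ≤ Real.exp |v| := Real.one_le_exp (abs_nonneg v)
    nlinarith [sq_nonneg v]
  · rcases le_or_gt 0 v with hv | hv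
    · rw [abs_of_nonneg hv] at *
      have : 1 ≤ v ^ 2 := by nlinarith
      nlinarith [Real.exp_pos v]
    · rw [abs_of_neg hv] at *
      have h1 : Real.exp v ≤ 1 := Real.exp_le_one_iff.2 hv.le
      have h2 : 1 ≤ Real.exp (-v) := Real.one_le_exp (by linarith)
      nlinarith [sq_nonneg v]

lemma exp_le_one_add_add_sq_of_nonpos {v : ℝ} (hv : v ≤ 0) : Real.exp v ≤ 1 + v + v ^ 2 := by
  rcases le_or_gt (-1) v with h | h
  · have h1 := (abs_le.1 (Real.abs_exp_sub_one_sub_id_le (abs_le.2 ⟨h, by linarith⟩))).2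
    linarith
  · have h1 : Real.exp v ≤ 1 := Real.exp_le_one_iff.2 hv
    nlinarith

/-- Pointwise bound on the exponential of a variable bounded by `y`. -/
lemma exp_mul_le_of_abs_le {q h y z : ℝ} (hq : 2 ≤ q) (hh : 0 < h) (hy : 0 < y) (hz : |z| ≤ y) :
    Real.exp (h * z) ≤ 1 + h * z + Real.exp q * h ^ 2 * z ^ 2
      + Real.exp (h * y) * (|z| ^ q / y ^ q) := by
  have hlast : 0 ≤ Real.exp (h * y) * (|z| ^ q / y ^ q) := by positivity
  have he1 : 1 ≤ Real.exp q := Real.one_le_exp (by linarith)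
  have hv2 : 0 ≤ h ^ 2 * z ^ 2 := by positivity
  rcases le_or_gt (h * z) q with hv | hv
  · rcases le_or_gt (h * z) 0 with h0 | h0
    · have := exp_le_one_add_add_sq_of_nonpos h0
      rw [mul_pow] at this
      nlinarith
    · have := exp_le_one_add_add_sq (h * z)
      rw [abs_of_pos h0, mul_pow] at this
      have h3 : Real.exp (h * z) ≤ Real.exp q := Real.exp_le_exp.2 hv
      nlinarith
  · have hq0 : 0 < q := by linarith
    have hz0 : 0 < z := by
      by_contra hcon
      have : h * z ≤ 0 := mul_nonpos_of_nonneg_of_nonpos hh.le (not_lt.1 hcon)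
      linarith
    rw [abs_of_pos hz0] at hz ⊢
    -- The function `z ↦ exp (h z) / z ^ q` increases on `z ≥ q / h`, the range of this case, so its
    -- value at `z` is at most the one at `y`.
    have key : Real.exp (h * z) ≤ Real.exp (h * y) * (z ^ q / y ^ q) := by
      rw [← Real.div_rpow hz0.le hy.le, Real.rpow_def_of_pos (by positivity), ← Real.exp_add]
      refine Real.exp_le_exp.2 ?_
      have hl : Real.log (y / z) ≤ y / z - 1 := Real.log_le_sub_one_of_pos (by positivity)
      have hl' : Real.log (z / y) = - Real.log (y / z) := by rw [← Real.log_inv, inv_div]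
      rw [hl']
      have h5 : q * (y / z - 1) ≤ h * y - h * z := by
        have : y / z - 1 = (y - z) / z := by field_simp
        rw [this, ← mul_div_assoc, div_le_iff₀ hz0]
        nlinarith
      nlinarith
    nlinarith

/-- A second-order expansion of `|x| ^ a` with the linear term kept exact, since for martingale
differences it integrates to zero. If `|x| ≤ |y|`, all terms are absorbed in `|y| ^ a`; otherwise `u
= y / x` satisfies `|u| ≤ 1` and `(1 + u) ^ a ≤ exp (a u)` is expanded. -/
lemma exists_abs_add_rpow_le {a : ℝ} (ha : 2 ≤ a) : ∃ C : ℝ, 1 ≤ C ∧ ∀ x y : ℝ,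
    |x + y| ^ a ≤ |x| ^ a + a * (|x| ^ (a - 2) * x * y)
      + C * (|x| ^ (a - 2) * y ^ 2 + |y| ^ a) := by
  refine ⟨3 ^ a + a * 2 ^ a + a ^ 2 * Real.exp a, ?_, fun x y => ?_⟩
  · have : (1:ℝ) ≤ 3 ^ a := Real.one_le_rpow (by norm_num) (by linarith)
    have : 0 ≤ a * 2 ^ a := by positivity
    have : 0 ≤ a ^ 2 * Real.exp a := by positivity
    linarith
  set c₁ : ℝ := 3 ^ a + a * 2 ^ a
  set c₂ : ℝ := a ^ 2 * Real.exp a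
  have hc₁ : 0 ≤ c₁ := by positivity
  have hc₂ : 0 ≤ c₂ := by positivity
  have hx2 : 0 ≤ |x| ^ (a - 2) * y ^ 2 := by positivity
  have hya : 0 ≤ |y| ^ a := by positivity
  rcases le_or_gt |x| |y| with h | h
  · have h1 : |x + y| ^ a ≤ 3 ^ a * |y| ^ a := by
      rw [← Real.mul_rpow (by norm_num) (abs_nonneg y)]
      refine Real.rpow_le_rpow (abs_nonneg _) ?_ (by linarith)
      linarith [abs_add_le x y, abs_nonneg y]
    have h2 : -(|y| ^ a) ≤ |x| ^ (a - 2) * x * y := by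
      have : |(|x| ^ (a - 2) * x * y)| ≤ |y| ^ a := by
        rw [abs_mul, abs_mul, abs_of_nonneg (by positivity : 0 ≤ |x| ^ (a - 2))]
        calc |x| ^ (a - 2) * |x| * |y| ≤ |y| ^ (a - 2) * |y| * |y| := by
              gcongr
          _ = |y| ^ a := by
              rcases eq_or_lt_of_le (abs_nonneg y) with h0 | h0
              · have h0a : (0 : ℝ) ^ a = 0 := Real.zero_rpow (by linarith)
                rw [← h0, h0a]; simp
              · rw [mul_assoc, ← sq, ← Real.rpow_natCast |y| 2, ← Real.rpow_add h0]
                norm_num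
      exact (abs_le.1 this).1
    have h3 : (1:ℝ) ≤ 2 ^ a := Real.one_le_rpow (by norm_num) (by linarith)
    have h4 : a * |y| ^ a ≤ a * 2 ^ a * |y| ^ a := by
      have : 0 ≤ a * |y| ^ a := by positivity
      nlinarith
    have h5 : 0 ≤ |x| ^ a := by positivity
    have h6 : c₁ * |y| ^ a = 3 ^ a * |y| ^ a + a * 2 ^ a * |y| ^ a := by simp only [c₁]; ring
    nlinarith [mul_nonneg hc₁ hx2, mul_nonneg hc₂ hx2, mul_nonneg hc₂ hya]
  · have hx0 : 0 < |x| := (abs_nonneg y).trans_lt h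
    have hxne : x ≠ 0 := abs_pos.1 hx0
    set u := y / x with hu
    have hu1 : |u| ≤ 1 := by
      rw [hu, abs_div, div_le_one hx0]; exact h.le
    have h1u : 0 ≤ 1 + u := by linarith [(abs_le.1 hu1).1]
    have e1 : |x + y| ^ a = |x| ^ a * (1 + u) ^ a := by
      rw [← Real.mul_rpow hx0.le h1u, ← abs_of_nonneg h1u, ← abs_mul, hu]
      congr 2
      field_simp
    have e2 : |x| ^ (a - 2) = |x| ^ a / x ^ 2 := by
      rw [Real.rpow_sub hx0, Real.rpow_two, sq_abs]
    have h2 : (1 + u) ^ a ≤ 1 + a * u + c₂ * u ^ 2 := by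
      calc (1 + u) ^ a ≤ Real.exp u ^ a := by
            refine Real.rpow_le_rpow h1u ?_ (by linarith)
            linarith [Real.add_one_le_exp u]
        _ = Real.exp (a * u) := by rw [← Real.exp_mul, mul_comm]
        _ ≤ 1 + a * u + (a * u) ^ 2 * Real.exp |a * u| := exp_le_one_add_add_sq _
        _ ≤ 1 + a * u + (a * u) ^ 2 * Real.exp a := by
            gcongr
            rw [abs_mul, abs_of_nonneg (by linarith : 0 ≤ a)]
            nlinarith [abs_nonneg u]
        _ = 1 + a * u + c₂ * u ^ 2 := by simp only [c₂]; ring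
    have h3 : |x + y| ^ a ≤ |x| ^ a + a * (|x| ^ (a - 2) * x * y)
        + c₂ * (|x| ^ (a - 2) * y ^ 2) := by
      rw [e1, e2]
      calc |x| ^ a * (1 + u) ^ a ≤ |x| ^ a * (1 + a * u + c₂ * u ^ 2) := by gcongr
        _ = _ := by rw [hu]; field_simp
    nlinarith [mul_nonneg hc₁ hx2, mul_nonneg hc₁ hya, mul_nonneg hc₂ hya]

/-- The mean of two lower bounds, superadditivity of the power and Bernoulli's inequality. The
moment induction has to absorb both error terms at the same time. -/
lemma rpow_add_half_le {r u v : ℝ} (hr : 1 ≤ r) (hu : 0 ≤ u) (hv : 0 ≤ v) :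
    u ^ r + (v ^ r + r * u ^ (r - 1) * v) / 2 ≤ (u + v) ^ r := by
  have h1 : u ^ r + v ^ r ≤ (u + v) ^ r := Real.add_rpow_le_rpow_add hu hv hr
  have h2 : u ^ r + r * u ^ (r - 1) * v ≤ (u + v) ^ r := by
    rcases eq_or_lt_of_le hu with h0 | h0
    · subst h0
      rcases eq_or_lt_of_le hr with h | h
      · subst h; simp
      · rw [Real.zero_rpow (by linarith), Real.zero_rpow (by linarith)]
        simp only [mul_zero, zero_mul, zero_add]
        positivity
    · have hb : 1 + r * (v / u) ≤ (1 + v / u) ^ r :=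
        one_add_mul_self_le_rpow_one_add (by linarith [div_nonneg hv hu]) hr
      have e : (u + v) ^ r = u ^ r * (1 + v / u) ^ r := by
        rw [← Real.mul_rpow hu (by positivity)]
        congr 1; field_simp
      have hp : 0 < u ^ r := by positivity
      rw [e, Real.rpow_sub_one h0.ne']
      calc u ^ r + r * (u ^ r / u) * v = u ^ r * (1 + r * (v / u)) := by field_simp
        _ ≤ _ := by gcongr
  linarith

lemma rpow_mul_rpow_le_add {a x y : ℝ} (ha : 2 ≤ a) (hx : 0 ≤ x) (hy : 0 ≤ y) :
    x ^ (a - 2) * y ^ 2 ≤ x ^ a + y ^ a := by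
  have key : ∀ z : ℝ, 0 ≤ z → z ^ (a - 2) * z ^ 2 = z ^ a := by
    intro z hz
    rcases eq_or_lt_of_le hz with h0 | h0
    · have h0a : (0 : ℝ) ^ a = 0 := Real.zero_rpow (by linarith)
      rw [← h0, h0a]; simp
    · rw [← Real.rpow_natCast z 2, ← Real.rpow_add h0]; norm_num
  rcases le_total x y with h | h
  · calc x ^ (a - 2) * y ^ 2 ≤ y ^ (a - 2) * y ^ 2 := by gcongr
      _ = y ^ a := key y hy
      _ ≤ _ := by linarith [Real.rpow_nonneg hx a]
  · calc x ^ (a - 2) * y ^ 2 ≤ x ^ (a - 2) * x ^ 2 := by gcongr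
      _ = x ^ a := key x hx
      _ ≤ _ := by linarith [Real.rpow_nonneg hy a]

end Elementary

/-! ### Moment and tail inequalities -/

section FukNagaev

/-- A Fuk–Nagaev inequality for independent variables bounded by `y`. -/
lemma fukNagaev_of_bounded {Ω ι : Type*} [MeasurableSpace Ω] {P : Measure Ω}
    [IsProbabilityMeasure P] {Z : ι → Ω → ℝ} (hind : iIndepFun Z P)
    (hmeas : ∀ i, Measurable (Z i)) (s : Finset ι) {q y V m x : ℝ} (hq : 2 ≤ q) (hy : 0 < y)
    (hV : 0 < V) (hm : 0 < m) (hx : 0 < x) (hZ : ∀ i ω, |Z i ω| ≤ y)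
    (hmean : ∑ i ∈ s, ∫ ω, Z i ω ∂P ≤ m / y ^ (q - 1))
    (hvar : ∑ i ∈ s, ∫ ω, Z i ω ^ 2 ∂P ≤ V)
    (hmom : ∑ i ∈ s, ∫ ω, |Z i ω| ^ q ∂P ≤ m) :
    P.real {ω | x ≤ ∑ i ∈ s, Z i ω} ≤
      Real.exp 2 * (Real.exp (-(x ^ 2 / (4 * Real.exp q * V))) + (m / y ^ q) ^ (x / (2 * y))) := by
  have hyq : 0 < y ^ q := by positivity
  -- When `y ^ q ≤ m` the polynomial term is at least one and the claim is trivial. Otherwise `ρ = y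
  -- ^ q / m` exceeds one and has a positive logarithm.
  have hxy : 0 ≤ x / (2 * y) := by positivity
  have he2 : 1 ≤ Real.exp 2 := Real.one_le_exp (by norm_num)
  rcases le_or_gt (y ^ q) m with hcase | hcase
  · have h1 : 1 ≤ (m / y ^ q) ^ (x / (2 * y)) :=
      Real.one_le_rpow ((one_le_div hyq).2 hcase) hxy
    have h2 : P.real {ω | x ≤ ∑ i ∈ s, Z i ω} ≤ 1 := measureReal_le_one
    have h3 := Real.exp_pos (-(x ^ 2 / (4 * Real.exp q * V)))
    nlinarith
  set ρ := y ^ q / m with hρ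
  have hρ1 : 1 < ρ := (one_lt_div hm).2 hcase
  have hlog : 0 < Real.log ρ := Real.log_pos hρ1
  -- The first bound on the tilt `h` lets the variance term use up only half of the exponent `h x`.
  -- The second gives `exp (h y) ≤ ρ`, so the terms from the mean and from the `q`-th moment
  -- contribute at most one each. The smaller of the two decides whether the Gaussian or the
  -- polynomial term results.
  set h := min (x / (2 * Real.exp q * V)) (Real.log ρ / y) with hh
  have hh0 : 0 < h := lt_min (by positivity) (by positivity)
  have hh1 : h ≤ x / (2 * Real.exp q * V) := min_le_left _ _
  have hh2 : h * y ≤ Real.log ρ := by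
    rw [← le_div_iff₀ hy]; exact min_le_right _ _
  have hbd : ∀ (c : ℝ) (g : ℝ → ℝ), Measurable g → (∀ z, |z| ≤ y → |g z| ≤ c) →
      ∀ i, Integrable (fun ω => g (Z i ω)) P := fun c g hg hc i =>
    Integrable.of_bound (hg.comp (hmeas i)).aestronglyMeasurable c
      (ae_of_all _ fun ω => hc _ (hZ i ω))
  have i1 := hbd y (fun z => z) measurable_id fun z hz => hz
  have i2 := hbd (y ^ 2) (fun z => z ^ 2) (by fun_prop) fun z hz => by
    rw [abs_of_nonneg (sq_nonneg z), ← sq_abs z]; gcongr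
  have i3 := hbd (y ^ q) (fun z => |z| ^ q) (by fun_prop) fun z hz => by
    rw [abs_of_nonneg (by positivity)]; gcongr
  have i4 := hbd (Real.exp (h * y)) (fun z => Real.exp (h * z)) (by fun_prop) fun z hz => by
    rw [abs_of_nonneg (Real.exp_pos _).le]
    gcongr
    exact (le_abs_self z).trans hz
  have hmgf : ∀ i, mgf (Z i) P h ≤ Real.exp (h * ∫ ω, Z i ω ∂P
      + Real.exp q * h ^ 2 * ∫ ω, Z i ω ^ 2 ∂P
      + Real.exp (h * y) * (∫ ω, |Z i ω| ^ q ∂P) / y ^ q) := by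
    intro i
    calc mgf (Z i) P h ≤ ∫ ω, (1 + h * Z i ω + Real.exp q * h ^ 2 * Z i ω ^ 2
          + Real.exp (h * y) * (|Z i ω| ^ q / y ^ q)) ∂P := by
          refine integral_mono (i4 i) ?_ fun ω => exp_mul_le_of_abs_le hq hh0 hy (hZ i ω)
          exact (((integrable_const _).add ((i1 i).const_mul _)).add ((i2 i).const_mul _)).add
            (((i3 i).div_const _).const_mul _)
      _ = 1 + (h * ∫ ω, Z i ω ∂P + Real.exp q * h ^ 2 * ∫ ω, Z i ω ^ 2 ∂P
          + Real.exp (h * y) * (∫ ω, |Z i ω| ^ q ∂P) / y ^ q) := by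
          rw [integral_add, integral_add, integral_add, integral_const_mul, integral_const_mul,
            integral_const_mul, integral_div]
          · simp; ring
          · exact integrable_const _
          · exact (i1 i).const_mul _
          · exact (integrable_const _).add ((i1 i).const_mul _)
          · exact (i2 i).const_mul _
          · exact ((integrable_const _).add ((i1 i).const_mul _)).add ((i2 i).const_mul _)
          · exact ((i3 i).div_const _).const_mul _
      _ ≤ _ := by linarith [Real.add_one_le_exp (h * ∫ ω, Z i ω ∂P
          + Real.exp q * h ^ 2 * ∫ ω, Z i ω ^ 2 ∂P
          + Real.exp (h * y) * (∫ ω, |Z i ω| ^ q ∂P) / y ^ q)]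
  have hsum : mgf (∑ i ∈ s, Z i) P h ≤ Real.exp (2 + Real.exp q * h ^ 2 * V) := by
    rw [hind.mgf_sum hmeas s]
    refine (Finset.prod_le_prod (fun _ _ => mgf_nonneg) fun i _ => hmgf i).trans ?_
    rw [← Real.exp_sum]
    refine Real.exp_le_exp.2 ?_
    rw [Finset.sum_add_distrib, Finset.sum_add_distrib, ← Finset.mul_sum, ← Finset.mul_sum,
      ← Finset.sum_div, ← Finset.mul_sum]
    have a1 : h * ∑ i ∈ s, ∫ ω, Z i ω ∂P ≤ 1 := by
      calc h * ∑ i ∈ s, ∫ ω, Z i ω ∂P ≤ h * (m / y ^ (q - 1)) := by gcongr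
        _ = h * y / ρ := by
            rw [hρ, Real.rpow_sub_one hy.ne']; field_simp
        _ ≤ Real.log ρ / ρ := by gcongr
        _ ≤ 1 := by
            rw [div_le_one (by linarith)]
            linarith [Real.log_le_sub_one_of_pos (by linarith : 0 < ρ)]
    have a2 : Real.exp q * h ^ 2 * ∑ i ∈ s, ∫ ω, Z i ω ^ 2 ∂P ≤ Real.exp q * h ^ 2 * V := by
      gcongr
    have a3 : Real.exp (h * y) * (∑ i ∈ s, ∫ ω, |Z i ω| ^ q ∂P) / y ^ q ≤ 1 := by
      have : Real.exp (h * y) ≤ ρ := by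
        rw [← Real.exp_log (by linarith : 0 < ρ)]; exact Real.exp_le_exp.2 hh2
      calc _ ≤ ρ * m / y ^ q := by
            gcongr
        _ = 1 := by rw [hρ]; field_simp
    linarith
  have hint : Integrable (fun ω => Real.exp (h * (∑ i ∈ s, Z i) ω)) P := by
    refine Integrable.of_bound (C := Real.exp (h * (s.card * y))) ?_ (ae_of_all _ fun ω => ?_)
    · have : Measurable (∑ i ∈ s, Z i) := by
        rw [show (∑ i ∈ s, Z i) = fun ω => ∑ i ∈ s, Z i ω from by ext ω; simp]
        exact Finset.measurable_sum _ fun i _ => hmeas i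
      exact (by fun_prop : Measurable fun ω => Real.exp (h * (∑ i ∈ s, Z i) ω)).aestronglyMeasurable
    · rw [Real.norm_eq_abs, abs_of_pos (Real.exp_pos _), Finset.sum_apply]
      gcongr
      calc ∑ i ∈ s, Z i ω ≤ ∑ i ∈ s, y :=
            Finset.sum_le_sum fun i _ => (le_abs_self _).trans (hZ i ω)
        _ = s.card * y := by simp
  have hch := measure_ge_le_exp_mul_mgf (μ := P) (X := ∑ i ∈ s, Z i) x hh0.le hint
  simp only [Finset.sum_apply] at hch
  have hfin : P.real {ω | x ≤ ∑ i ∈ s, Z i ω} ≤ Real.exp 2 * Real.exp (-(h * x / 2)) := by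
    refine hch.trans ((mul_le_mul_of_nonneg_left hsum (Real.exp_pos _).le).trans ?_)
    rw [← Real.exp_add, ← Real.exp_add]
    refine Real.exp_le_exp.2 ?_
    have : h * (2 * Real.exp q * V) ≤ x := (le_div_iff₀ (by positivity)).1 hh1
    nlinarith
  refine hfin.trans (mul_le_mul_of_nonneg_left ?_ (Real.exp_pos _).le)
  have p1 := Real.exp_pos (-(x ^ 2 / (4 * Real.exp q * V)))
  have p2 : 0 < (m / y ^ q) ^ (x / (2 * y)) := by positivity
  rcases min_choice (x / (2 * Real.exp q * V)) (Real.log ρ / y) with hc | hc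
  · have : h * x / 2 = x ^ 2 / (4 * Real.exp q * V) := by rw [hh, hc]; field_simp; ring
    rw [this]; linarith
  · have : Real.exp (-(h * x / 2)) = (m / y ^ q) ^ (x / (2 * y)) := by
      rw [Real.rpow_def_of_pos (by positivity), hh, hc]
      have : Real.log (m / y ^ q) = - Real.log ρ := by rw [← Real.log_inv, hρ, inv_div]
      rw [this]
      congr 1
      field_simp
    rw [this]; linarith

end FukNagaev

section Etemadi

/-- Etemadi's maximal inequality. -/
lemma etemadi {Ω : Type*} [MeasurableSpace Ω] {P : Measure Ω}
    [IsProbabilityMeasure P] {B : ℕ → Ω → ℝ} (hind : iIndepFun B P)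
    (hmeas : ∀ i, Measurable (B i)) (R : ℕ) {x : ℝ} {α : ℝ≥0∞}
    (hα : ∀ k ≤ R, P {ω | x < |∑ i ∈ Finset.range k, B i ω|} ≤ α) :
    P {ω | ∃ k ≤ R, 3 * x < |∑ i ∈ Finset.range k, B i ω|} ≤ 3 * α := by
  set S : ℕ → Ω → ℝ := fun k ω => ∑ i ∈ Finset.range k, B i ω with hS
  have hSm : ∀ k, Measurable (S k) := fun k => Finset.measurable_sum _ fun i _ => hmeas i
  -- First passage at time `k`. Then either `|S R| > x`, or the remaining increment exceeds `2x`;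
  -- that increment is independent of `A k`.
  let A : ℕ → Set Ω := fun k => {ω | 3 * x < |S k ω| ∧ ∀ j < k, |S j ω| ≤ 3 * x}
  have hAm : ∀ k, MeasurableSet (A k) := by
    intro k
    have : A k = {ω | 3 * x < |S k ω|} ∩ ⋂ j, ⋂ (_ : j < k), {ω | |S j ω| ≤ 3 * x} := by
      ext ω; simp [A]
    rw [this]
    exact (measurableSet_lt measurable_const (hSm k).abs).inter
      (MeasurableSet.iInter fun j => MeasurableSet.iInter fun _ =>
        measurableSet_le (hSm j).abs measurable_const)
  have hdisj : Pairwise (Function.onFun Disjoint A) := by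
    intro i j hij
    refine Set.disjoint_left.2 fun ω hi hj => ?_
    rcases lt_or_gt_of_ne hij with h | h
    · exact absurd hi.1 (not_lt.2 (hj.2 i h))
    · exact absurd hj.1 (not_lt.2 (hi.2 j h))
  have hcov : {ω | ∃ k ≤ R, 3 * x < |S k ω|} ⊆
      {ω | x < |S R ω|} ∪ ⋃ k ∈ Finset.range (R + 1), A k ∩ {ω | 2 * x < |S R ω - S k ω|} := by
    rintro ω ⟨k, hk, hω⟩
    by_cases hR : x < |S R ω|
    · exact Or.inl hR
    · right
      classical
      have hex : ∃ k, 3 * x < |S k ω| := ⟨k, hω⟩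
      have hmin : Nat.find hex ≤ k := Nat.find_min' hex hω
      simp only [Set.mem_iUnion, Finset.mem_range]
      refine ⟨Nat.find hex, by omega, ⟨Nat.find_spec hex, fun j hj => ?_⟩, ?_⟩
      · exact not_lt.1 (Nat.find_min hex hj)
      · have h1 := Nat.find_spec hex
        have h2 := abs_sub_abs_le_abs_sub (S (Nat.find hex) ω) (S R ω)
        rw [abs_sub_comm] at h2
        simp only [Set.mem_ofPred_eq]
        linarith [not_lt.1 hR]
  have hindep : ∀ k ≤ R, P (A k ∩ {ω | 2 * x < |S R ω - S k ω|})
      = P (A k) * P {ω | 2 * x < |S R ω - S k ω|} := by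
    intro k hk
    have hI := hind.indepFun_finset (Finset.range k) (Finset.Ico k R)
      (by rw [Finset.disjoint_left]; intro a; simp; omega) hmeas
    -- Rebuilds the partial sums from the vector of the first `k` variables, so that `A k` is the
    -- preimage of an event about that vector.
    let φ : (Finset.range k → ℝ) → ℕ → ℝ := fun v j =>
      ∑ i : Finset.range k, if (i : ℕ) < j then v i else 0
    have hφm : ∀ j, Measurable fun v => φ v j := by
      intro j
      refine Finset.measurable_sum _ fun i _ => ?_
      split_ifs
      · exact measurable_pi_apply i
      · exact measurable_const
    have hφ : ∀ j ≤ k, ∀ ω, φ (fun i : Finset.range k => B i ω) j = S j ω := by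
      intro j hj ω
      simp only [φ, hS]
      rw [Finset.sum_coe_sort (Finset.range k) (fun i => if i < j then B i ω else 0),
        ← Finset.sum_filter]
      congr 1
      ext i; simp; omega
    have e1 : A k = (fun ω (i : Finset.range k) => B i ω) ⁻¹'
        {v | 3 * x < |φ v k| ∧ ∀ j < k, |φ v j| ≤ 3 * x} := by
      ext ω
      simp only [A, Set.mem_ofPred_eq, Set.mem_preimage, hφ k le_rfl]
      refine and_congr_right fun _ => forall_congr' fun j => forall_congr' fun hj => ?_
      rw [hφ j hj.le]
    have e2 : {ω | 2 * x < |S R ω - S k ω|} = (fun ω (i : Finset.Ico k R) => B i ω) ⁻¹'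
        {v | 2 * x < |∑ i, v i|} := by
      ext ω
      simp only [Set.mem_ofPred_eq, Set.mem_preimage, hS]
      rw [Finset.sum_coe_sort (Finset.Ico k R) (fun i => B i ω), Finset.sum_Ico_eq_sub _ hk]
    rw [e1, e2]
    refine hI.measure_inter_preimage_eq_mul _ _ ?_ ?_
    · have : {v : Finset.range k → ℝ | 3 * x < |φ v k| ∧ ∀ j < k, |φ v j| ≤ 3 * x}
          = {v | 3 * x < |φ v k|} ∩ ⋂ j, ⋂ (_ : j < k), {v | |φ v j| ≤ 3 * x} := by
        ext v; simp
      rw [this]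
      exact (measurableSet_lt measurable_const (hφm k).abs).inter
        (MeasurableSet.iInter fun j => MeasurableSet.iInter fun _ =>
          measurableSet_le (hφm j).abs measurable_const)
    · exact measurableSet_lt measurable_const
        (Finset.measurable_sum _ fun i _ => measurable_pi_apply i).abs
  have hdiff : ∀ k ≤ R, P {ω | 2 * x < |S R ω - S k ω|} ≤ 2 * α := by
    intro k hk
    calc P {ω | 2 * x < |S R ω - S k ω|} ≤ P ({ω | x < |S R ω|} ∪ {ω | x < |S k ω|}) := by
          refine measure_mono fun ω hω => ?_
          simp only [Set.mem_ofPred_eq, Set.mem_union] at hω ⊢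
          by_contra hcon
          push Not at hcon
          linarith [abs_sub (S R ω) (S k ω)]
      _ ≤ α + α := (measure_union_le _ _).trans (add_le_add (hα R le_rfl) (hα k hk))
      _ = 2 * α := (two_mul α).symm
  calc P {ω | ∃ k ≤ R, 3 * x < |S k ω|}
      ≤ P {ω | x < |S R ω|} + ∑ k ∈ Finset.range (R + 1),
          P (A k ∩ {ω | 2 * x < |S R ω - S k ω|}) :=
        (measure_mono hcov).trans ((measure_union_le _ _).trans
          (add_le_add le_rfl (measure_biUnion_finset_le _ _)))
    _ ≤ α + ∑ k ∈ Finset.range (R + 1), P (A k) * (2 * α) := by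
        refine add_le_add (hα R le_rfl) (Finset.sum_le_sum fun k hk => ?_)
        have hk' : k ≤ R := Nat.lt_succ_iff.1 (Finset.mem_range.1 hk)
        rw [hindep k hk']
        gcongr
        exact hdiff k hk'
    _ = α + P (⋃ k ∈ Finset.range (R + 1), A k) * (2 * α) := by
        rw [measure_biUnion_finset (fun i _ j _ h => hdisj h) fun k _ => hAm k, Finset.sum_mul]
    _ ≤ α + 1 * (2 * α) := by gcongr; exact prob_le_one
    _ = 3 * α := by ring

end Etemadi

section LpNorm

variable {Ω : Type*} [MeasurableSpace Ω] {P : Measure Ω}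

lemma eLpNorm_le_ofReal_iff {f : Ω → ℝ} {a d : ℝ} (ha : 0 < a) (hd : 0 ≤ d)
    (hf : MemLp f (ENNReal.ofReal a) P) :
    eLpNorm f (ENNReal.ofReal a) P ≤ ENNReal.ofReal d ↔ ∫ ω, |f ω| ^ a ∂P ≤ d ^ a := by
  have h0 : 0 ≤ ∫ ω, |f ω| ^ a ∂P := integral_nonneg fun ω => by positivity
  rw [hf.eLpNorm_eq_integral_rpow_norm (by simpa using ha) ENNReal.ofReal_ne_top,
    ENNReal.toReal_ofReal ha.le, ENNReal.ofReal_le_ofReal_iff hd]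
  simp only [Real.norm_eq_abs]
  rw [Real.rpow_inv_le_iff_of_pos h0 hd ha]

lemma integrable_abs_rpow {f : Ω → ℝ} {a : ℝ} (ha : 0 < a)
    (hf : MemLp f (ENNReal.ofReal a) P) : Integrable (fun ω => |f ω| ^ a) P := by
  have := hf.integrable_norm_rpow (by simpa using ha) ENNReal.ofReal_ne_top
  simpa [ENNReal.toReal_ofReal ha.le] using this

lemma measure_ge_le_of_eLpNorm_le {f : Ω → ℝ} {a d y : ℝ} (ha : 0 < a) (hd : 0 ≤ d) (hy : 0 < y)
    (hfm : AEStronglyMeasurable f P)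
    (hf : eLpNorm f (ENNReal.ofReal a) P ≤ ENNReal.ofReal d) :
    P {ω | y ≤ |f ω|} ≤ ENNReal.ofReal ((d / y) ^ a) := by
  have h := meas_ge_le_mul_pow_eLpNorm_enorm P (p := ENNReal.ofReal a) (by simpa using ha)
    ENNReal.ofReal_ne_top hfm (ε := ENNReal.ofReal y) (by simpa using hy)
    (by simp)
  rw [ENNReal.toReal_ofReal ha.le] at h
  have e : {ω | y ≤ |f ω|} = {x | ENNReal.ofReal y ≤ ‖f x‖ₑ} := by
    ext ω
    simp only [Set.mem_ofPred_eq, Real.enorm_eq_ofReal_abs]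
    rw [ENNReal.ofReal_le_ofReal_iff (abs_nonneg _)]
  rw [e]
  refine h.trans ?_
  calc _ ≤ (ENNReal.ofReal y)⁻¹ ^ a * ENNReal.ofReal d ^ a := by gcongr
    _ = ENNReal.ofReal ((d / y) ^ a) := by
        rw [← ENNReal.mul_rpow_of_nonneg _ _ ha.le, ← ENNReal.ofReal_inv_of_pos hy,
          ← ENNReal.ofReal_mul (by positivity), ENNReal.ofReal_rpow_of_nonneg (by positivity) ha.le]
        congr 2
        field_simp

end LpNorm

/-! ### Moments of sums of orthogonal increments -/

section Martingale

universe u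

/-- Moments of sums of martingale-difference-like variables: each summand is orthogonal to the
duality map of the preceding partial sum. -/
lemma exists_integral_abs_sum_rpow_le {a : ℝ} (ha : 2 ≤ a) : ∃ C : ℝ, 1 ≤ C ∧
    ∀ {Ω : Type u} [MeasurableSpace Ω] (P : Measure Ω) [IsProbabilityMeasure P]
      (D : ℕ → Ω → ℝ) (d : ℝ), 0 < d → (∀ i, MemLp (D i) (ENNReal.ofReal a) P) →
      (∀ i, ∫ ω, |D i ω| ^ a ∂P ≤ d ^ a) →
      (∀ k, ∫ ω, |∑ i ∈ Finset.range k, D i ω| ^ (a - 2) * (∑ i ∈ Finset.range k, D i ω)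
        * D k ω ∂P = 0) →
      ∀ n : ℕ, ∫ ω, |∑ i ∈ Finset.range n, D i ω| ^ a ∂P ≤ (C * n * d ^ 2) ^ (a / 2) := by
  obtain ⟨C₀, hC₀, hC⟩ := exists_abs_add_rpow_le ha
  refine ⟨4 * C₀, by linarith, ?_⟩
  intro Ω _ P _ D d hd hD hDm horth n
  have ha0 : 0 < a := by linarith
  induction n with
  | zero => simp [Real.zero_rpow ha0.ne', Real.zero_rpow (by positivity : a / 2 ≠ 0)]
  | succ n ih =>
    set S : Ω → ℝ := fun ω => ∑ i ∈ Finset.range n, D i ω with hS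
    have hSL : MemLp S (ENNReal.ofReal a) P := memLp_finsetSum _ fun i _ => hD i
    have iS := integrable_abs_rpow ha0 hSL
    have iD := integrable_abs_rpow ha0 (hD n)
    have hpow : ∀ z : ℝ, 0 ≤ z → (z ^ 2) ^ (a / 2) = z ^ a := fun z hz => by
      rw [← Real.rpow_natCast z 2, ← Real.rpow_mul hz]; congr 1; push_cast; ring
    simp only [Finset.sum_range_succ]
    -- The first step is separate: for `n = 0` the scale `σ` vanishes, and it occurs below as a
    -- divisor.
    rcases Nat.eq_zero_or_pos n with hn | hn
    · subst hn
      simp only [Finset.range_zero, Finset.sum_empty, zero_add, Nat.cast_one, mul_one]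
      refine (hDm 0).trans ?_
      rw [← hpow d hd.le]
      refine Real.rpow_le_rpow (by positivity) ?_ (by positivity)
      nlinarith [sq_nonneg d]
    set σ : ℝ := Real.sqrt (4 * C₀ * n * d ^ 2) with hσ
    have hn' : (0:ℝ) < n := by exact_mod_cast hn
    have hσ0 : 0 < σ := Real.sqrt_pos.2 (by positivity)
    have hσ2 : σ ^ 2 = 4 * C₀ * n * d ^ 2 := Real.sq_sqrt (by positivity)
    rw [← hσ2, hpow σ hσ0.le] at ih
    -- A Young-type inequality for `S / σ` and `D / d`: both normalized moments are at most one, so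
    -- the cross term has expectation at most `2 σ ^ (a-2) d ^ 2`.
    have hw : ∀ ω, |S ω| ^ (a - 2) * D n ω ^ 2 ≤
        σ ^ (a - 2) * d ^ 2 * (|S ω| ^ a / σ ^ a + |D n ω| ^ a / d ^ a) := by
      intro ω
      have := rpow_mul_rpow_le_add ha (x := |S ω| / σ) (y := |D n ω| / d) (by positivity)
        (by positivity)
      rw [Real.div_rpow (abs_nonneg _) hσ0.le, Real.div_rpow (abs_nonneg _) hσ0.le,
        Real.div_rpow (abs_nonneg _) hd.le, div_pow, sq_abs] at this
      calc |S ω| ^ (a - 2) * D n ω ^ 2 = σ ^ (a - 2) * d ^ 2 *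
            (|S ω| ^ (a - 2) / σ ^ (a - 2) * (D n ω ^ 2 / d ^ 2)) := by field_simp
        _ ≤ _ := by gcongr
    have hmS : AEStronglyMeasurable S P := hSL.1
    have hmD : AEStronglyMeasurable (D n) P := (hD n).1
    have hmSm := hmS.aemeasurable
    have hmDm := hmD.aemeasurable
    have icross : Integrable (fun ω => |S ω| ^ (a - 2) * D n ω ^ 2) P := by
      refine Integrable.mono' (((iS.div_const (σ ^ a)).add (iD.div_const (d ^ a))).const_mul
        (σ ^ (a - 2) * d ^ 2)) ?_ (ae_of_all _ fun ω => ?_)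
      · exact (by fun_prop : AEMeasurable (fun ω => |S ω| ^ (a - 2) * D n ω ^ 2) P).aestronglyMeasurable
      · rw [Real.norm_eq_abs, abs_of_nonneg (by positivity)]
        exact hw ω
    have ilin : Integrable (fun ω => |S ω| ^ (a - 2) * S ω * D n ω) P := by
      refine Integrable.mono' (icross.add iS) ?_ (ae_of_all _ fun ω => ?_)
      · exact (by fun_prop : AEMeasurable
          (fun ω => |S ω| ^ (a - 2) * S ω * D n ω) P).aestronglyMeasurable
      · rw [Real.norm_eq_abs, abs_mul, abs_mul, abs_of_nonneg (by positivity : 0 ≤ |S ω| ^ (a-2))]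
        have h1 : |S ω| ^ a = |S ω| ^ (a - 2) * |S ω| ^ 2 := by
          rcases eq_or_lt_of_le (abs_nonneg (S ω)) with h0 | h0
          · rw [← h0, Real.zero_rpow ha0.ne']; simp
          · rw [← Real.rpow_natCast |S ω| 2, ← Real.rpow_add h0]; norm_num
        simp only [Pi.add_apply]
        rw [h1, ← sq_abs (D n ω), ← mul_add, mul_assoc]
        gcongr
        nlinarith [sq_nonneg (|S ω| - |D n ω|), sq_nonneg (|S ω|), sq_nonneg (|D n ω|)]
    have hcross : ∫ ω, |S ω| ^ (a - 2) * D n ω ^ 2 ∂P ≤ 2 * (σ ^ (a - 2) * d ^ 2) := by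
      calc _ ≤ ∫ ω, σ ^ (a - 2) * d ^ 2 * (|S ω| ^ a / σ ^ a + |D n ω| ^ a / d ^ a) ∂P :=
            integral_mono icross (((iS.div_const (σ ^ a)).add (iD.div_const (d ^ a))).const_mul _) hw
        _ = σ ^ (a - 2) * d ^ 2 * ((∫ ω, |S ω| ^ a ∂P) / σ ^ a
              + (∫ ω, |D n ω| ^ a ∂P) / d ^ a) := by
            rw [integral_const_mul, integral_add (iS.div_const _) (iD.div_const _),
              integral_div, integral_div]
        _ ≤ σ ^ (a - 2) * d ^ 2 * (1 + 1) := by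
            gcongr
            · exact (div_le_one (by positivity)).2 ih
            · exact (div_le_one (by positivity)).2 (hDm n)
        _ = _ := by ring
    have isum : Integrable (fun ω => |S ω + D n ω| ^ a) P :=
      integrable_abs_rpow ha0 (hSL.add (hD n))
    calc ∫ ω, |S ω + D n ω| ^ a ∂P
        ≤ ∫ ω, (|S ω| ^ a + a * (|S ω| ^ (a - 2) * S ω * D n ω)
          + C₀ * (|S ω| ^ (a - 2) * D n ω ^ 2 + |D n ω| ^ a)) ∂P :=
          integral_mono isum ((iS.add (ilin.const_mul a)).add ((icross.add iD).const_mul C₀))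
            fun ω => hC _ _
      _ = ∫ ω, |S ω| ^ a ∂P + a * 0
          + C₀ * (∫ ω, |S ω| ^ (a - 2) * D n ω ^ 2 ∂P + ∫ ω, |D n ω| ^ a ∂P) := by
          have iA : Integrable (fun ω => |S ω| ^ a + a * (|S ω| ^ (a - 2) * S ω * D n ω)) P :=
            iS.add (ilin.const_mul a)
          have iB : Integrable (fun ω => C₀ * (|S ω| ^ (a - 2) * D n ω ^ 2 + |D n ω| ^ a)) P :=
            (icross.add iD).const_mul C₀
          rw [integral_add iA iB, integral_add iS (ilin.const_mul a), integral_const_mul,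
            integral_const_mul, integral_add icross iD, horth n]
      _ ≤ σ ^ a + C₀ * (2 * (σ ^ (a - 2) * d ^ 2) + d ^ a) := by
          have := hDm n
          have : C₀ * (∫ ω, |S ω| ^ (a - 2) * D n ω ^ 2 ∂P + ∫ ω, |D n ω| ^ a ∂P)
              ≤ C₀ * (2 * (σ ^ (a - 2) * d ^ 2) + d ^ a) := by gcongr
          linarith
      _ ≤ (σ ^ 2 + 4 * C₀ * d ^ 2) ^ (a / 2) := by
          -- The factor `4` in the constant pays for the `1/2` in this lemma and for the `2` in
          -- front of the cross term.
          have h := rpow_add_half_le (r := a / 2) (u := σ ^ 2) (v := 4 * C₀ * d ^ 2)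
            (by linarith) (by positivity) (by positivity)
          refine le_trans ?_ h
          have e1 : (4 * C₀ * d ^ 2) ^ (a / 2) = (4 * C₀) ^ (a / 2) * d ^ a := by
            rw [Real.mul_rpow (by positivity) (by positivity), hpow d hd.le]
          have e2 : (σ ^ 2) ^ (a / 2 - 1) = σ ^ (a - 2) := by
            rw [← Real.rpow_natCast σ 2, ← Real.rpow_mul hσ0.le]; congr 1; push_cast; ring
          rw [hpow σ hσ0.le, e1, e2]
          have e3 : 4 * C₀ ≤ (4 * C₀) ^ (a / 2) :=
            Real.self_le_rpow_of_one_le (by linarith) (by linarith)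
          have p1 : 0 ≤ σ ^ (a - 2) * d ^ 2 := by positivity
          have p2 : 0 < d ^ a := by positivity
          have b1 : 4 * C₀ * d ^ a ≤ (4 * C₀) ^ (a / 2) * d ^ a := by gcongr
          have b2 : 4 * C₀ * (σ ^ (a - 2) * d ^ 2)
              ≤ a / 2 * σ ^ (a - 2) * (4 * C₀ * d ^ 2) := by
            have : 4 * C₀ * (σ ^ (a - 2) * d ^ 2) * 1
              ≤ 4 * C₀ * (σ ^ (a - 2) * d ^ 2) * (a / 2) := by
                gcongr; linarith
            linarith
          nlinarith
      _ = (4 * C₀ * (n + 1 : ℕ) * d ^ 2) ^ (a / 2) := by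
          rw [hσ2]; congr 1; push_cast; ring

/-- The moment inequality divides by `d`, whereas bounds on lag increments may vanish; it is applied
with `d + η` and `η` tends to zero. -/
lemma exists_eLpNorm_sum_le {a : ℝ} (ha : 2 ≤ a) : ∃ C : ℝ, 1 ≤ C ∧
    ∀ {Ω : Type u} [MeasurableSpace Ω] (P : Measure Ω) [IsProbabilityMeasure P]
      (D : ℕ → Ω → ℝ) (d : ℝ), 0 ≤ d → (∀ i, AEStronglyMeasurable (D i) P) →
      (∀ i, eLpNorm (D i) (ENNReal.ofReal a) P ≤ ENNReal.ofReal d) →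
      (∀ k, ∫ ω, |∑ i ∈ Finset.range k, D i ω| ^ (a - 2) * (∑ i ∈ Finset.range k, D i ω)
        * D k ω ∂P = 0) →
      ∀ n : ℕ, eLpNorm (fun ω => ∑ i ∈ Finset.range n, D i ω) (ENNReal.ofReal a) P
        ≤ ENNReal.ofReal (C * Real.sqrt n * d) := by
  obtain ⟨C, hC1, hC⟩ := exists_integral_abs_sum_rpow_le.{u} ha
  refine ⟨Real.sqrt C, Real.one_le_sqrt.2 hC1, ?_⟩
  intro Ω _ P _ D d hd hm hD horth n
  have ha0 : 0 < a := by linarith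
  have hL : ∀ i, MemLp (D i) (ENNReal.ofReal a) P := fun i =>
    ⟨hm i, (hD i).trans_lt ENNReal.ofReal_lt_top⟩
  have key : ∀ η : ℝ, 0 < η → eLpNorm (fun ω => ∑ i ∈ Finset.range n, D i ω)
      (ENNReal.ofReal a) P ≤ ENNReal.ofReal (Real.sqrt C * Real.sqrt n * (d + η)) := by
    intro η hη
    have hdη : 0 < d + η := by linarith
    rw [eLpNorm_le_ofReal_iff ha0 (by positivity) (memLp_finsetSum _ fun i _ => hL i)]
    refine (hC P D (d + η) hdη hL (fun i => ?_) horth n).trans_eq ?_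
    · rw [← eLpNorm_le_ofReal_iff ha0 hdη.le (hL i)]
      exact (hD i).trans (ENNReal.ofReal_le_ofReal (by linarith))
    · have : C * n * (d + η) ^ 2 = (Real.sqrt C * Real.sqrt n * (d + η)) ^ 2 := by
        rw [mul_pow, mul_pow, Real.sq_sqrt (by linarith), Real.sq_sqrt (by positivity)]
      rw [this, ← Real.rpow_natCast _ 2, ← Real.rpow_mul (by positivity)]
      congr 1; push_cast; ring
  have hlim : Tendsto (fun η : ℝ => ENNReal.ofReal (Real.sqrt C * Real.sqrt n * (d + η)))
      (𝓝[>] 0) (𝓝 (ENNReal.ofReal (Real.sqrt C * Real.sqrt n * (d + 0)))) := by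
    refine (ENNReal.tendsto_ofReal (Continuous.tendsto ?_ 0)).mono_left nhdsWithin_le_nhds
    fun_prop
  rw [add_zero] at hlim
  exact ge_of_tendsto hlim (eventually_nhdsWithin_of_forall fun η hη => key η hη)

end Martingale

/-! ### Maximal inequality by dyadic chaining -/

section Chaining

/-- A point is reached from `0` through its binary digits, with at most one dyadic increment per
scale. The induction removes the last digit: an odd index costs one finest increment, an even index
belongs to the sequence `j ↦ s (2j)`. -/
lemma abs_le_sum_of_dyadic (h : ℕ) (s : ℕ → ℝ) (y : ℕ → ℝ) (hs : s 0 = 0)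
    (hy : ∀ r ≤ h, ∀ j < 2 ^ (h - r), |s ((j + 1) * 2 ^ r) - s (j * 2 ^ r)| ≤ y r) :
    ∀ m ≤ 2 ^ h, |s m| ≤ ∑ r ∈ Finset.range (h + 1), y r := by
  have hy0 : ∀ r ≤ h, 0 ≤ y r := fun r hr =>
    (abs_nonneg _).trans (hy r hr 0 (by positivity))
  induction h generalizing s y with
  | zero =>
    intro m hm
    have h00 := hy 0 le_rfl 0 (by simp)
    simp only [pow_zero, mul_one, zero_add, hs, sub_zero] at h00
    simp only [zero_add, Finset.range_one, Finset.sum_singleton]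
    interval_cases m
    · rw [hs, abs_zero]; exact hy0 0 le_rfl
    · exact h00
  | succ h ih =>
    intro m hm
    have ih' := ih (fun j => s (2 * j)) (fun r => y (r + 1)) (by simpa using hs)
      (fun r hr j hj => by
        have := hy (r + 1) (by omega) j (by simpa using hj)
        rw [pow_succ] at this
        convert this using 3 <;> ring_nf)
      (fun r hr => hy0 _ (by omega))
    rw [Finset.sum_range_succ']
    rcases Nat.even_or_odd' m with ⟨k, rfl | rfl⟩
    · have := ih' k (by rw [pow_succ] at hm; omega)
      linarith [hy0 0 (by omega)]
    · have h1 := ih' k (by rw [pow_succ] at hm; omega)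
      have h2 := hy 0 (by omega) (2 * k) (by simp only [Nat.sub_zero]; omega)
      simp only [pow_zero, mul_one] at h2
      have h3 : |s (2 * k + 1)| ≤ |s (2 * k + 1) - s (2 * k)| + |s (2 * k)| := by
        simpa using abs_add_le (s (2 * k + 1) - s (2 * k)) (s (2 * k))
      linarith

/-- Maximal inequality by chaining: if increments over intervals of length `l` have norm at most
`c √l` in `L^q`, `q > 2`, then the maximum obeys the same tail bound up to a constant. -/
lemma exists_measure_max_le {q : ℝ} (hq : 2 < q) : ∃ C : ℝ, 1 ≤ C ∧
    ∀ {Ω : Type*} [MeasurableSpace Ω] (P : Measure Ω)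
      (S : ℕ → Ω → ℝ) (c : ℝ) (τ : ℕ), 1 ≤ τ → 0 ≤ c → (∀ ω, S 0 ω = 0) →
      (∀ m, AEStronglyMeasurable (S m) P) →
      (∀ m m', m ≤ m' → m' ≤ τ → eLpNorm (fun ω => S m' ω - S m ω) (ENNReal.ofReal q) P
        ≤ ENNReal.ofReal (c * Real.sqrt ((m' : ℝ) - m))) →
      ∀ y : ℝ, 0 < y → P {ω | ∃ m ≤ τ, y < |S m ω|}
        ≤ ENNReal.ofReal ((C * c * Real.sqrt τ / y) ^ q) := by
  have hq0 : 0 < q := by linarith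
  -- Level `r` is given the share `y (1 - β) β ^ (h - r)` of the threshold. Descending by one level
  -- doubles the number of increments and divides their norm by `√2`, while the share shrinks by
  -- `β`. The probabilities therefore change by the factor `2 (2 ^ (-1/2) / β) ^ q = ρ`, and `q > 2`
  -- leaves room for both `β < 1` and `ρ < 1`.
  set η : ℝ := (q / 2 - 1) / (2 * q) with hη
  have hη0 : 0 < η := by rw [hη]; apply div_pos <;> linarith
  set β : ℝ := 2 ^ (-η) with hβ
  have hβ0 : 0 < β := by positivity
  have hβ1 : β < 1 := Real.rpow_lt_one_of_one_lt_of_neg (by norm_num) (by linarith)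
  set ρ : ℝ := 2 ^ (-((q / 2 - 1) / 2)) with hρ
  have hρ0 : 0 < ρ := by positivity
  have hρ1 : ρ < 1 := Real.rpow_lt_one_of_one_lt_of_neg (by norm_num) (by linarith)
  have hrel : 2 * ((Real.sqrt 2)⁻¹ / β) ^ q = ρ := by
    have e1 : (Real.sqrt 2)⁻¹ = (2:ℝ) ^ (-(1/2) : ℝ) := by
      rw [Real.sqrt_eq_rpow, ← Real.rpow_neg (by norm_num)]
    rw [e1, hβ, ← Real.rpow_sub (by norm_num), ← Real.rpow_mul (by norm_num), hρ]
    nth_rewrite 1 [← Real.rpow_one 2]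
    rw [← Real.rpow_add (by norm_num)]
    congr 1
    rw [hη]; field_simp; ring
  set K : ℝ := 2 * (1 - β)⁻¹ * ((1 - ρ)⁻¹) with hK
  have hβ' : 1 ≤ (1 - β)⁻¹ := (one_le_inv₀ (by linarith)).2 (by linarith)
  have hρ' : 1 ≤ (1 - ρ)⁻¹ := (one_le_inv₀ (by linarith)).2 (by linarith)
  refine ⟨K, by nlinarith, ?_⟩
  intro Ω _ P S c τ hτ hc hS0 hSm hS y hy
  set h := Nat.clog 2 τ with hh
  have hτh : τ ≤ 2 ^ h := Nat.le_pow_clog (by norm_num) τ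
  have hhτ : 2 ^ h ≤ 2 * τ := by
    rcases Nat.eq_zero_or_pos h with h0 | h0
    · rw [h0]; omega
    · have : 2 ^ (h - 1) < τ := Nat.pow_pred_clog_lt_self (by norm_num) (by
        by_contra hcon
        have : τ = 1 := by omega
        rw [hh, this] at h0; simp at h0)
      have e : 2 ^ h = 2 * 2 ^ (h - 1) := by rw [← pow_succ']; congr 1; omega
      omega
  -- The dyadic grid reaches `2 ^ h ≥ τ`, but the increments are controlled only up to `τ`; the
  -- process is frozen from there on.
  set S' : ℕ → Ω → ℝ := fun m => S (min m τ) with hS'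
  set yr : ℕ → ℝ := fun r => y * (1 - β) * β ^ (h - r) with hyr
  have hyr0 : ∀ r, 0 < yr r := fun r => by
    have : 0 < 1 - β := by linarith
    simp only [hyr]; positivity
  have hsum : ∑ r ∈ Finset.range (h + 1), yr r ≤ y := by
    have e : ∑ r ∈ Finset.range (h + 1), yr r
        = y * (1 - β) * ∑ k ∈ Finset.range (h + 1), β ^ k := by
      rw [Finset.mul_sum, ← Finset.sum_range_reflect]
      refine Finset.sum_congr rfl fun k hk => ?_
      have : h - (h + 1 - 1 - k) = k := by have := Finset.mem_range.1 hk; omega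
      simp only [hyr, this]
    rw [e, mul_assoc]
    have : (1 - β) * ∑ k ∈ Finset.range (h + 1), β ^ k ≤ 1 := by
      rw [mul_neg_geom_sum]; linarith [pow_pos hβ0 (h + 1)]
    nlinarith
  have hcov : {ω | ∃ m ≤ τ, y < |S m ω|} ⊆ ⋃ r ∈ Finset.range (h + 1),
      ⋃ j ∈ Finset.range (2 ^ (h - r)),
        {ω | yr r ≤ |S' ((j + 1) * 2 ^ r) ω - S' (j * 2 ^ r) ω|} := by
    rintro ω ⟨m, hm, hω⟩
    by_contra hcon
    simp only [Set.mem_iUnion, Finset.mem_range, Set.mem_ofPred_eq, not_exists, not_le] at hcon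
    have := abs_le_sum_of_dyadic h (fun m => S' m ω) yr (by simp [hS', hS0])
      (fun r hr j hj => (hcon r (by omega) j hj).le) m (by omega)
    simp only [hS', min_eq_left hm] at this
    linarith
  have hone : ∀ r j, P {ω | yr r ≤ |S' ((j + 1) * 2 ^ r) ω - S' (j * 2 ^ r) ω|}
      ≤ ENNReal.ofReal ((c * Real.sqrt (2 ^ r) / yr r) ^ q) := by
    intro r j
    refine measure_ge_le_of_eLpNorm_le hq0 (by positivity) (hyr0 r)
      ((hSm _).sub (hSm _)) ?_
    have hmin : min (j * 2 ^ r) τ ≤ min ((j + 1) * 2 ^ r) τ :=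
      min_le_min (Nat.mul_le_mul_right _ (by omega)) le_rfl
    refine (hS _ _ hmin (min_le_right _ _)).trans (ENNReal.ofReal_le_ofReal ?_)
    gcongr
    have h1 : min ((j + 1) * 2 ^ r) τ ≤ min (j * 2 ^ r) τ + 2 ^ r := by
      have e : (j + 1) * 2 ^ r = j * 2 ^ r + 2 ^ r := by ring
      have := Nat.pos_of_ne_zero (pow_ne_zero r (two_ne_zero (α := ℕ)))
      omega
    have h2 : ((min ((j + 1) * 2 ^ r) τ : ℕ) : ℝ) ≤ (min (j * 2 ^ r) τ : ℕ) + 2 ^ r := by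
      exact_mod_cast h1
    linarith
  have hterm : ∀ r ∈ Finset.range (h + 1),
      (2 ^ (h - r) : ℝ) * (c * Real.sqrt (2 ^ r) / yr r) ^ q
        = (c * Real.sqrt (2 ^ h) / (y * (1 - β))) ^ q * ρ ^ (h - r) := by
    intro r hr
    have hr' : r ≤ h := Nat.lt_succ_iff.1 (Finset.mem_range.1 hr)
    have h1β : 0 < 1 - β := by linarith
    rw [← hrel, mul_pow, ← Real.rpow_natCast (((Real.sqrt 2)⁻¹ / β) ^ q), ← Real.rpow_mul
      (by positivity), mul_comm q, Real.rpow_mul (by positivity), mul_left_comm,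
      ← Real.mul_rpow (by positivity) (by positivity), Real.rpow_natCast]
    congr 2
    have e1 : Real.sqrt (2 ^ h) = Real.sqrt (2 ^ r) * Real.sqrt 2 ^ (h - r) := by
      have : (2:ℝ) ^ h = 2 ^ r * 2 ^ (h - r) := by rw [← pow_add]; congr 1; omega
      rw [this, Real.sqrt_mul (by positivity)]
      congr 1
      rw [Real.sqrt_eq_rpow, Real.sqrt_eq_rpow, ← Real.rpow_natCast, ← Real.rpow_natCast,
        ← Real.rpow_mul (by norm_num), ← Real.rpow_mul (by norm_num), mul_comm]
    simp only [hyr]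
    rw [e1, div_pow, inv_pow]
    field_simp
  calc P {ω | ∃ m ≤ τ, y < |S m ω|}
      ≤ ∑ r ∈ Finset.range (h + 1), ∑ j ∈ Finset.range (2 ^ (h - r)),
          P {ω | yr r ≤ |S' ((j + 1) * 2 ^ r) ω - S' (j * 2 ^ r) ω|} :=
        (measure_mono hcov).trans ((measure_biUnion_finset_le _ _).trans
          (Finset.sum_le_sum fun r _ => measure_biUnion_finset_le _ _))
    _ ≤ ∑ r ∈ Finset.range (h + 1), ENNReal.ofReal
          ((2 ^ (h - r) : ℝ) * (c * Real.sqrt (2 ^ r) / yr r) ^ q) := by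
        refine Finset.sum_le_sum fun r _ => ?_
        refine (Finset.sum_le_sum fun j _ => hone r j).trans_eq ?_
        rw [Finset.sum_const, Finset.card_range, nsmul_eq_mul, ENNReal.ofReal_mul (by positivity)]
        congr 1
        rw [ENNReal.ofReal_pow (by norm_num)]
        norm_num
    _ = ENNReal.ofReal (∑ r ∈ Finset.range (h + 1),
          ((2 ^ (h - r) : ℝ) * (c * Real.sqrt (2 ^ r) / yr r) ^ q)) :=
        (ENNReal.ofReal_sum_of_nonneg fun r _ => by
          have := hyr0 r
          positivity).symm
    _ ≤ ENNReal.ofReal ((K * c * Real.sqrt τ / y) ^ q) := by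
        refine ENNReal.ofReal_le_ofReal ?_
        rw [Finset.sum_congr rfl hterm, ← Finset.mul_sum]
        have h1β : 0 < 1 - β := by linarith
        have e : ∑ r ∈ Finset.range (h + 1), ρ ^ (h - r) ≤ (1 - ρ)⁻¹ := by
          rw [← Finset.sum_range_reflect]
          have : ∑ k ∈ Finset.range (h + 1), ρ ^ (h - (h + 1 - 1 - k))
              = ∑ k ∈ Finset.range (h + 1), ρ ^ k := by
            refine Finset.sum_congr rfl fun k hk => ?_
            congr 1; have := Finset.mem_range.1 hk; omega
          rw [this, ← tsum_geometric_of_lt_one hρ0.le hρ1]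
          exact Summable.sum_le_tsum _ (fun _ _ => by positivity)
            (summable_geometric_of_lt_one hρ0.le hρ1)
        calc _ ≤ (c * (2 * Real.sqrt τ) / (y * (1 - β))) ^ q * ((1 - ρ)⁻¹) ^ q := by
              gcongr
              · rw [show (2:ℝ) = Real.sqrt (2 ^ 2) by simp, ← Real.sqrt_mul (by positivity)]
                refine Real.sqrt_le_sqrt ?_
                have : ((2 ^ h : ℕ) : ℝ) ≤ (2 * τ : ℕ) := by exact_mod_cast hhτ
                push_cast at this
                have h0 : (0:ℝ) ≤ τ := by positivity
                norm_num
                linarith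
              · exact e.trans (Real.self_le_rpow_of_one_le hρ' (by linarith))
          _ = _ := by
              rw [← Real.mul_rpow (by positivity) (by positivity)]
              congr 1
              rw [hK]; field_simp

end Chaining

/-! ### Averaging over coordinates of a product space -/

section Product

open Measure

set_option linter.unusedSectionVars false

variable {ι E : Type*} [MeasurableSpace E]

open Classical in
/-- The point with coordinates `x i` for `i ∈ S` and `y i` for `i ∉ S`. -/
def splice (S : Set ι) (x y : ι → E) : ι → E := fun i => if i ∈ S then x i else y i

lemma measurable_splice (S : Set ι) :
    Measurable fun z : (ι → E) × (ι → E) => splice S z.1 z.2 := by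
  refine measurable_pi_lambda _ fun i => ?_
  unfold splice
  split_ifs <;> fun_prop

lemma DependsOn.apply_splice {β : Type*} {S : Set ι} {f : (ι → E) → β} (hf : DependsOn f S)
    (x y : ι → E) : f (splice S x y) = f x :=
  hf fun i hi => by simp [splice, hi]

lemma update_splice_insert [DecidableEq ι] {S : Set ι} {a : ι} (ha : a ∉ S) (x y : ι → E) (z : E) :
    Function.update (splice (insert a S) x y) a z = splice S x (Function.update y a z) := by
  ext i
  by_cases hia : i = a
  · subst hia; simp [splice, ha]
  · rw [Function.update_of_ne hia]
    simp only [splice, Function.update_of_ne hia]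
    by_cases hi : i ∈ S
    · rw [if_pos hi, if_pos (Set.mem_insert_of_mem _ hi)]
    · rw [if_neg hi, if_neg]
      rintro (h | h)
      exacts [hia h, hi h]

variable (law : Measure E) [IsProbabilityMeasure law]

/-- The product measure of copies of `law`. -/
abbrev iidLaw (ι : Type*) : Measure (ι → E) := infinitePi fun _ : ι => law

/-- On a cylinder the preimage is a rectangle, with the factors in `S` on one side and the others on
the other. This makes `condAvg` an everywhere defined version of the conditional expectation given
the coordinates in `S`. -/
lemma measurePreserving_splice (S : Set ι) :
    MeasurePreserving (fun z : (ι → E) × (ι → E) => splice S z.1 z.2)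
      ((iidLaw law ι).prod (iidLaw law ι)) (iidLaw law ι) := by
  classical
  refine ⟨measurable_splice S, eq_infinitePi _ fun s t ht => ?_⟩
  have hbox : MeasurableSet (Set.pi (s : Set ι) t) :=
    .pi s.countable_toSet fun i _ => ht i
  rw [map_apply (measurable_splice S) hbox]
  have e : (fun z : (ι → E) × (ι → E) => splice S z.1 z.2) ⁻¹' (Set.pi (s : Set ι) t)
      = (Set.pi ((s.filter (· ∈ S) : Finset ι) : Set ι) t) ×ˢ
        (Set.pi ((s.filter (· ∉ S) : Finset ι) : Set ι) t) := by
    ext ⟨x, y⟩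
    simp only [Set.mem_preimage, Set.mem_pi, Set.mem_prod, Finset.coe_filter, Set.mem_ofPred_eq,
      splice, Finset.mem_coe]
    constructor
    · intro h
      exact ⟨fun i hi => by simpa [hi.2] using h i hi.1, fun i hi => by simpa [hi.2] using h i hi.1⟩
    · rintro ⟨h1, h2⟩ i hi
      split_ifs with hS
      · exact h1 i ⟨hi, hS⟩
      · exact h2 i ⟨hi, hS⟩
  rw [e, prod_prod, infinitePi_pi _ fun i _ => ht i, infinitePi_pi _ fun i _ => ht i,
    Finset.prod_filter_mul_prod_filter_not]

lemma measurable_update_pair [DecidableEq ι] (a : ι) :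
    Measurable fun z : (ι → E) × E => Function.update z.1 a z.2 := by
  refine measurable_pi_lambda _ fun i => ?_
  by_cases h : i = a
  · subst h; simp only [Function.update_self]; fun_prop
  · simp only [Function.update_of_ne h]; fun_prop

lemma measurePreserving_update [DecidableEq ι] (a : ι) :
    MeasurePreserving (fun z : (ι → E) × E => Function.update z.1 a z.2)
      ((iidLaw law ι).prod law) (iidLaw law ι) := by
  refine ⟨measurable_update_pair a, eq_infinitePi _ fun s t ht => ?_⟩
  have hbox : MeasurableSet (Set.pi (s : Set ι) t) :=
    .pi s.countable_toSet fun i _ => ht i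
  rw [map_apply (measurable_update_pair a) hbox]
  have e : (fun z : (ι → E) × E => Function.update z.1 a z.2) ⁻¹' (Set.pi (s : Set ι) t)
      = (Set.pi ((s.erase a : Finset ι) : Set ι) t) ×ˢ (if a ∈ s then t a else Set.univ) := by
    ext ⟨x, y⟩
    simp only [Set.mem_preimage, Set.mem_pi, Set.mem_prod, Finset.mem_coe, Finset.mem_erase]
    constructor
    · intro h
      refine ⟨fun i hi => by simpa [hi.1] using h i hi.2, ?_⟩
      split_ifs with ha
      · simpa using h a ha
      · trivial
    · rintro ⟨h1, h2⟩ i hi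
      by_cases hia : i = a
      · subst hia; simpa [hi] using h2
      · simpa [hia] using h1 i ⟨hia, hi⟩
  rw [e, prod_prod, infinitePi_pi _ fun i _ => ht i]
  split_ifs with ha
  · rw [mul_comm, Finset.mul_prod_erase s (fun i => law (t i)) ha]
  · rw [measure_univ, mul_one, Finset.erase_eq_of_notMem ha]

/-- The average of `f` over the coordinates outside `S`. -/
def condAvg (S : Set ι) (f : (ι → E) → ℝ) (x : ι → E) : ℝ :=
  ∫ y, f (splice S x y) ∂(iidLaw law ι)

lemma measurable_condAvg {f : (ι → E) → ℝ} (hf : Measurable f) (S : Set ι) :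
    Measurable (condAvg law S f) :=
  (StronglyMeasurable.integral_prod_right
    (f := fun (x : ι → E) (y : ι → E) => f (splice S x y))
    (hf.comp (measurable_splice S)).stronglyMeasurable).measurable

lemma dependsOn_condAvg (S : Set ι) (f : (ι → E) → ℝ) : DependsOn (condAvg law S f) S := by
  intro x y h
  unfold condAvg
  congr 1
  ext w
  congr 1
  ext i
  simp only [splice]
  split_ifs with hi
  · exact h i hi
  · rfl

lemma dependsOn_condAvg_inter {S T : Set ι} {f : (ι → E) → ℝ} (hf : DependsOn f T) :
    DependsOn (condAvg law S f) (S ∩ T) := by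
  intro x y h
  unfold condAvg
  congr 1
  ext w
  refine hf fun i hi => ?_
  simp only [splice]
  split_ifs with hiS
  · exact h i ⟨hiS, hi⟩
  · rfl

lemma condAvg_of_disjoint {S T : Set ι} {f : (ι → E) → ℝ} (hf : DependsOn f T)
    (hST : Disjoint S T) (x : ι → E) : condAvg law S f x = ∫ y, f y ∂(iidLaw law ι) := by
  unfold condAvg
  congr 1
  ext w
  refine hf fun i hi => ?_
  simp [splice, Set.disjoint_right.1 hST hi]

lemma lintegral_rpow_le {Y : Type*} [MeasurableSpace Y] {ν : Measure Y} [IsProbabilityMeasure ν]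
    {F : Y → ℝ} (hF : AEStronglyMeasurable F ν) {q : ℝ} (hq : 1 ≤ q) :
    ‖∫ y, F y ∂ν‖ₑ ^ q ≤ ∫⁻ y, ‖F y‖ₑ ^ q ∂ν := by
  have hq0 : 0 < q := by linarith
  have h1 : ‖∫ y, F y ∂ν‖ₑ ≤ eLpNorm F 1 ν := by
    rw [eLpNorm_one_eq_lintegral_enorm]; exact enorm_integral_le_lintegral_enorm F
  have h2 : eLpNorm F 1 ν ≤ eLpNorm F (ENNReal.ofReal q) ν :=
    eLpNorm_le_eLpNorm_of_exponent_le (by simpa using hq) hF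
  have h3 : eLpNorm F (ENNReal.ofReal q) ν ^ q = ∫⁻ y, ‖F y‖ₑ ^ q ∂ν := by
    rw [eLpNorm_eq_lintegral_rpow_enorm_toReal (by simpa using hq0) ENNReal.ofReal_ne_top,
      ENNReal.toReal_ofReal hq0.le, ← ENNReal.rpow_mul, one_div_mul_cancel hq0.ne',
      ENNReal.rpow_one]
  rw [← h3]
  exact ENNReal.rpow_le_rpow (h1.trans h2) hq0.le

/-- Jensen's inequality in the second variable, then Tonelli. -/
lemma eLpNorm_integral_le {X Y : Type*} [MeasurableSpace X] [MeasurableSpace Y] {μ : Measure X}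
    [SFinite μ] {ν : Measure Y} [IsProbabilityMeasure ν] {F : X × Y → ℝ} (hF : Measurable F)
    {q : ℝ} (hq : 1 ≤ q) :
    eLpNorm (fun x => ∫ y, F (x, y) ∂ν) (ENNReal.ofReal q) μ
      ≤ eLpNorm F (ENNReal.ofReal q) (μ.prod ν) := by
  have hq0 : 0 < q := by linarith
  rw [eLpNorm_eq_lintegral_rpow_enorm_toReal (by simpa using hq0) ENNReal.ofReal_ne_top,
    eLpNorm_eq_lintegral_rpow_enorm_toReal (by simpa using hq0) ENNReal.ofReal_ne_top,
    ENNReal.toReal_ofReal hq0.le]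
  refine ENNReal.rpow_le_rpow ?_ (by positivity)
  rw [lintegral_prod _ (by fun_prop)]
  exact lintegral_mono fun x =>
    lintegral_rpow_le (hF.comp measurable_prodMk_left).aestronglyMeasurable hq

lemma eLpNorm_condAvg_le {f : (ι → E) → ℝ} (hf : Measurable f) (S : Set ι) {q : ℝ} (hq : 1 ≤ q) :
    eLpNorm (condAvg law S f) (ENNReal.ofReal q) (iidLaw law ι)
      ≤ eLpNorm f (ENNReal.ofReal q) (iidLaw law ι) := by
  refine (eLpNorm_integral_le (hf.comp (measurable_splice S)) hq).trans_eq ?_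
  exact eLpNorm_comp_measurePreserving hf.aestronglyMeasurable (measurePreserving_splice law S)

/-- The defining property of conditional expectation: splicing preserves the law, and `φ` does not
see the spliced coordinates. -/
lemma integral_condAvg_mul {S : Set ι} {φ f : (ι → E) → ℝ} (hφ : DependsOn φ S)
    (hint : Integrable (fun x => φ x * f x) (iidLaw law ι)) :
    ∫ x, φ x * condAvg law S f x ∂(iidLaw law ι) = ∫ x, φ x * f x ∂(iidLaw law ι) := by
  have hmp := measurePreserving_splice law S
  have hint' : Integrable (fun z : (ι → E) × (ι → E) =>
      φ (splice S z.1 z.2) * f (splice S z.1 z.2)) ((iidLaw law ι).prod (iidLaw law ι)) :=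
    hmp.integrable_comp_of_integrable hint
  have e : ∫ x, φ x * f x ∂(iidLaw law ι) = ∫ z, φ (splice S z.1 z.2) * f (splice S z.1 z.2)
      ∂((iidLaw law ι).prod (iidLaw law ι)) := by
    have := integral_map hmp.measurable.aemeasurable (f := fun x => φ x * f x)
      (by rw [hmp.map_eq]; exact hint.1)
    rwa [hmp.map_eq] at this
  rw [e, integral_prod _ hint']
  refine integral_congr_ae (ae_of_all _ fun x => ?_)
  simp only [hφ.apply_splice, condAvg]
  rw [integral_const_mul]

lemma integrable_condAvg {f : (ι → E) → ℝ} (hf : Measurable f)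
    (hint : Integrable f (iidLaw law ι)) (S : Set ι) :
    Integrable (condAvg law S f) (iidLaw law ι) := by
  rw [← memLp_one_iff_integrable] at hint ⊢
  refine ⟨(measurable_condAvg law hf S).aestronglyMeasurable, ?_⟩
  have := eLpNorm_condAvg_le law hf S (q := 1) le_rfl
  rw [ENNReal.ofReal_one] at this
  exact this.trans_lt hint.2

lemma measurePreserving_splice_prod (S : Set ι) :
    MeasurePreserving (fun z : (ι → E) × ((ι → E) × E) => (splice S z.1 z.2.1, z.2.2))
      ((iidLaw law ι).prod ((iidLaw law ι).prod law)) ((iidLaw law ι).prod law) := by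
  have h1 := (measurePreserving_prodAssoc (iidLaw law ι) (iidLaw law ι) law).symm
  have h2 := (measurePreserving_splice law S).prod (MeasurePreserving.id law)
  exact h2.comp h1

/-- Resampling coordinate `a` of an already averaged point does not change the average. Both terms
thus become integrals over the same space, and their difference is the average of `f - f ∘ update`
at a spliced point; Jensen's inequality concludes. This links the dependence measure to projections.
-/
lemma eLpNorm_condAvg_insert_sub_le [DecidableEq ι] {f : (ι → E) → ℝ} (hf : Measurable f)
    (hint : Integrable f (iidLaw law ι)) {S : Set ι} {a : ι} (ha : a ∉ S) {q : ℝ} (hq : 1 ≤ q) :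
    eLpNorm (fun x => condAvg law (insert a S) f x - condAvg law S f x) (ENNReal.ofReal q)
        (iidLaw law ι)
      ≤ eLpNorm (fun z : (ι → E) × E => f z.1 - f (Function.update z.1 a z.2))
        (ENNReal.ofReal q) ((iidLaw law ι).prod law) := by
  set μ := iidLaw law ι
  set G : (ι → E) × E → ℝ := fun z => f z.1 - f (Function.update z.1 a z.2) with hG
  have hGm : Measurable G :=
    (hf.comp measurable_fst).sub (hf.comp (measurable_update_pair a))
  set Φ : (ι → E) × ((ι → E) × E) → (ι → E) × E :=
    fun z => (splice (insert a S) z.1 z.2.1, z.2.2) with hΦdef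
  have hΦ : MeasurePreserving Φ (μ.prod (μ.prod law)) (μ.prod law) :=
    measurePreserving_splice_prod law (insert a S)
  have hslice : ∀ᵐ x ∂μ, Integrable (fun y => f (splice (insert a S) x y)) μ :=
    ((measurePreserving_splice law (insert a S)).integrable_comp_of_integrable hint).prod_right_ae
  have hslice' : ∀ᵐ x ∂μ, Integrable (fun y => f (splice S x y)) μ :=
    ((measurePreserving_splice law S).integrable_comp_of_integrable hint).prod_right_ae
  have heq : ∀ᵐ x ∂μ, condAvg law (insert a S) f x - condAvg law S f x
      = ∫ w, G (Φ (x, w)) ∂(μ.prod law) := by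
    filter_upwards [hslice, hslice'] with x hx hx'
    have i1 : Integrable (fun w : (ι → E) × E => f (splice (insert a S) x w.1)) (μ.prod law) :=
      hx.comp_fst law
    have hmp := measurePreserving_update law a
    have i2 : Integrable (fun w : (ι → E) × E => f (splice S x (Function.update w.1 a w.2)))
        (μ.prod law) := hmp.integrable_comp_of_integrable hx'
    have v1 : ∫ w : (ι → E) × E, f (splice (insert a S) x w.1) ∂(μ.prod law)
        = condAvg law (insert a S) f x := by
      rw [integral_fun_fst (fun y => f (splice (insert a S) x y)), probReal_univ, one_smul]
      rfl
    have v2 : ∫ w : (ι → E) × E, f (splice S x (Function.update w.1 a w.2)) ∂(μ.prod law)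
        = condAvg law S f x := by
      have := integral_map hmp.measurable.aemeasurable (f := fun y => f (splice S x y))
        (by rw [hmp.map_eq]; exact hx'.1)
      rw [hmp.map_eq] at this
      exact this.symm
    rw [← v1, ← v2, ← integral_sub i1 i2]
    refine integral_congr_ae (ae_of_all _ fun w => ?_)
    simp only [hG, hΦdef, update_splice_insert ha]
  have h1 := eLpNorm_integral_le (μ := μ) (ν := μ.prod law) (F := G ∘ Φ)
    (hGm.comp hΦ.measurable) hq
  have h2 : eLpNorm (G ∘ Φ) (ENNReal.ofReal q) (μ.prod (μ.prod law))
      = eLpNorm G (ENNReal.ofReal q) (μ.prod law) :=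
    eLpNorm_comp_measurePreserving hGm.aestronglyMeasurable hΦ
  rw [h2] at h1
  exact (eLpNorm_congr_ae heq).trans_le h1

/-- Lévy's upward theorem for the filtration generated by the coordinates in `S n`, whose union is
the whole σ-algebra. -/
lemma tendsto_condAvg {f : (ι → E) → ℝ} (hf : Measurable f)
    (hint : Integrable f (iidLaw law ι)) {S : ℕ → Set ι} (hS : Monotone S)
    (hU : ∀ i, ∃ n, i ∈ S n) :
    ∀ᵐ x ∂(iidLaw law ι), Tendsto (fun n => condAvg law (S n) f x) atTop (𝓝 (f x)) := by
  set μ := iidLaw law ι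
  have : Nonempty E := nonempty_of_isProbabilityMeasure law
  let y₀ : ι → E := fun _ => Classical.arbitrary E
  let res : (T : Set ι) → (ι → E) → (T → E) := fun T x i => x i
  have hres : ∀ T, Measurable (res T) := fun T => by fun_prop
  let ℱ : Filtration ℕ (inferInstance : MeasurableSpace (ι → E)) :=
    { seq := fun n => MeasurableSpace.comap (res (S n)) inferInstance
      mono' := by
        intro n m hnm
        refine MeasurableSpace.comap_le_iff_le_map.2 fun s hs => ?_
        refine ⟨(fun (v : S m → E) (i : S n) => v ⟨i, hS hnm i.2⟩) ⁻¹' s, ?_, rfl⟩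
        exact (by fun_prop : Measurable fun (v : S m → E) (i : S n) => v ⟨i, hS hnm i.2⟩) hs
      le' := fun n => (hres (S n)).comap_le }
  -- A function that depends only on `S n` factors through restriction: the other coordinates can be
  -- filled with those of the fixed point `y₀`.
  have hdep : ∀ n (g : (ι → E) → ℝ), Measurable g → DependsOn g (S n) →
      Measurable[ℱ n] g := by
    classical
    intro n g hg hd
    let ext' : (S n → E) → (ι → E) := fun v i => if h : i ∈ S n then v ⟨i, h⟩ else y₀ i
    have hext : Measurable ext' := by
      refine measurable_pi_lambda _ fun i => ?_
      simp only [ext']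
      split_ifs <;> fun_prop
    have e : g = (g ∘ ext') ∘ res (S n) := by
      ext x
      exact hd fun i hi => by simp [ext', res, hi]
    rw [e]
    exact (hg.comp hext).comp (comap_measurable _)
  have hce : ∀ n, condAvg law (S n) f =ᵐ[μ] μ[f | ℱ n] := by
    intro n
    refine ae_eq_condExp_of_forall_setIntegral_eq (ℱ.le n) hint
      (fun s _ _ => (integrable_condAvg law hf hint _).integrableOn) (fun s hs _ => ?_)
      (hdep n _ (measurable_condAvg law hf _) (dependsOn_condAvg law _ _)).stronglyMeasurable.aestronglyMeasurable
    obtain ⟨s', hs', rfl⟩ := hs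
    have hsm := hres (S n) hs'
    rw [← integral_indicator hsm, ← integral_indicator hsm]
    have e : ∀ g : (ι → E) → ℝ, (res (S n) ⁻¹' s').indicator g
        = fun x => (res (S n) ⁻¹' s').indicator 1 x * g x := by
      intro g; ext x
      by_cases hx : x ∈ res (S n) ⁻¹' s' <;> simp [hx]
    rw [e f, e (condAvg law (S n) f)]
    refine integral_condAvg_mul law ?_ ?_
    · intro x y h
      have : res (S n) x = res (S n) y := funext fun i => h i i.2
      have hiff : (x ∈ res (S n) ⁻¹' s') = (y ∈ res (S n) ⁻¹' s') := by
        simp only [Set.mem_preimage, this]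
      by_cases hx : x ∈ res (S n) ⁻¹' s'
      · rw [Set.indicator_of_mem hx, Set.indicator_of_mem (hiff ▸ hx)]; rfl
      · rw [Set.indicator_of_notMem hx, Set.indicator_of_notMem (hiff ▸ hx)]
    · rw [← e]; exact hint.indicator hsm
  have hsup : (⨆ n, ℱ n) = (inferInstance : MeasurableSpace (ι → E)) := by
    refine le_antisymm (iSup_le fun n => ℱ.le n) ?_
    refine iSup_le fun i => ?_
    obtain ⟨n, hn⟩ := hU i
    refine le_trans ?_ (le_iSup _ n)
    refine MeasurableSpace.comap_le_iff_le_map.2 fun s hs => ?_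
    exact ⟨(fun v : S n → E => v ⟨i, hn⟩) ⁻¹' s, (measurable_pi_apply _) hs, rfl⟩
  have hlevy := tendsto_ae_condExp (μ := μ) (ℱ := ℱ) f
  have htop : μ[f | ⨆ n, ℱ n] = f := by
    rw [hsup]; exact condExp_of_stronglyMeasurable le_rfl hf.stronglyMeasurable hint
  rw [htop] at hlevy
  filter_upwards [hlevy, ae_all_iff.2 hce] with x hx hx'
  simpa only [hx'] using hx

/-- Take one independent copy of the whole sequence per block and read coordinate `i` from the copy
of its own block. The pairs `(blk i, i)` are distinct, so the glued sequence again has the product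
law, while each `g r` sees only its own copy. -/
lemma iIndepFun_of_dependsOn {κ : Type*} [Countable κ] {S : κ → Set ι}
    (hS : Pairwise (Function.onFun Disjoint S)) {g : κ → (ι → E) → ℝ} (hg : ∀ r, Measurable (g r))
    (hd : ∀ r, DependsOn (g r) (S r)) : iIndepFun g (iidLaw law ι) := by
  classical
  rcases isEmpty_or_nonempty κ with hκ | ⟨⟨r₀⟩⟩
  · exact iIndepFun.of_subsingleton
  let blk : ι → κ := fun i => if h : ∃ r, i ∈ S r then h.choose else r₀
  have hblk : ∀ r, ∀ i ∈ S r, blk i = r := by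
    intro r i hi
    have h : ∃ r, i ∈ S r := ⟨r, hi⟩
    simp only [blk, h, dif_pos]
    by_contra hne
    exact Set.disjoint_left.1 (hS hne) h.choose_spec hi
  let Φ : (κ → ι → E) → (ι → E) := fun z i => z (blk i) i
  have hΦm : Measurable Φ := by fun_prop
  have hΦ : (infinitePi fun _ : κ => iidLaw law ι).map Φ = iidLaw law ι := by
    have h1 := infinitePi_map_curry_symm (fun (_ : κ) (_ : ι) => law)
    have hinj : Function.Injective fun i : ι => (blk i, i) := fun i j h => (Prod.mk.inj h).2
    have h2 := map_infinitePi_infinitePi_of_inj (P := fun _ : κ × ι => law) hinj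
    rw [← h1, map_map (by fun_prop) (by fun_prop)] at h2
    exact h2
  have hcomp : ∀ r z, g r (Φ z) = g r (z r) := fun r z => hd r fun i hi => by
    simp only [Φ, hblk r i hi]
  have hI : iIndepFun (fun r (z : κ → ι → E) => g r (z r)) (infinitePi fun _ : κ => iidLaw law ι) :=
    iIndepFun_infinitePi hg
  rw [iIndepFun_iff_map_fun_eq_infinitePi_map hg]
  rw [iIndepFun_iff_map_fun_eq_infinitePi_map (X := fun r (z : κ → ι → E) => g r (z r))
    fun r => (hg r).comp (measurable_pi_apply r)] at hI
  have e1 : (fun z (r : κ) => g r (z r)) = (fun x r => g r x) ∘ Φ := by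
    ext z r; exact (hcomp r z).symm
  have e2 : ∀ r, (fun z : κ → ι → E => g r (z r)) = g r ∘ Φ := fun r => by
    ext z; exact (hcomp r z).symm
  rw [e1] at hI
  simp only [e2] at hI
  rw [← map_map (by fun_prop) hΦm, hΦ] at hI
  rw [hI]
  congr 1
  ext1 r
  rw [← map_map (hg r) hΦm, hΦ]

end Product

/-! ### Causal arrays and approximation by finitely many lags -/

section Causal

open Measure

variable {E : Type*} [MeasurableSpace E] (law : Measure E) [IsProbabilityMeasure law]

/-- The average of a function of the past of time `i` over all coordinates but the last `k`. -/
def lagAvg (k i : ℕ) (f : (ℤ → E) → ℝ) : (ℤ → E) → ℝ :=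
  condAvg law (Set.Ici ((i : ℤ) - k + 1)) f

lemma integrable_dual_mul {Ω : Type*} [MeasurableSpace Ω] {P : Measure Ω} {a : ℝ} (ha : 2 ≤ a)
    {S f : Ω → ℝ} (hS : MemLp S (ENNReal.ofReal a) P) (hf : MemLp f (ENNReal.ofReal a) P) :
    Integrable (fun ω => |S ω| ^ (a - 2) * S ω * f ω) P := by
  have ha0 : 0 < a := by linarith
  have hmS := hS.1.aemeasurable
  have hmf := hf.1.aemeasurable
  refine Integrable.mono' ((integrable_abs_rpow ha0 hS).add (integrable_abs_rpow ha0 hf))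
    (by fun_prop : AEMeasurable (fun ω => |S ω| ^ (a - 2) * S ω * f ω) P).aestronglyMeasurable
    (ae_of_all _ fun ω => ?_)
  rw [Real.norm_eq_abs, abs_mul, abs_mul, abs_of_nonneg (by positivity : 0 ≤ |S ω| ^ (a - 2))]
  have key : ∀ z : ℝ, 0 ≤ z → z ^ (a - 2) * z * z = z ^ a := by
    intro z hz
    rcases eq_or_lt_of_le hz with h0 | h0
    · have h0a : (0 : ℝ) ^ a = 0 := Real.zero_rpow (by linarith)
      rw [← h0, h0a]; simp
    · rw [mul_assoc, ← sq, ← Real.rpow_natCast z 2, ← Real.rpow_add h0]; norm_num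
  simp only [Pi.add_apply]
  have p1 : 0 ≤ |S ω| ^ a := by positivity
  have p2 : 0 ≤ |f ω| ^ a := by positivity
  rcases le_total |S ω| |f ω| with h | h
  · calc |S ω| ^ (a - 2) * |S ω| * |f ω| ≤ |f ω| ^ (a - 2) * |f ω| * |f ω| := by gcongr
      _ = |f ω| ^ a := key _ (abs_nonneg _)
      _ ≤ _ := by linarith
  · calc |S ω| ^ (a - 2) * |S ω| * |f ω| ≤ |S ω| ^ (a - 2) * |S ω| * |S ω| := by gcongr
      _ = |S ω| ^ a := key _ (abs_nonneg _)
      _ ≤ _ := by linarith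

variable {law}

lemma measurable_lagAvg {f : (ℤ → E) → ℝ} (hf : Measurable f) (k i : ℕ) :
    Measurable (lagAvg law k i f) := measurable_condAvg law hf _

lemma memLp_lagAvg {f : (ℤ → E) → ℝ} (hfm : Measurable f) {a : ℝ} (ha : 1 ≤ a)
    (hf : MemLp f (ENNReal.ofReal a) (iidLaw law ℤ)) (k i : ℕ) :
    MemLp (lagAvg law k i f) (ENNReal.ofReal a) (iidLaw law ℤ) :=
  ⟨(measurable_lagAvg hfm k i).aestronglyMeasurable,
    (eLpNorm_condAvg_le law hfm _ ha).trans_lt hf.2⟩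

/-- The only coordinates kept lie after time `i`, where `f` depends on nothing. Telescoping over
lags therefore starts at the mean. -/
lemma lagAvg_zero {i : ℕ} {f : (ℤ → E) → ℝ} (hf : DependsOn f (Set.Iic (i : ℤ))) (x : ℤ → E) :
    lagAvg law 0 i f x = ∫ y, f y ∂(iidLaw law ℤ) := by
  refine condAvg_of_disjoint law hf (Set.disjoint_left.2 fun j h1 h2 => ?_) x
  simp only [Set.mem_Ici, Set.mem_Iic] at h1 h2
  push_cast at h1
  linarith

/-- Finite range, the source of the independence of distant blocks. -/
lemma dependsOn_lagAvg {k i : ℕ} {f : (ℤ → E) → ℝ} (hf : DependsOn f (Set.Iic (i : ℤ))) :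
    DependsOn (lagAvg law k i f) (Set.Ioc ((i : ℤ) - k) i) := by
  refine (dependsOn_condAvg_inter law hf).mono fun j hj => ?_
  simp only [Set.mem_inter_iff, Set.mem_Ici, Set.mem_Iic, Set.mem_Ioc] at hj ⊢
  omega

lemma eLpNorm_lagAvg_succ_sub_le {f : (ℤ → E) → ℝ} (hf : Measurable f)
    (hint : Integrable f (iidLaw law ℤ)) {q : ℝ} (hq : 1 ≤ q) (i m : ℕ) :
    eLpNorm (fun x => lagAvg law (m + 1) i f x - lagAvg law m i f x) (ENNReal.ofReal q)
        (iidLaw law ℤ)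
      ≤ eLpNorm (fun z : (ℤ → E) × E => f z.1 - f (Function.update z.1 ((i : ℤ) - m) z.2))
        (ENNReal.ofReal q) ((iidLaw law ℤ).prod law) := by
  have h := eLpNorm_condAvg_insert_sub_le law hf hint (S := Set.Ici ((i : ℤ) - m + 1))
    (a := (i : ℤ) - m) (by simp) hq
  have e : insert ((i : ℤ) - m) (Set.Ici ((i : ℤ) - m + 1)) = Set.Ici ((i : ℤ) - (m + 1 : ℕ) + 1) := by
    ext j; simp only [Set.mem_insert_iff, Set.mem_Ici]; push_cast; omega
  rw [e] at h
  exact h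

universe u

/-- Rosenthal-type bound for sums of one lag increment over an interval of times. -/
lemma exists_eLpNorm_sum_lag_le {a : ℝ} (ha : 2 ≤ a) : ∃ C : ℝ, 1 ≤ C ∧
    ∀ {E : Type u} [MeasurableSpace E] {law : Measure E} [IsProbabilityMeasure law]
      {f : ℕ → (ℤ → E) → ℝ} {δ : ℕ → ℝ}, (∀ i, Measurable (f i)) →
      (∀ i, MemLp (f i) (ENNReal.ofReal a) (iidLaw law ℤ)) → (∀ m, 0 ≤ δ m) →
      (∀ i m : ℕ, eLpNorm (fun z : (ℤ → E) × E =>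
          f i z.1 - f i (Function.update z.1 ((i : ℤ) - m) z.2))
        (ENNReal.ofReal a) ((iidLaw law ℤ).prod law) ≤ ENNReal.ofReal (δ m)) →
      ∀ m s n : ℕ, eLpNorm (fun x => ∑ i ∈ Finset.range n,
          (lagAvg law (m + 1) (s + i) (f (s + i)) x - lagAvg law m (s + i) (f (s + i)) x))
          (ENNReal.ofReal a) (iidLaw law ℤ) ≤ ENNReal.ofReal (C * Real.sqrt n * δ m) := by
  obtain ⟨C, hC1, hC⟩ := exists_eLpNorm_sum_le.{u} ha
  refine ⟨C, hC1, ?_⟩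
  intro E _ law _ f δ hfm hfL hδ0 hδ m s n
  set μ := iidLaw law ℤ
  have ha1 : 1 ≤ a := by linarith
  have hint : ∀ i, Integrable (f i) μ := fun i =>
    (hfL i).integrable (by simpa using ha1)
  let Q : ℕ → (ℤ → E) → ℝ := fun i x => lagAvg law (m + 1) i (f i) x - lagAvg law m i (f i) x
  have hQm : ∀ i, Measurable (Q i) := fun i =>
    (measurable_lagAvg (hfm i) _ _).sub (measurable_lagAvg (hfm i) _ _)
  have hQL : ∀ i, MemLp (Q i) (ENNReal.ofReal a) μ := fun i =>
    (memLp_lagAvg (hfm i) ha1 (hfL i) _ _).sub (memLp_lagAvg (hfm i) ha1 (hfL i) _ _)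
  have hQd : ∀ i : ℕ, DependsOn (Q i) (Set.Ici ((i : ℤ) - m)) := by
    intro i x y h
    have h1 : lagAvg law (m + 1) i (f i) x = lagAvg law (m + 1) i (f i) y :=
      dependsOn_condAvg law _ _ fun j hj => h j (by
        simp only [Set.mem_Ici] at hj ⊢; push_cast at hj; omega)
    have h2 : lagAvg law m i (f i) x = lagAvg law m i (f i) y :=
      dependsOn_condAvg law _ _ fun j hj => h j (by
        simp only [Set.mem_Ici] at hj ⊢; omega)
    simp only [Q, h1, h2]
  -- The order of time is reversed: at lag `m` the increment of time `i` reveals the innovation `i -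
  -- m`, and the later times involve only strictly later innovations. The partial sums then depend
  -- on what is already known.
  let D : ℕ → (ℤ → E) → ℝ := fun r x => if r < n then Q (s + (n - 1 - r)) x else 0
  have hDm : ∀ r, Measurable (D r) := by
    intro r
    simp only [D]
    split_ifs
    · exact hQm _
    · exact measurable_const
  have hDL : ∀ r, MemLp (D r) (ENNReal.ofReal a) μ := by
    intro r
    by_cases h : r < n
    · simpa only [D, h, if_true] using hQL _
    · simp only [D, h, if_false]
      exact MemLp.zero
  have hDn : ∀ r, eLpNorm (D r) (ENNReal.ofReal a) μ ≤ ENNReal.ofReal (δ m) := by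
    intro r
    by_cases h : r < n
    · simp only [D, h, if_true]
      exact (eLpNorm_lagAvg_succ_sub_le (hfm _) (hint _) ha1 _ _).trans (hδ _ _)
    · simp [D, h]
  have horth : ∀ k, ∫ x, |∑ i ∈ Finset.range k, D i x| ^ (a - 2) * (∑ i ∈ Finset.range k, D i x)
        * D k x ∂μ = 0 := by
    intro k
    by_cases hk : k < n
    · set i₀ : ℕ := s + (n - 1 - k) with hi₀
      set S : (ℤ → E) → ℝ := fun x => ∑ i ∈ Finset.range k, D i x with hS
      have hSL : MemLp S (ENNReal.ofReal a) μ := memLp_finsetSum _ fun i _ => hDL i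
      have hφ : DependsOn (fun x => |S x| ^ (a - 2) * S x) (Set.Ici ((i₀ : ℤ) - m + 1)) := by
        intro x y h
        have : S x = S y := by
          refine Finset.sum_congr rfl fun r hr => ?_
          have hr' := Finset.mem_range.1 hr
          have hrn : r < n := by omega
          simp only [D, hrn, if_true]
          refine hQd _ fun j hj => h j ?_
          simp only [Set.mem_Ici] at hj ⊢
          omega
        simp only [this]
      have hi1 := integrable_dual_mul ha hSL (hfL i₀)
      -- Both averages retain every coordinate on which the dual of the partial sum depends, so each
      -- has the same pairing with it as `f` itself, and the difference pairs to zero.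
      have e1 := integral_condAvg_mul law hφ hi1
      have e2 := integral_condAvg_mul law (S := Set.Ici ((i₀ : ℤ) - (m + 1 : ℕ) + 1))
        (hφ.mono fun j hj => by simp only [Set.mem_Ici] at hj ⊢; push_cast; omega) hi1
      have eD : ∀ x, D k x = condAvg law (Set.Ici ((i₀ : ℤ) - (m + 1 : ℕ) + 1)) (f i₀) x
          - condAvg law (Set.Ici ((i₀ : ℤ) - m + 1)) (f i₀) x := fun x => by
        simp only [D, hk, if_true, Q, lagAvg, ← hi₀]
      have j1 := integrable_dual_mul ha hSL (memLp_lagAvg (hfm i₀) ha1 (hfL i₀) (m + 1) i₀)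
      have j2 := integrable_dual_mul ha hSL (memLp_lagAvg (hfm i₀) ha1 (hfL i₀) m i₀)
      simp only [lagAvg] at j1 j2
      calc ∫ x, |S x| ^ (a - 2) * S x * D k x ∂μ
          = ∫ x, (|S x| ^ (a - 2) * S x * condAvg law (Set.Ici ((i₀ : ℤ) - (m + 1 : ℕ) + 1)) (f i₀) x
            - |S x| ^ (a - 2) * S x * condAvg law (Set.Ici ((i₀ : ℤ) - m + 1)) (f i₀) x) ∂μ := by
            simp only [eD, mul_sub]
        _ = 0 := by
            rw [integral_sub j1 j2, e1, e2, sub_self]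
    · simp [D, hk]
  have key := hC μ D (δ m) (hδ0 m) (fun i => (hDm i).aestronglyMeasurable) hDn horth n
  have e : ∀ x, ∑ i ∈ Finset.range n, D i x = ∑ i ∈ Finset.range n, Q (s + i) x := by
    intro x
    rw [← Finset.sum_range_reflect]
    refine Finset.sum_congr rfl fun r hr => ?_
    have hr' := Finset.mem_range.1 hr
    simp only [D]
    rw [if_pos (by omega)]
    congr 2; omega
  simpa only [e] using key

/-- Bound for sums over an interval of times of the contribution of the lags in `[k, k')`. -/
lemma exists_eLpNorm_sum_lagAvg_sub_le {a : ℝ} (ha : 2 ≤ a) : ∃ C : ℝ, 1 ≤ C ∧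
    ∀ {E : Type u} [MeasurableSpace E] {law : Measure E} [IsProbabilityMeasure law]
      {f : ℕ → (ℤ → E) → ℝ} {δ : ℕ → ℝ}, (∀ i, Measurable (f i)) →
      (∀ i, MemLp (f i) (ENNReal.ofReal a) (iidLaw law ℤ)) → (∀ m, 0 ≤ δ m) →
      (∀ i m : ℕ, eLpNorm (fun z : (ℤ → E) × E =>
          f i z.1 - f i (Function.update z.1 ((i : ℤ) - m) z.2))
        (ENNReal.ofReal a) ((iidLaw law ℤ).prod law) ≤ ENNReal.ofReal (δ m)) →
      ∀ k k' s n : ℕ, k ≤ k' → eLpNorm (fun x => ∑ i ∈ Finset.range n,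
          (lagAvg law k' (s + i) (f (s + i)) x - lagAvg law k (s + i) (f (s + i)) x))
          (ENNReal.ofReal a) (iidLaw law ℤ)
        ≤ ENNReal.ofReal (C * Real.sqrt n * ∑ m ∈ Finset.Ico k k', δ m) := by
  obtain ⟨C, hC1, hC⟩ := exists_eLpNorm_sum_lag_le.{u} ha
  refine ⟨C, hC1, ?_⟩
  intro E _ law _ f δ hfm hfL hδ0 hδ k k' s n hk
  have e : (fun x => ∑ i ∈ Finset.range n,
      (lagAvg law k' (s + i) (f (s + i)) x - lagAvg law k (s + i) (f (s + i)) x))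
      = ∑ m ∈ Finset.Ico k k', fun x => ∑ i ∈ Finset.range n,
        (lagAvg law (m + 1) (s + i) (f (s + i)) x - lagAvg law m (s + i) (f (s + i)) x) := by
    ext x
    rw [Finset.sum_apply, Finset.sum_comm]
    refine Finset.sum_congr rfl fun i _ => ?_
    rw [Finset.sum_Ico_sub (fun m => lagAvg law m (s + i) (f (s + i)) x) hk]
  rw [e]
  refine (eLpNorm_sum_le (fun m _ => ?_) (by simp; linarith)).trans ?_
  · refine (Finset.measurable_sum _ fun i _ => ?_).aestronglyMeasurable
    exact (measurable_lagAvg (hfm _) _ _).sub (measurable_lagAvg (hfm _) _ _)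
  · rw [Finset.mul_sum, ENNReal.ofReal_sum_of_nonneg fun m _ => by
      have := hδ0 m
      positivity]
    exact Finset.sum_le_sum fun m _ => hC hfm hfL hδ0 hδ m s n

/-- The same with all the lags from `k` on. -/
lemma exists_eLpNorm_sum_sub_lagAvg_le {a : ℝ} (ha : 2 ≤ a) : ∃ C : ℝ, 1 ≤ C ∧
    ∀ {E : Type u} [MeasurableSpace E] {law : Measure E} [IsProbabilityMeasure law]
      {f : ℕ → (ℤ → E) → ℝ} {δ : ℕ → ℝ}, (∀ i, Measurable (f i)) →
      (∀ i, MemLp (f i) (ENNReal.ofReal a) (iidLaw law ℤ)) → (∀ m, 0 ≤ δ m) →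
      (∀ i m : ℕ, eLpNorm (fun z : (ℤ → E) × E =>
          f i z.1 - f i (Function.update z.1 ((i : ℤ) - m) z.2))
        (ENNReal.ofReal a) ((iidLaw law ℤ).prod law) ≤ ENNReal.ofReal (δ m)) →
      ∀ (k s n : ℕ) (T : ℝ), (∀ k', ∑ m ∈ Finset.Ico k k', δ m ≤ T) →
        eLpNorm (fun x => ∑ i ∈ Finset.range n,
          (f (s + i) x - lagAvg law k (s + i) (f (s + i)) x))
          (ENNReal.ofReal a) (iidLaw law ℤ)
        ≤ ENNReal.ofReal (C * Real.sqrt n * T) := by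
  obtain ⟨C, hC1, hC⟩ := exists_eLpNorm_sum_lagAvg_sub_le.{u} ha
  refine ⟨C, hC1, ?_⟩
  intro E _ law _ f δ hfm hfL hδ0 hδ k s n T hT
  have ha1 : 1 ≤ a := by linarith
  have hint : ∀ i, Integrable (f i) (iidLaw law ℤ) := fun i =>
    (hfL i).integrable (by simpa using ha1)
  have hlim : ∀ᵐ x ∂(iidLaw law ℤ), Tendsto (fun k' : ℕ => ∑ i ∈ Finset.range n,
      (lagAvg law k' (s + i) (f (s + i)) x - lagAvg law k (s + i) (f (s + i)) x)) atTop
      (𝓝 (∑ i ∈ Finset.range n, (f (s + i) x - lagAvg law k (s + i) (f (s + i)) x))) := by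
    have h : ∀ i : ℕ, ∀ᵐ x ∂(iidLaw law ℤ), Tendsto (fun k' : ℕ => lagAvg law k' i (f i) x) atTop
        (𝓝 (f i x)) := by
      intro i
      refine tendsto_condAvg law (hfm i) (hint i) (fun k₁ k₂ h j hj => ?_) fun j => ?_
      · simp only [Set.mem_Ici] at hj ⊢; omega
      · exact ⟨((i : ℤ) - j + 1).toNat, by simp only [Set.mem_Ici]; omega⟩
    filter_upwards [ae_all_iff.2 h] with x hx
    exact tendsto_finsetSum _ fun i _ => (hx (s + i)).sub_const _
  -- Fatou's lemma: the lag averages converge almost surely as the retained window exhausts the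
  -- past.
  refine (Lp.eLpNorm_lim_le_liminf_eLpNorm (fun k' => ?_) _ hlim).trans ?_
  · refine (Finset.measurable_sum _ fun i _ => ?_).aestronglyMeasurable
    exact (measurable_lagAvg (hfm _) _ _).sub (measurable_lagAvg (hfm _) _ _)
  · refine liminf_le_of_le (by isBoundedDefault) fun b hb => ?_
    obtain ⟨N, hN⟩ := eventually_atTop.1 hb
    refine (hN (max N k) (le_max_left _ _)).trans ?_
    refine (hC hfm hfL hδ0 hδ k _ s n (le_max_right _ _)).trans (ENNReal.ofReal_le_ofReal ?_)
    have := hT (max N k)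
    gcongr

end Causal

/-! ### Maximal inequalities for one layer of lags -/

section Truncation

/-- Truncation to zero outside `[-y, y]`. -/
def trunc (y z : ℝ) : ℝ := if |z| ≤ y then z else 0

lemma measurable_trunc (y : ℝ) : Measurable (trunc y) :=
  Measurable.ite (measurableSet_le (by fun_prop) measurable_const) measurable_id measurable_const

lemma abs_trunc_le {y : ℝ} (hy : 0 ≤ y) (z : ℝ) : |trunc y z| ≤ y := by
  unfold trunc; split_ifs with h
  · exact h
  · simpa using hy

lemma abs_trunc_le_abs (y z : ℝ) : |trunc y z| ≤ |z| := by
  unfold trunc; split_ifs with h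
  · exact le_rfl
  · simp

/-- As `B` is centred, the mean of its truncation is minus that of the part with `|B| > y`, where
`|B| ≤ |B| ^ q / y ^ (q - 1)`. This is the mean condition of `fukNagaev_of_bounded`. -/
lemma abs_integral_trunc_le {Ω : Type*} [MeasurableSpace Ω] {P : Measure Ω}
    [IsProbabilityMeasure P] {B : Ω → ℝ} {q y : ℝ} (hq : 1 < q) (hy : 0 < y)
    (hB : MemLp B (ENNReal.ofReal q) P) (hBm : Measurable B) (h0 : ∫ ω, B ω ∂P = 0) :
    |∫ ω, trunc y (B ω) ∂P| ≤ (∫ ω, |B ω| ^ q ∂P) / y ^ (q - 1) := by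
  have hint : Integrable B P := hB.integrable (by simpa using hq.le)
  have htr : Integrable (fun ω => trunc y (B ω)) P :=
    Integrable.of_bound ((measurable_trunc y).comp hBm).aestronglyMeasurable y
      (ae_of_all _ fun ω => abs_trunc_le hy.le _)
  have hq' := integrable_abs_rpow (by linarith) hB
  have e : ∫ ω, trunc y (B ω) ∂P = ∫ ω, (trunc y (B ω) - B ω) ∂P := by
    rw [integral_sub htr hint, h0, sub_zero]
  rw [e, ← integral_div]
  refine (abs_integral_le_integral_abs).trans (integral_mono (htr.sub hint).abs
    (hq'.div_const _) fun ω => ?_)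
  simp only [trunc]
  split_ifs with h
  · simp only [sub_self, abs_zero]; positivity
  · have h' : y < |B ω| := not_le.1 h
    have hB0 : 0 < |B ω| := hy.trans h'
    rw [zero_sub, abs_neg, le_div_iff₀ (by positivity)]
    calc |B ω| * y ^ (q - 1) ≤ |B ω| * |B ω| ^ (q - 1) := by
          gcongr
      _ = |B ω| ^ q := by
          rw [Real.rpow_sub_one hB0.ne']; field_simp

/-- Maximal inequality for partial sums of truncated independent variables. -/
lemma measure_max_trunc_le {Ω : Type*} [MeasurableSpace Ω] {P : Measure Ω}
    [IsProbabilityMeasure P] {B : ℕ → Ω → ℝ} (hind : iIndepFun B P)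
    (hmeas : ∀ i, Measurable (B i)) {q : ℝ} (hq : 2 ≤ q)
    (hL : ∀ i, MemLp (B i) (ENNReal.ofReal q) P) (h0 : ∀ i, ∫ ω, B i ω ∂P = 0)
    {M V : ℝ} (hM : 0 < M) (hV : 0 < V) (hBM : ∀ i, ∫ ω, |B i ω| ^ q ∂P ≤ M)
    (hBV : ∀ i, ∫ ω, B i ω ^ 2 ∂P ≤ V) {R : ℕ} (hR : 1 ≤ R) {x y : ℝ} (hx : 0 < x) (hy : 0 < y) :
    P {ω | ∃ k ≤ R, 3 * x < |∑ j ∈ Finset.range k, trunc y (B j ω)|}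
      ≤ ENNReal.ofReal (6 * Real.exp 2 * (Real.exp (-(x ^ 2 / (4 * Real.exp q * (R * V))))
        + (R * M / y ^ q) ^ (x / (2 * y)))) := by
  have hR0 : (0:ℝ) < R := by exact_mod_cast hR
  set T : ℝ := Real.exp 2 * (Real.exp (-(x ^ 2 / (4 * Real.exp q * (R * V))))
    + (R * M / y ^ q) ^ (x / (2 * y))) with hT
  have hT0 : 0 ≤ T := by positivity
  have hm2 : ∀ j, Integrable (fun ω => B j ω ^ 2) P := fun j => by
    refine MemLp.integrable_sq ((hL j).mono_exponent ?_)
    rw [show (2 : ℝ≥0∞) = ENNReal.ofReal 2 by norm_num]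
    exact ENNReal.ofReal_le_ofReal hq
  have side : ∀ σ : ℝ, |σ| = 1 → ∀ k ≤ R,
      P {ω | x ≤ ∑ j ∈ Finset.range k, σ * trunc y (B j ω)} ≤ ENNReal.ofReal T := by
    intro σ hσ k hk
    have hφ : Measurable fun z : ℝ => σ * trunc y z := (measurable_trunc y).const_mul σ
    have hI : iIndepFun (fun j ω => σ * trunc y (B j ω)) P :=
      hind.comp (fun _ z => σ * trunc y z) fun _ => hφ
    have habs : ∀ z, |σ * trunc y z| = |trunc y z| := fun z => by rw [abs_mul, hσ, one_mul]
    have hkR : (k : ℝ) ≤ R := by exact_mod_cast hk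
    have hsum : ∀ (g : ℕ → ℝ) (c : ℝ), 0 ≤ c → (∀ j, g j ≤ c) →
        ∑ j ∈ Finset.range k, g j ≤ R * c := by
      intro g c hc hg
      calc ∑ j ∈ Finset.range k, g j ≤ ∑ j ∈ Finset.range k, c := Finset.sum_le_sum fun j _ => hg j
        _ = k * c := by simp
        _ ≤ R * c := by gcongr
    have hfn := fukNagaev_of_bounded hI (fun j => hφ.comp (hmeas j)) (Finset.range k) hq hy
      (V := R * V) (m := R * M) (by positivity) (by positivity) hx
      (fun j ω => by rw [habs]; exact abs_trunc_le hy.le _) ?_ ?_ ?_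
    · rw [← ENNReal.ofReal_toReal (measure_ne_top P
        {ω | x ≤ ∑ j ∈ Finset.range k, σ * trunc y (B j ω)})]
      exact ENNReal.ofReal_le_ofReal hfn
    · rw [mul_div_assoc]
      refine hsum _ _ (by positivity) fun j => ?_
      rw [integral_const_mul]
      refine (le_abs_self _).trans ?_
      rw [abs_mul, hσ, one_mul]
      exact (abs_integral_trunc_le (by linarith) hy (hL j) (hmeas j) (h0 j)).trans
        (by gcongr; exact hBM j)
    · refine hsum _ _ hV.le fun j => le_trans ?_ (hBV j)
      refine integral_mono_of_nonneg (ae_of_all _ fun ω => sq_nonneg _) (hm2 j)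
        (ae_of_all _ fun ω => ?_)
      simp only
      rw [← sq_abs, habs, ← sq_abs (B j ω)]
      exact pow_le_pow_left₀ (abs_nonneg _) (abs_trunc_le_abs _ _) 2
    · refine hsum _ _ hM.le fun j => le_trans ?_ (hBM j)
      refine integral_mono_of_nonneg (ae_of_all _ fun ω => by positivity)
        (integrable_abs_rpow (by linarith) (hL j)) (ae_of_all _ fun ω => ?_)
      simp only
      rw [habs]
      exact Real.rpow_le_rpow (abs_nonneg _) (abs_trunc_le_abs _ _) (by linarith)
  have hone : ∀ k ≤ R, P {ω | x < |∑ j ∈ Finset.range k, trunc y (B j ω)|}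
      ≤ ENNReal.ofReal (2 * T) := by
    intro k hk
    have h1 := side 1 (by simp) k hk
    have h2 := side (-1) (by simp) k hk
    rw [two_mul, ENNReal.ofReal_add hT0 hT0]
    refine (measure_mono ?_).trans ((measure_union_le _ _).trans (add_le_add h1 h2))
    intro ω hω
    simp only [Set.mem_ofPred_eq, Set.mem_union] at hω ⊢
    simp only [one_mul, neg_mul, Finset.sum_neg_distrib]
    rcases lt_abs.1 hω with h | h
    · exact Or.inl h.le
    · exact Or.inr h.le
  have hI : iIndepFun (fun j ω => trunc y (B j ω)) P :=
    hind.comp (fun _ => trunc y) fun _ => measurable_trunc y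
  refine (etemadi hI (fun j => (measurable_trunc y).comp (hmeas j)) R hone).trans_eq ?_
  rw [show (3 : ℝ≥0∞) = ENNReal.ofReal 3 by norm_num, ← ENNReal.ofReal_mul (by norm_num)]
  congr 1
  rw [hT]; ring

end Truncation

section Layer

open Measure

lemma sum_range_mul_add (g : ℕ → ℝ) (τ m : ℕ) :
    ∑ i ∈ Finset.range m, g i = ∑ r ∈ Finset.range (m / τ), ∑ i ∈ Finset.range τ, g (r * τ + i)
      + ∑ i ∈ Finset.range (m % τ), g (m / τ * τ + i) := by
  have h : ∀ k, ∑ i ∈ Finset.range (k * τ), g i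
      = ∑ r ∈ Finset.range k, ∑ i ∈ Finset.range τ, g (r * τ + i) := by
    intro k
    induction k with
    | zero => simp
    | succ k ih => rw [Finset.sum_range_succ, ← ih, add_mul, one_mul, Finset.sum_range_add]
  rw [← h, ← Finset.sum_range_add]
  congr 2
  rw [mul_comm]; exact (Nat.div_add_mod m τ).symm

lemma sum_range_even_odd (B : ℕ → ℝ) (k : ℕ) :
    ∑ r ∈ Finset.range k, B r = ∑ j ∈ Finset.range ((k + 1) / 2), B (2 * j)
      + ∑ j ∈ Finset.range (k / 2), B (2 * j + 1) := by
  induction k with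
  | zero => simp
  | succ k ih =>
    rw [Finset.sum_range_succ, ih]
    rcases Nat.even_or_odd' k with ⟨c, rfl | rfl⟩
    · have h1 : (2 * c + 1) / 2 = c := by omega
      have h2 : (2 * c + 1 + 1) / 2 = c + 1 := by omega
      have h3 : 2 * c / 2 = c := by omega
      rw [h1, h2, h3, Finset.sum_range_succ]; ring
    · have h1 : (2 * c + 1 + 1) / 2 = c + 1 := by omega
      have h2 : (2 * c + 1 + 1 + 1) / 2 = c + 1 := by omega
      have h3 : (2 * c + 1) / 2 = c := by omega
      rw [h1, h2, h3, Finset.sum_range_succ (fun j => B (2 * j + 1))]; ring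

/-- As long as no block sum exceeds `y`, truncation changes nothing. A partial sum then consists of
its even blocks, its odd blocks and one incomplete block. -/
lemma abs_sum_range_le_of_blocks {g : ℕ → ℝ} {τ R : ℕ} (hτ : 1 ≤ τ) {x y : ℝ}
    (hbig : ∀ r ≤ R, ∀ m ≤ τ, |∑ i ∈ Finset.range m, g (r * τ + i)| ≤ y)
    (hev : ∀ k ≤ R, |∑ j ∈ Finset.range k, trunc y (∑ i ∈ Finset.range τ, g ((2 * j) * τ + i))| ≤ x)
    (hod : ∀ k ≤ R,
      |∑ j ∈ Finset.range k, trunc y (∑ i ∈ Finset.range τ, g ((2 * j + 1) * τ + i))| ≤ x)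
    {m : ℕ} (hm : m ≤ R * τ) : |∑ i ∈ Finset.range m, g i| ≤ 2 * x + y := by
  have hk : m / τ ≤ R := Nat.div_le_of_le_mul (by rwa [mul_comm])
  have htr : ∀ r ≤ R, trunc y (∑ i ∈ Finset.range τ, g (r * τ + i))
      = ∑ i ∈ Finset.range τ, g (r * τ + i) := fun r hr => by
    rw [trunc, if_pos (hbig r hr τ le_rfl)]
  rw [sum_range_mul_add g τ m,
    sum_range_even_odd (fun r => ∑ i ∈ Finset.range τ, g (r * τ + i))]
  have h1 := hev ((m / τ + 1) / 2) (by omega)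
  have h2 := hod (m / τ / 2) (by omega)
  rw [Finset.sum_congr rfl fun j hj => htr (2 * j) (by
    have := Finset.mem_range.1 hj; omega)] at h1
  rw [Finset.sum_congr rfl fun j hj => htr (2 * j + 1) (by
    have := Finset.mem_range.1 hj; omega)] at h2
  have h3 := hbig (m / τ) hk (m % τ) (Nat.mod_lt _ hτ).le
  have h4 := abs_add_le (∑ j ∈ Finset.range ((m / τ + 1) / 2), ∑ i ∈ Finset.range τ, g (2 * j * τ + i)
      + ∑ j ∈ Finset.range (m / τ / 2), ∑ i ∈ Finset.range τ, g ((2 * j + 1) * τ + i))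
      (∑ i ∈ Finset.range (m % τ), g (m / τ * τ + i))
  have h5 := abs_add_le
    (∑ j ∈ Finset.range ((m / τ + 1) / 2), ∑ i ∈ Finset.range τ, g (2 * j * τ + i))
    (∑ j ∈ Finset.range (m / τ / 2), ∑ i ∈ Finset.range τ, g ((2 * j + 1) * τ + i))
  linarith

end Layer

section LayerBound

open Measure

universe u

/-- An array of random variables with lag increments bounded by `δ` in `L^a`. -/
structure LagBound {E : Type u} [MeasurableSpace E] (law : Measure E) [IsProbabilityMeasure law]
    (a : ℝ) (f : ℕ → (ℤ → E) → ℝ) (δ : ℕ → ℝ) : Prop where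
  measurable : ∀ i, Measurable (f i)
  memLp : ∀ i, MemLp (f i) (ENNReal.ofReal a) (iidLaw law ℤ)
  nonneg : ∀ m, 0 ≤ δ m
  increment : ∀ i m : ℕ, eLpNorm (fun z : (ℤ → E) × E =>
      f i z.1 - f i (Function.update z.1 ((i : ℤ) - m) z.2))
    (ENNReal.ofReal a) ((iidLaw law ℤ).prod law) ≤ ENNReal.ofReal (δ m)

lemma exists_measure_max_sum_le {q : ℝ} (hq : 2 < q) : ∃ C : ℝ, 1 ≤ C ∧
    ∀ {Ω : Type u} [MeasurableSpace Ω] (P : Measure Ω) (g : ℕ → Ω → ℝ) (c : ℝ) (τ s : ℕ),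
      1 ≤ τ → 0 ≤ c → (∀ i, Measurable (g i)) →
      (∀ s n, eLpNorm (fun ω => ∑ i ∈ Finset.range n, g (s + i) ω) (ENNReal.ofReal q) P
        ≤ ENNReal.ofReal (c * Real.sqrt n)) →
      ∀ y : ℝ, 0 < y → P {ω | ∃ m ≤ τ, y < |∑ i ∈ Finset.range m, g (s + i) ω|}
        ≤ ENNReal.ofReal ((C * c * Real.sqrt τ / y) ^ q) := by
  obtain ⟨C, hC1, hC⟩ := exists_measure_max_le.{u} hq
  refine ⟨C, hC1, fun {Ω} _ P g c τ s hτ hc hg hS y hy => ?_⟩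
  refine hC P (fun m ω => ∑ i ∈ Finset.range m, g (s + i) ω) c τ hτ hc (by simp)
    (fun m => (Finset.measurable_sum _ fun i _ => hg _).aestronglyMeasurable)
    (fun m m' hm _ => ?_) y hy
  have e : ∀ ω, ∑ i ∈ Finset.range m', g (s + i) ω - ∑ i ∈ Finset.range m, g (s + i) ω
      = ∑ i ∈ Finset.range (m' - m), g (s + m + i) ω := by
    intro ω
    obtain ⟨d, rfl⟩ := Nat.exists_eq_add_of_le hm
    rw [Finset.sum_range_add, add_sub_cancel_left, Nat.add_sub_cancel_left]
    simp only [add_assoc]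
  simp only [e]
  refine (hS (s + m) (m' - m)).trans_eq ?_
  rw [Nat.cast_sub hm]

/-- The lags below `τ` make the block sum over `[rτ, rτ + τ)` depend only on innovations in `(rτ -
τ, rτ + τ - 1]`, so blocks of equal parity are independent. The event that some block is large is
stated apart from the deviation on its complement, because for short lags the first must be bounded
differently. On the complement the sums may be truncated. -/
lemma exists_layer_bound {q : ℝ} (hq : 2 < q) : ∃ C : ℝ, 1 ≤ C ∧
    ∀ {E : Type u} [MeasurableSpace E] {law : Measure E} [IsProbabilityMeasure law]
      {f : ℕ → (ℤ → E) → ℝ} {δ δ₂ : ℕ → ℝ}, (∀ i : ℕ, DependsOn (f i) (Set.Iic (i : ℤ))) →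
      LagBound law q f δ → LagBound law 2 f δ₂ →
      ∀ (k τ R : ℕ), k ≤ τ → 1 ≤ τ → 1 ≤ R → ∀ D D₂ : ℝ, 0 < D → 0 < D₂ →
      ∑ m ∈ Finset.Ico k τ, δ m ≤ D → ∑ m ∈ Finset.Ico k τ, δ₂ m ≤ D₂ → ∀ y : ℝ, 0 < y →
      iidLaw law ℤ {x | ∃ r ≤ R, ∃ m ≤ τ, y < |∑ i ∈ Finset.range m,
          (lagAvg law τ (r * τ + i) (f (r * τ + i)) x
            - lagAvg law k (r * τ + i) (f (r * τ + i)) x)|}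
        ≤ ENNReal.ofReal (C * (R * (C * Real.sqrt τ * D / y) ^ q)) ∧
      iidLaw law ℤ {x | (∀ r ≤ R, ∀ m ≤ τ, |∑ i ∈ Finset.range m,
          (lagAvg law τ (r * τ + i) (f (r * τ + i)) x
            - lagAvg law k (r * τ + i) (f (r * τ + i)) x)| ≤ y) ∧
          ∃ m ≤ R * τ, 37 * y < |∑ i ∈ Finset.range m,
            (lagAvg law τ i (f i) x - lagAvg law k i (f i) x)|}
        ≤ ENNReal.ofReal (C * (Real.exp (-(y ^ 2 / (C * (R * τ * D₂ ^ 2))))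
          + (R * (C * Real.sqrt τ * D / y) ^ q) ^ (3 : ℝ))) := by
  obtain ⟨C₁, hC₁1, hC₁⟩ := exists_measure_max_sum_le.{u} hq
  obtain ⟨C₂, hC₂1, hC₂⟩ := exists_eLpNorm_sum_lagAvg_sub_le.{u} (a := q) hq.le
  obtain ⟨C₃, hC₃1, hC₃⟩ := exists_eLpNorm_sum_lagAvg_sub_le.{u} (a := 2) le_rfl
  set C : ℝ := 12 * Real.exp 2 + Real.exp q * C₃ ^ 2 + C₁ * C₂ + 2 with hCdef
  have hC12 : C₂ ≤ C₁ * C₂ := by nlinarith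
  have hCp1 : 0 ≤ Real.exp q * C₃ ^ 2 := by positivity
  have hCp2 : 0 ≤ 12 * Real.exp 2 := by positivity
  have hCp3 : 0 ≤ C₁ * C₂ := by positivity
  refine ⟨C, by linarith, ?_⟩
  intro E _ law _ f δ δ₂ hdep hδ hδ₂ k τ R hkτ hτ hR D D₂ hD hD₂ hsD hsD₂ y hy
  set μ := iidLaw law ℤ
  have hq0 : 0 < q := by linarith
  have hR0 : (1:ℝ) ≤ R := by exact_mod_cast hR
  have hτ0 : (1:ℝ) ≤ τ := by exact_mod_cast hτ
  set g : ℕ → (ℤ → E) → ℝ := fun i x => lagAvg law τ i (f i) x - lagAvg law k i (f i) x with hg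
  have hgm : ∀ i, Measurable (g i) := fun i =>
    (measurable_lagAvg (hδ.measurable i) _ _).sub (measurable_lagAvg (hδ.measurable i) _ _)
  have hgL : ∀ i, MemLp (g i) (ENNReal.ofReal q) μ := fun i =>
    (memLp_lagAvg (hδ.measurable i) (by linarith) (hδ.memLp i) _ _).sub
      (memLp_lagAvg (hδ.measurable i) (by linarith) (hδ.memLp i) _ _)
  have hgL2 : ∀ i, MemLp (g i) (ENNReal.ofReal 2) μ := fun i =>
    (memLp_lagAvg (hδ₂.measurable i) (by norm_num) (hδ₂.memLp i) _ _).sub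
      (memLp_lagAvg (hδ₂.measurable i) (by norm_num) (hδ₂.memLp i) _ _)
  have hnq : ∀ s n, eLpNorm (fun x => ∑ i ∈ Finset.range n, g (s + i) x) (ENNReal.ofReal q) μ
      ≤ ENNReal.ofReal (C₂ * D * Real.sqrt n) := by
    intro s n
    refine (hC₂ hδ.measurable hδ.memLp hδ.nonneg hδ.increment k τ s n hkτ).trans
      (ENNReal.ofReal_le_ofReal ?_)
    rw [mul_right_comm]
    gcongr
  have hn2 : ∀ s n, eLpNorm (fun x => ∑ i ∈ Finset.range n, g (s + i) x) (ENNReal.ofReal 2) μ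
      ≤ ENNReal.ofReal (C₃ * D₂ * Real.sqrt n) := by
    intro s n
    refine (hC₃ hδ₂.measurable hδ₂.memLp hδ₂.nonneg hδ₂.increment k τ s n hkτ).trans
      (ENNReal.ofReal_le_ofReal ?_)
    rw [mul_right_comm]
    gcongr
  constructor
  · have hcov : {x | ∃ r ≤ R, ∃ m ≤ τ, y < |∑ i ∈ Finset.range m, g (r * τ + i) x|}
        ⊆ ⋃ r ∈ Finset.range (R + 1), {x | ∃ m ≤ τ, y < |∑ i ∈ Finset.range m, g (r * τ + i) x|} := by
      rintro x ⟨r, hr, h⟩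
      simp only [Set.mem_iUnion, Finset.mem_range]
      exact ⟨r, by omega, h⟩
    refine (measure_mono hcov).trans ((measure_biUnion_finset_le _ _).trans ?_)
    refine (Finset.sum_le_sum fun r _ => hC₁ μ g (C₂ * D) τ (r * τ) hτ (by positivity) hgm hnq
      y hy).trans ?_
    rw [Finset.sum_const, Finset.card_range, nsmul_eq_mul, ← ENNReal.ofReal_natCast,
      ← ENNReal.ofReal_mul (by positivity)]
    refine ENNReal.ofReal_le_ofReal ?_
    push_cast
    calc ((R : ℝ) + 1) * (C₁ * (C₂ * D) * Real.sqrt τ / y) ^ q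
        ≤ (C * R) * (C * Real.sqrt τ * D / y) ^ q := by
          gcongr ?_ * ?_ ^ q
          · nlinarith
          · gcongr ?_ / y
            calc C₁ * (C₂ * D) * Real.sqrt τ = (C₁ * C₂) * Real.sqrt τ * D := by ring
              _ ≤ _ := by gcongr; linarith
      _ = _ := by ring
  · set B : ℕ → (ℤ → E) → ℝ := fun r x => ∑ i ∈ Finset.range τ, g (r * τ + i) x with hB
    have hBm : ∀ r, Measurable (B r) := fun r => Finset.measurable_sum _ fun i _ => hgm _
    have hBL : ∀ r, MemLp (B r) (ENNReal.ofReal q) μ := fun r => memLp_finsetSum _ fun i _ => hgL _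
    have hBL2 : ∀ r, MemLp (B r) (ENNReal.ofReal 2) μ := fun r =>
      memLp_finsetSum _ fun i _ => hgL2 _
    have hmean : ∀ i k', ∫ x, lagAvg law k' i (f i) x ∂μ = ∫ x, f i x ∂μ := by
      intro i k'
      have := integral_condAvg_mul law (S := Set.Ici ((i : ℤ) - k' + 1)) (φ := fun _ => 1) (f := f i)
        (fun _ _ _ => rfl)
        (by simpa using (hδ.memLp i).integrable (by simp; linarith))
      simpa [lagAvg] using this
    have hB0 : ∀ r, ∫ x, B r x ∂μ = 0 := by
      intro r
      rw [integral_finsetSum _ fun i _ => (hgL _).integrable (by simp; linarith)]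
      refine Finset.sum_eq_zero fun i _ => ?_
      simp only [hg]
      rw [integral_sub, hmean, hmean, sub_self]
      · exact (memLp_lagAvg (hδ.measurable _) (by linarith) (hδ.memLp _) _ _).integrable
          (by simp; linarith)
      · exact (memLp_lagAvg (hδ.measurable _) (by linarith) (hδ.memLp _) _ _).integrable
          (by simp; linarith)
    have hBM : ∀ r, ∫ x, |B r x| ^ q ∂μ ≤ (C₂ * D * Real.sqrt τ) ^ q := fun r =>
      (eLpNorm_le_ofReal_iff hq0 (by positivity) (hBL r)).1 (hnq _ _)
    have hBV : ∀ r, ∫ x, B r x ^ 2 ∂μ ≤ (C₃ * D₂ * Real.sqrt τ) ^ 2 := by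
      intro r
      have := (eLpNorm_le_ofReal_iff (by norm_num) (by positivity) (hBL2 r)).1 (hn2 _ _)
      simpa only [Real.rpow_two, sq_abs] using this
    have hBd : ∀ r, DependsOn (B r) (Set.Ioc ((r : ℤ) * τ - τ) (r * τ + τ - 1)) := by
      intro r x x' h
      refine Finset.sum_congr rfl fun i hi => ?_
      have hi' := Finset.mem_range.1 hi
      have h1 : ∀ k' ≤ τ, lagAvg law k' (r * τ + i) (f (r * τ + i)) x
          = lagAvg law k' (r * τ + i) (f (r * τ + i)) x' := by
        intro k' hk'
        refine dependsOn_lagAvg (hdep _) fun j hj => h j ?_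
        simp only [Set.mem_Ioc] at hj ⊢
        push_cast at hj
        omega
      simp only [hg, h1 τ le_rfl, h1 k hkτ]
    have hind : ∀ c : ℕ, iIndepFun (fun j => B (2 * j + c)) μ := by
      intro c
      refine iIndepFun_of_dependsOn law
        (S := fun j : ℕ => Set.Ioc (((2 * j + c : ℕ) : ℤ) * τ - τ) ((2 * j + c : ℕ) * τ + τ - 1))
        (fun j j' hjj => ?_) (fun j => hBm _) fun j => hBd _
      have key : ∀ a b : ℕ, a < b → ∀ z : ℤ, z ≤ ((2 * a + c : ℕ) : ℤ) * τ + τ - 1 →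
          ¬ (((2 * b + c : ℕ) : ℤ) * τ - τ < z) := by
        intro a b hab z hz hz'
        have h1 : ((2 * a + c : ℕ) : ℤ) + 2 ≤ ((2 * b + c : ℕ) : ℤ) := by push_cast; omega
        have h2 : (((2 * a + c : ℕ) : ℤ) + 2) * τ ≤ ((2 * b + c : ℕ) : ℤ) * τ := by gcongr
        linarith
      refine Set.disjoint_left.2 fun z hz hz' => ?_
      simp only [Set.mem_Ioc] at hz hz'
      rcases lt_or_gt_of_ne hjj with h | h
      · exact key j j' h z hz.2 hz'.1
      · exact key j' j h z hz'.2 hz.1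
    have hmax : ∀ c : ℕ, μ {x | ∃ k' ≤ R, 18 * y < |∑ j ∈ Finset.range k',
        trunc y (B (2 * j + c) x)|}
        ≤ ENNReal.ofReal (6 * Real.exp 2 * (Real.exp (-(y ^ 2 / (C * (R * τ * D₂ ^ 2))))
          + (R * (C * Real.sqrt τ * D / y) ^ q) ^ (3 : ℝ))) := by
      intro c
      -- With `x = 6y` the polynomial term has the exponent `x / (2y) = 3`, large enough for a later
      -- union over `p ^ 2` pairs. Etemadi's factor makes the level `18y`; two parities and one
      -- incomplete block add up to `37y`.
      have := measure_max_trunc_le (hind c) (fun j => hBm _) hq.le (fun j => hBL _)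
        (fun j => hB0 _) (M := (C₂ * D * Real.sqrt τ) ^ q) (V := (C₃ * D₂ * Real.sqrt τ) ^ 2)
        (by positivity) (by positivity) (fun j => hBM _) (fun j => hBV _) hR (x := 6 * y)
        (by positivity) hy
      rw [show 3 * (6 * y) = 18 * y by ring] at this
      refine this.trans (ENNReal.ofReal_le_ofReal ?_)
      have e3 : 6 * y / (2 * y) = 3 := by field_simp; norm_num
      rw [e3, mul_div_assoc, ← Real.div_rpow (by positivity) hy.le]
      gcongr ?_ * (Real.exp (-?_) + (?_ * (?_ / y) ^ q) ^ (3:ℝ))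
      · rw [mul_pow (C₃ * D₂), mul_pow 6 y, Real.sq_sqrt (by positivity),
          div_le_div_iff₀ (by positivity) (by positivity)]
        have : Real.exp q * C₃ ^ 2 ≤ C := by linarith
        calc y ^ 2 * (4 * Real.exp q * (R * ((C₃ * D₂) ^ 2 * τ)))
            = 4 * y ^ 2 * (R * τ * D₂ ^ 2) * (Real.exp q * C₃ ^ 2) := by ring
          _ ≤ 36 * y ^ 2 * (R * τ * D₂ ^ 2) * C := by gcongr; norm_num
          _ = 6 ^ 2 * y ^ 2 * (C * (R * τ * D₂ ^ 2)) := by ring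
      · calc C₂ * D * Real.sqrt τ = C₂ * Real.sqrt τ * D := by ring
          _ ≤ _ := by gcongr; linarith
    have hcov : {x | (∀ r ≤ R, ∀ m ≤ τ, |∑ i ∈ Finset.range m, g (r * τ + i) x| ≤ y) ∧
          ∃ m ≤ R * τ, 37 * y < |∑ i ∈ Finset.range m, g i x|}
        ⊆ {x | ∃ k' ≤ R, 18 * y < |∑ j ∈ Finset.range k', trunc y (B (2 * j + 0) x)|}
          ∪ {x | ∃ k' ≤ R, 18 * y < |∑ j ∈ Finset.range k', trunc y (B (2 * j + 1) x)|} := by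
      rintro x ⟨hbig, m, hm, hx⟩
      by_contra hcon
      simp only [Set.mem_union, Set.mem_ofPred_eq, not_or, not_exists, not_and, not_lt] at hcon
      have := abs_sum_range_le_of_blocks (g := fun i => g i x) hτ hbig hcon.1 hcon.2 hm
      linarith
    refine (measure_mono hcov).trans ((measure_union_le _ _).trans
      ((add_le_add (hmax 0) (hmax 1)).trans ?_))
    rw [← ENNReal.ofReal_add (by positivity) (by positivity)]
    refine ENNReal.ofReal_le_ofReal ?_
    rw [← add_mul]
    gcongr
    linarith

end LayerBound

/-! ### Concentration of partial sums, uniformly over pairs of coordinates -/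

section Concentration

open Measure

universe u

/-- Arrays indexed by pairs of coordinates whose dependence is controlled through single
coordinates. -/
structure PairArray {E : Type u} [MeasurableSpace E] (law : Measure E) [IsProbabilityMeasure law]
    (p : ℕ) (q A : ℝ) (f : Fin p × Fin p → ℕ → (ℤ → E) → ℝ) (δ δ₂ : Fin p × Fin p → ℕ → ℝ)
    (s : Fin p → ℝ) (N : ℝ) (U : ℕ → (ℤ → E) → ℝ≥0∞) : Prop where
  dependsOn : ∀ e (i : ℕ), DependsOn (f e i) (Set.Iic (i : ℤ))
  lagBound : ∀ e, LagBound law q (f e) (δ e)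
  lagBound₂ : ∀ e, LagBound law 2 (f e) (δ₂ e)
  s_pos : ∀ j, 0 < s j
  N_pos : 0 < N
  sum_le : ∀ e k k', ∑ m ∈ Finset.Ico k k', δ e m ≤ (s e.1 + s e.2) * ((k : ℝ) + 1) ^ (-A)
  sum_le₂ : ∀ e k k', ∑ m ∈ Finset.Ico k k', δ₂ e m ≤ N * ((k : ℝ) + 1) ^ (-A)
  measurable_U : ∀ i, Measurable (U i)
  le_U : ∀ e i x, ‖f e i x‖ₑ ^ q ≤ U i x
  lintegral_U : ∀ i, ∫⁻ x, U i x ∂(iidLaw law ℤ) ≤ ENNReal.ofReal (∑ j, s j ^ q)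

lemma add_rpow_le_two_rpow_mul {a b q : ℝ} (ha : 0 ≤ a) (hb : 0 ≤ b) (hq : 0 ≤ q) :
    (a + b) ^ q ≤ 2 ^ q * (a ^ q + b ^ q) := by
  have h1 : 0 ≤ a ^ q := by positivity
  have h2 : 0 ≤ b ^ q := by positivity
  have h3 : (a + b) ^ q ≤ (2 * max a b) ^ q := by
    gcongr; linarith [le_max_left a b, le_max_right a b]
  rw [Real.mul_rpow (by norm_num) (by positivity)] at h3
  refine h3.trans ?_
  gcongr
  rcases max_choice a b with h | h <;> rw [h] <;> linarith

/-- Passing from coordinates to pairs costs a single factor `p`, the one inside `JqA`. -/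
lemma sum_pair_rpow_le {p : ℕ} {s : Fin p → ℝ} (hs : ∀ j, 0 < s j) {q : ℝ} (hq : 0 ≤ q) :
    ∑ e : Fin p × Fin p, (s e.1 + s e.2) ^ q ≤ 2 * 2 ^ q * (p * ∑ j, s j ^ q) := by
  calc ∑ e : Fin p × Fin p, (s e.1 + s e.2) ^ q
      ≤ ∑ e : Fin p × Fin p, 2 ^ q * (s e.1 ^ q + s e.2 ^ q) :=
        Finset.sum_le_sum fun e _ => add_rpow_le_two_rpow_mul (hs _).le (hs _).le hq
    _ = 2 * 2 ^ q * (p * ∑ j, s j ^ q) := by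
        rw [← Finset.mul_sum, Finset.sum_add_distrib, Fintype.sum_prod_type, Fintype.sum_prod_type]
        simp only [Finset.sum_const, Finset.card_univ, Fintype.card_fin, nsmul_eq_mul]
        rw [← Finset.mul_sum]
        ring

/-- Bookkeeping of exponents: `R` blocks, each contributing `(√τ k ^ (-A)) ^ q`, with `R τ` of order
`n` and `τ` of order `k`, give `n k ^ (q/2 - 1 - A q)`. The alternative `A ≤ 0` is the case where `k
↦ k ^ (-A)` is not decreasing. -/
lemma poly_term_le {q A C B n k τ R a lam y : ℝ} (hq : 2 < q) (hC : 0 ≤ C) (hCB : C ≤ B)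
    (hB : 0 < B) (hk : 1 ≤ k) (hkτ : k ≤ τ) (hτk : τ ≤ 2 * k) (hR : R * τ ≤ 2 * n) (hR0 : 0 ≤ R)
    (ha : 0 ≤ a) (hlam : 0 < lam) (hy : 0 < y) :
    R * (C * Real.sqrt τ * (a * (k + 1) ^ (-A)) / (B * lam * y)) ^ q
      ≤ 2 ^ q * (n * k ^ (q / 2 - 1 - A * q) * lam ^ (-q)) * (a ^ q / y ^ q) ∨ A ≤ 0 := by
  rcases le_or_gt A 0 with hA | hA
  · exact Or.inr hA
  left
  have hk0 : 0 < k := by linarith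
  have hτ0 : 0 < τ := by linarith
  have hn0 : 0 ≤ n := by nlinarith
  have h1 : C * Real.sqrt τ * (a * (k + 1) ^ (-A)) / (B * lam * y)
      ≤ Real.sqrt τ * (k ^ (-A)) * lam⁻¹ * (a / y) := by
    have hkA : (k + 1) ^ (-A) ≤ k ^ (-A) :=
      Real.rpow_le_rpow_of_nonpos hk0 (by linarith) (by linarith)
    rw [div_le_iff₀ (by positivity)]
    calc C * Real.sqrt τ * (a * (k + 1) ^ (-A)) ≤ B * Real.sqrt τ * (a * k ^ (-A)) := by gcongr
      _ = _ := by field_simp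
  have hsq : Real.sqrt τ ^ q = τ * τ ^ (q / 2 - 1) := by
    rw [Real.sqrt_eq_rpow, ← Real.rpow_mul hτ0.le, Real.rpow_sub_one hτ0.ne']
    field_simp
  calc R * (C * Real.sqrt τ * (a * (k + 1) ^ (-A)) / (B * lam * y)) ^ q
      ≤ R * (Real.sqrt τ * (k ^ (-A)) * lam⁻¹ * (a / y)) ^ q := by
        gcongr
    _ = (R * τ) * τ ^ (q / 2 - 1) * k ^ (-A * q) * lam ^ (-q) * (a ^ q / y ^ q) := by
        rw [Real.mul_rpow (by positivity) (by positivity), Real.mul_rpow (by positivity)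
          (by positivity), Real.mul_rpow (by positivity) (by positivity), hsq,
          ← Real.rpow_mul hk0.le, Real.inv_rpow hlam.le, Real.rpow_neg hlam.le,
          Real.div_rpow ha hy.le]
        ring
    _ ≤ (2 * n) * (2 * k) ^ (q / 2 - 1) * k ^ (-A * q) * lam ^ (-q) * (a ^ q / y ^ q) := by
        gcongr
        linarith
    _ = 2 ^ (q / 2) * (n * k ^ (q / 2 - 1 - A * q) * lam ^ (-q)) * (a ^ q / y ^ q) := by
        rw [Real.mul_rpow (by norm_num) hk0.le, Real.rpow_sub_one (by norm_num : (2:ℝ) ≠ 0),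
          sub_eq_add_neg (q / 2 - 1), Real.rpow_add hk0, neg_mul]
        ring
    _ ≤ 2 ^ q * (n * k ^ (q / 2 - 1 - A * q) * lam ^ (-q)) * (a ^ q / y ^ q) := by
        gcongr
        · norm_num
        · linarith

lemma div_add_one_mul_le {n τ : ℕ} (hτ : τ ≤ n) : ((n / τ + 1 : ℕ) : ℝ) * τ ≤ 2 * n := by
  have h1 : (n / τ + 1) * τ ≤ 2 * n := by
    have := Nat.div_mul_le_self n τ
    nlinarith
  exact_mod_cast h1

lemma lt_div_add_one_mul {n τ : ℕ} (hτ : 1 ≤ τ) : n + 1 ≤ (n / τ + 1) * τ := by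
  have := Nat.div_add_mod n τ
  have h2 := Nat.mod_lt n hτ
  nlinarith

/-- One dyadic layer of lags. -/
lemma exists_upper_layer_bound {q A : ℝ} (hq : 2 < q) (hA : 0 < A) : ∃ C : ℝ, 1 ≤ C ∧
    ∀ {E : Type u} [MeasurableSpace E] {law : Measure E} [IsProbabilityMeasure law] {p : ℕ}
      {f : Fin p × Fin p → ℕ → (ℤ → E) → ℝ} {δ δ₂ : Fin p × Fin p → ℕ → ℝ} {s : Fin p → ℝ}
      {N : ℝ} {U : ℕ → (ℤ → E) → ℝ≥0∞}, PairArray law p q A f δ δ₂ s N U →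
      ∀ (n k : ℕ) (ϖ y lam : ℝ), 1 ≤ p → 1 ≤ k → 2 * k ≤ n → 0 < ϖ → 0 < y → 0 < lam →
      p * ϖ * ∑ j, s j ^ q ≤ y ^ q → N ^ 2 * (n * Real.log p) ≤ y ^ 2 →
      iidLaw law ℤ {x | ∃ e, ∃ m ≤ n + 1, C * lam * y < |∑ i ∈ Finset.range m,
          (lagAvg law (2 * k) i (f e i) x - lagAvg law k i (f e i) x)|}
        ≤ ENNReal.ofReal (C * (p ^ 2 * Real.exp (-(4 * (lam ^ 2 * (k : ℝ) ^ (2 * A) * Real.log p)))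
          + n / ϖ * (k : ℝ) ^ (q / 2 - 1 - A * q) * lam ^ (-q))) := by
  obtain ⟨C, hC1, hC⟩ := exists_layer_bound.{u} hq
  -- Serves two purposes: `C ≤ B` absorbs the constant of the polynomial term, and `8 C ≤ B ^ 2`
  -- produces the factor `4` in the Gaussian exponent.
  set B : ℝ := 8 * C with hB
  have hq0 : 0 < q := by linarith
  have hB8 : 8 ≤ B := by linarith
  set K : ℝ := 37 * B + C + C * (2 ^ q * (2 * 2 ^ q)) * 2 with hK
  have hK0 : 0 ≤ C * (2 ^ q * (2 * 2 ^ q)) * 2 := by positivity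
  refine ⟨K, by linarith, ?_⟩
  intro E _ law _ p f δ δ₂ s N U hf n k ϖ y lam hp hk hkn hϖ hy hlam hyq hy2
  set μ := iidLaw law ℤ
  set τ := 2 * k with hτ
  set R := n / τ + 1 with hR
  have hk1 : (1:ℝ) ≤ k := by exact_mod_cast hk
  have hk0 : (0:ℝ) < k := by linarith
  have hp1 : (1:ℝ) ≤ p := by exact_mod_cast hp
  have hlogp : 0 ≤ Real.log p := Real.log_nonneg hp1
  have hn1 : (2:ℝ) ≤ n := by
    have : ((2 * k : ℕ) : ℝ) ≤ n := by exact_mod_cast hkn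
    push_cast at this; linarith
  have hRτ : (R : ℝ) * τ ≤ 2 * n := div_add_one_mul_le hkn
  have hτR : n + 1 ≤ R * τ := lt_div_add_one_mul (by omega)
  set G : ℝ := ∑ j, s j ^ q with hG
  have hG0 : 0 < G := by
    have : Nonempty (Fin p) := ⟨⟨0, hp⟩⟩
    exact Finset.sum_pos (fun j _ => by have := hf.s_pos j; positivity) Finset.univ_nonempty
  set g : Fin p × Fin p → ℕ → (ℤ → E) → ℝ := fun e i x =>
    lagAvg law τ i (f e i) x - lagAvg law k i (f e i) x with hg
  set Y := B * lam * y with hY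
  have hY0 : 0 < Y := by positivity
  set ex : ℝ := Real.exp (-(4 * (lam ^ 2 * (k : ℝ) ^ (2 * A) * Real.log p))) with hex
  set β : Fin p × Fin p → ℝ := fun e =>
    2 ^ q * (n * (k : ℝ) ^ (q / 2 - 1 - A * q) * lam ^ (-q)) * ((s e.1 + s e.2) ^ q / y ^ q) with hβ
  have hβ0 : ∀ e, 0 ≤ β e := fun e => by
    have := hf.s_pos e.1
    have := hf.s_pos e.2
    positivity
  have hone : ∀ e, μ {x | ∃ m ≤ n + 1, 37 * Y < |∑ i ∈ Finset.range m, g e i x|}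
      ≤ ENNReal.ofReal (C * (ex + 2 * β e)) := by
    intro e
    have hs1 := hf.s_pos e.1
    have hs2 := hf.s_pos e.2
    have hN := hf.N_pos
    obtain ⟨h1, h2⟩ := hC (hf.dependsOn e) (hf.lagBound e) (hf.lagBound₂ e) k τ R (by omega)
      (by omega) (Nat.le_add_left 1 _) ((s e.1 + s e.2) * ((k : ℝ) + 1) ^ (-A)) (N * ((k : ℝ) + 1) ^ (-A))
      (by positivity) (by positivity) (hf.sum_le e _ _) (hf.sum_le₂ e _ _) Y hY0
    have hbase : R * (C * Real.sqrt τ * ((s e.1 + s e.2) * ((k : ℝ) + 1) ^ (-A)) / Y) ^ q ≤ β e := by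
      rcases poly_term_le (A := A) (C := C) (B := B) (n := n) (k := k) (τ := τ) (R := R)
        (a := s e.1 + s e.2) (lam := lam) (y := y) hq (by linarith) (by linarith) (by linarith)
        hk1 (by rw [hτ]; push_cast; linarith) (by rw [hτ]; push_cast; linarith) hRτ (by positivity)
        (by positivity) hlam hy with h | h
      · exact h
      · linarith
    have hb0 : 0 ≤ R * (C * Real.sqrt τ * ((s e.1 + s e.2) * ((k : ℝ) + 1) ^ (-A)) / Y) ^ q := by
      positivity
    have hexp : Real.exp (-(Y ^ 2 / (C * (R * τ * (N * ((k : ℝ) + 1) ^ (-A)) ^ 2)))) ≤ ex := by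
      refine Real.exp_le_exp.2 (neg_le_neg ?_)
      rw [le_div_iff₀ (by positivity)]
      have hkA : ((k : ℝ) + 1) ^ (-A) ≤ (k : ℝ) ^ (-A) :=
        Real.rpow_le_rpow_of_nonpos hk0 (by linarith) (by linarith)
      have hkk : (k : ℝ) ^ (2 * A) * ((k : ℝ) ^ (-A)) ^ 2 = 1 := by
        rw [← Real.rpow_natCast, ← Real.rpow_mul hk0.le, ← Real.rpow_add hk0]
        norm_num
        rw [show 2 * A + -(A * 2) = 0 by ring, Real.rpow_zero]
      calc 4 * (lam ^ 2 * (k : ℝ) ^ (2 * A) * Real.log p)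
            * (C * (R * τ * (N * ((k : ℝ) + 1) ^ (-A)) ^ 2))
          ≤ 4 * (lam ^ 2 * (k : ℝ) ^ (2 * A) * Real.log p)
            * (C * (2 * n * (N * (k : ℝ) ^ (-A)) ^ 2)) := by gcongr
        _ = 8 * C * lam ^ 2 * (N ^ 2 * (n * Real.log p)) *
            ((k : ℝ) ^ (2 * A) * ((k : ℝ) ^ (-A)) ^ 2) := by ring
        _ ≤ 8 * C * lam ^ 2 * y ^ 2 := by rw [hkk, mul_one]; gcongr
        _ ≤ Y ^ 2 := by
            rw [hY, mul_pow, mul_pow]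
            have : 8 * C ≤ B ^ 2 := by nlinarith
            gcongr
    have hsub : {x | ∃ m ≤ n + 1, 37 * Y < |∑ i ∈ Finset.range m, g e i x|}
        ⊆ {x | ∃ r ≤ R, ∃ m ≤ τ, Y < |∑ i ∈ Finset.range m, g e (r * τ + i) x|} ∪
          {x | (∀ r ≤ R, ∀ m ≤ τ, |∑ i ∈ Finset.range m, g e (r * τ + i) x| ≤ Y) ∧
            ∃ m ≤ R * τ, 37 * Y < |∑ i ∈ Finset.range m, g e i x|} := by
      rintro x ⟨m, hm, hx⟩
      by_cases hbig : ∃ r ≤ R, ∃ m ≤ τ, Y < |∑ i ∈ Finset.range m, g e (r * τ + i) x|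
      · exact Or.inl hbig
      · push Not at hbig
        exact Or.inr ⟨hbig, m, hm.trans hτR, hx⟩
    -- If `β e ≥ 1` there is nothing to prove; if `β e < 1`, the cubed polynomial term is dominated
    -- by its first power.
    rcases le_or_gt 1 (β e) with hβ1 | hβ1
    · refine prob_le_one.trans ?_
      rw [← ENNReal.ofReal_one]
      refine ENNReal.ofReal_le_ofReal ?_
      have : 0 < ex := Real.exp_pos _
      nlinarith
    · refine (measure_mono hsub).trans ((measure_union_le _ _).trans ((add_le_add h1 h2).trans ?_))
      rw [← ENNReal.ofReal_add (by positivity) (by positivity)]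
      refine ENNReal.ofReal_le_ofReal ?_
      rw [← mul_add]
      have hcube : (R * (C * Real.sqrt τ * ((s e.1 + s e.2) * ((k : ℝ) + 1) ^ (-A)) / Y) ^ q) ^ (3:ℝ)
          ≤ β e := by
        calc _ ≤ (β e) ^ (3:ℝ) := by gcongr
          _ ≤ (β e) ^ (1:ℝ) := Real.rpow_le_rpow_of_exponent_ge' (hβ0 e) hβ1.le (by norm_num)
              (by norm_num)
          _ = β e := Real.rpow_one _
      exact mul_le_mul_of_nonneg_left (by linarith) (by linarith)
  have hcov : {x | ∃ e, ∃ m ≤ n + 1, K * lam * y < |∑ i ∈ Finset.range m, g e i x|}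
      ⊆ ⋃ e ∈ (Finset.univ : Finset (Fin p × Fin p)),
        {x | ∃ m ≤ n + 1, 37 * Y < |∑ i ∈ Finset.range m, g e i x|} := by
    rintro x ⟨e, m, hm, hx⟩
    simp only [Finset.mem_univ, Set.iUnion_true, Set.mem_iUnion]
    refine ⟨e, m, hm, lt_of_le_of_lt ?_ hx⟩
    rw [hY, ← mul_assoc, ← mul_assoc]
    gcongr
    linarith
  refine (measure_mono hcov).trans ((measure_biUnion_finset_le _ _).trans
    ((Finset.sum_le_sum fun e _ => hone e).trans ?_))
  rw [← ENNReal.ofReal_sum_of_nonneg fun e _ => by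
    have := hβ0 e
    positivity]
  refine ENNReal.ofReal_le_ofReal ?_
  rw [← Finset.mul_sum, Finset.sum_add_distrib, ← Finset.mul_sum]
  have hsumβ : ∑ e, β e ≤ 2 ^ q * (2 * 2 ^ q) *
      (n / ϖ * (k : ℝ) ^ (q / 2 - 1 - A * q) * lam ^ (-q)) := by
    rw [hβ, ← Finset.mul_sum, ← Finset.sum_div]
    calc 2 ^ q * (n * (k : ℝ) ^ (q / 2 - 1 - A * q) * lam ^ (-q)) *
          ((∑ e : Fin p × Fin p, (s e.1 + s e.2) ^ q) / y ^ q)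
        ≤ 2 ^ q * (n * (k : ℝ) ^ (q / 2 - 1 - A * q) * lam ^ (-q)) *
          ((2 * 2 ^ q * (p * G)) / (p * ϖ * G)) := by
          gcongr
          exact sum_pair_rpow_le hf.s_pos hq0.le
      _ = _ := by field_simp
  have hcard : ∑ e : Fin p × Fin p, ex = p ^ 2 * ex := by
    simp [Finset.sum_const, Fintype.card_prod, sq]
  rw [hcard]
  have p1 : 0 ≤ (p:ℝ) ^ 2 * ex := by positivity
  have p2 : 0 ≤ n / ϖ * (k : ℝ) ^ (q / 2 - 1 - A * q) * lam ^ (-q) := by positivity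
  calc C * (p ^ 2 * ex + 2 * ∑ e, β e) ≤ C * (p ^ 2 * ex + 2 * (2 ^ q * (2 * 2 ^ q) *
      (n / ϖ * (k : ℝ) ^ (q / 2 - 1 - A * q) * lam ^ (-q)))) := by gcongr
    _ = C * (p ^ 2 * ex) + C * (2 ^ q * (2 * 2 ^ q)) * 2 *
      (n / ϖ * (k : ℝ) ^ (q / 2 - 1 - A * q) * lam ^ (-q)) := by ring
    _ ≤ K * (p ^ 2 * ex) + K * (n / ϖ * (k : ℝ) ^ (q / 2 - 1 - A * q) * lam ^ (-q)) := by
        gcongr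
        · linarith
        · linarith
    _ = _ := by ring

end Concentration

section Deviation

open Measure

universe u

/-- A bound on all coordinates at once for averages over old innovations. -/
lemma PairArray.measure_lagAvg_gt_le {E : Type u} [MeasurableSpace E] {law : Measure E}
    [IsProbabilityMeasure law] {p : ℕ} {q A : ℝ} {f : Fin p × Fin p → ℕ → (ℤ → E) → ℝ}
    {δ δ₂ : Fin p × Fin p → ℕ → ℝ} {s : Fin p → ℝ} {N : ℝ} {U : ℕ → (ℤ → E) → ℝ≥0∞}
    (hf : PairArray law p q A f δ δ₂ s N U) (hq : 1 ≤ q) (k i : ℕ) {z : ℝ} (hz : 0 < z) :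
    iidLaw law ℤ {x | ∃ e, z < |lagAvg law k i (f e i) x|}
      ≤ ENNReal.ofReal ((∑ j, s j ^ q) / z ^ q) := by
  set S : Set ℤ := Set.Ici ((i : ℤ) - k + 1)
  -- `U` dominates the `q`-th powers for all pairs simultaneously, and by Jensen its average
  -- dominates those of the lag averages. A single use of Markov's inequality replaces the union
  -- over pairs.
  set V : (ℤ → E) → ℝ≥0∞ := fun x => ∫⁻ y, U i (splice S x y) ∂(iidLaw law ℤ) with hV
  have hUm : Measurable fun w : (ℤ → E) × (ℤ → E) => U i (splice S w.1 w.2) :=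
    (hf.measurable_U i).comp (measurable_splice S)
  have hVm : Measurable V := hUm.lintegral_prod_right'
  have hVint : ∫⁻ x, V x ∂(iidLaw law ℤ) = ∫⁻ x, U i x ∂(iidLaw law ℤ) := by
    rw [hV, ← lintegral_prod _ hUm.aemeasurable]
    exact (measurePreserving_splice law S).lintegral_comp (hf.measurable_U i)
  have hle : ∀ e x, ‖lagAvg law k i (f e i) x‖ₑ ^ q ≤ V x := by
    intro e x
    have hm : Measurable fun y => f e i (splice S x y) :=
      ((hf.lagBound e).measurable i).comp ((measurable_splice S).comp measurable_prodMk_left)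
    exact (lintegral_rpow_le hm.aestronglyMeasurable hq).trans
      (lintegral_mono fun y => hf.le_U e i _)
  have hsub : {x | ∃ e, z < |lagAvg law k i (f e i) x|} ⊆ {x | ENNReal.ofReal (z ^ q) ≤ V x} := by
    rintro x ⟨e, he⟩
    refine le_trans ?_ (hle e x)
    rw [Real.enorm_eq_ofReal_abs, ENNReal.ofReal_rpow_of_nonneg (abs_nonneg _) (by linarith)]
    exact ENNReal.ofReal_le_ofReal (Real.rpow_le_rpow hz.le he.le (by linarith))
  have hzq : 0 < z ^ q := by positivity
  refine (measure_mono hsub).trans ((meas_ge_le_lintegral_div hVm.aemeasurable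
    (by simpa using hzq) ENNReal.ofReal_ne_top).trans ?_)
  rw [hVint, ENNReal.ofReal_div_of_pos hzq]
  exact ENNReal.div_le_div_right (hf.lintegral_U i) _

/-- The short lags. -/
lemma exists_lower_layer_bound {q A : ℝ} (hq : 2 < q) : ∃ C : ℝ, 1 ≤ C ∧
    ∀ {E : Type u} [MeasurableSpace E] {law : Measure E} [IsProbabilityMeasure law] {p : ℕ}
      {f : Fin p × Fin p → ℕ → (ℤ → E) → ℝ} {δ δ₂ : Fin p × Fin p → ℕ → ℝ} {s : Fin p → ℝ}
      {N : ℝ} {U : ℕ → (ℤ → E) → ℝ≥0∞}, PairArray law p q A f δ δ₂ s N U →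
      ∀ (n L : ℕ) (ϖ y : ℝ), 1 ≤ p → 1 ≤ L → L ≤ n → (n : ℝ) ≤ ϖ → 0 < y →
      p * ϖ * ∑ j, s j ^ q ≤ y ^ q → N ^ 2 * (n * Real.log p) ≤ y ^ 2 →
      iidLaw law ℤ {x | ∃ e, ∃ m ≤ n + 1, C * y < |∑ i ∈ Finset.range m,
          (lagAvg law L i (f e i) x - lagAvg law 0 i (f e i) x)|}
        ≤ ENNReal.ofReal (C * ((L : ℝ) ^ q / p + p ^ 2 * Real.exp (-(4 * Real.log p))
          + p ^ 2 * ((L : ℝ) ^ q / p) ^ (3 : ℝ))) := by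
  obtain ⟨C, hC1, hC⟩ := exists_layer_bound.{u} hq
  set B : ℝ := 8 * C with hB
  have hq0 : 0 < q := by linarith
  set c₀ : ℝ := 2 * 2 * 2 ^ q with hc₀
  have hc₀0 : 0 < c₀ := by positivity
  set K : ℝ := 37 * B + C + C * c₀ ^ (3 : ℝ) + 6 * 2 ^ q with hK
  have hK1 : 0 ≤ C * c₀ ^ (3 : ℝ) := by positivity
  have hK2 : (0:ℝ) ≤ 6 * 2 ^ q := by positivity
  refine ⟨K, by linarith, ?_⟩
  intro E _ law _ p f δ δ₂ s N U hf n L ϖ y hp hL hLn hϖ hy hyq hy2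
  set μ := iidLaw law ℤ
  set R := n / L + 1 with hR
  have hL1 : (1:ℝ) ≤ L := by exact_mod_cast hL
  have hp1 : (1:ℝ) ≤ p := by exact_mod_cast hp
  have hn1 : (1:ℝ) ≤ n := by exact_mod_cast hL.trans hLn
  have hϖ0 : 0 < ϖ := by linarith
  have hlogp : 0 ≤ Real.log p := Real.log_nonneg hp1
  have hRL : (R : ℝ) * L ≤ 2 * n := div_add_one_mul_le hLn
  have hLR : n + 1 ≤ R * L := lt_div_add_one_mul hL
  set G : ℝ := ∑ j, s j ^ q with hG
  have hGs : ∀ j, s j ^ q ≤ G := fun j =>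
    Finset.single_le_sum (f := fun j => s j ^ q) (fun j _ => by have := hf.s_pos j; positivity)
      (Finset.mem_univ j)
  have hG0 : 0 ≤ G := Finset.sum_nonneg fun j _ => by have := hf.s_pos j; positivity
  have hGy : G / y ^ q ≤ 1 / (p * ϖ) := by
    rw [div_le_div_iff₀ (by positivity) (by positivity)]; linarith
  have hnG : n * (G / y ^ q) ≤ 1 / p := by
    calc n * (G / y ^ q) ≤ ϖ * (1 / (p * ϖ)) := by gcongr
      _ = 1 / p := by field_simp
  set g : Fin p × Fin p → ℕ → (ℤ → E) → ℝ := fun e i x =>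
    lagAvg law L i (f e i) x - lagAvg law 0 i (f e i) x with hg
  set Y := B * y with hY
  have hB1 : 8 ≤ B := by linarith
  have hY0 : 0 < Y := by positivity
  set ex : ℝ := Real.exp (-(4 * Real.log p)) with hex
  have hone : ∀ e, μ {x | (∀ r ≤ R, ∀ m ≤ L, |∑ i ∈ Finset.range m, g e (r * L + i) x| ≤ Y) ∧
            ∃ m ≤ R * L, 37 * Y < |∑ i ∈ Finset.range m, g e i x|}
      ≤ ENNReal.ofReal (C * (ex + c₀ ^ (3 : ℝ) * ((L : ℝ) ^ q / p) ^ (3 : ℝ))) := by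
    intro e
    have hs1 := hf.s_pos e.1
    have hs2 := hf.s_pos e.2
    have hN := hf.N_pos
    obtain ⟨-, h2⟩ := hC (hf.dependsOn e) (hf.lagBound e) (hf.lagBound₂ e) 0 L R (by omega)
      (by omega) (Nat.le_add_left 1 _) (s e.1 + s e.2) N
      (by positivity) (by positivity) (by simpa using hf.sum_le e 0 L)
      (by simpa using hf.sum_le₂ e 0 L) Y hY0
    refine h2.trans (ENNReal.ofReal_le_ofReal ?_)
    have hexp : Real.exp (-(Y ^ 2 / (C * (R * L * N ^ 2)))) ≤ ex := by
      refine Real.exp_le_exp.2 (neg_le_neg ?_)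
      rw [le_div_iff₀ (by positivity)]
      calc 4 * Real.log p * (C * (R * L * N ^ 2))
          ≤ 4 * Real.log p * (C * (2 * n * N ^ 2)) := by gcongr
        _ = 8 * C * (N ^ 2 * (n * Real.log p)) := by ring
        _ ≤ 8 * C * y ^ 2 := by gcongr
        _ ≤ Y ^ 2 := by
            rw [hY, mul_pow]
            have : 8 * C ≤ B ^ 2 := by nlinarith
            gcongr
    have hbase : R * (C * Real.sqrt L * (s e.1 + s e.2) / Y) ^ q ≤ c₀ * ((L : ℝ) ^ q / p) := by
      have e1 : C * Real.sqrt L * (s e.1 + s e.2) / Y ≤ Real.sqrt L * ((s e.1 + s e.2) / y) := by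
        rw [div_le_iff₀ hY0]
        calc C * Real.sqrt L * (s e.1 + s e.2) ≤ B * Real.sqrt L * (s e.1 + s e.2) := by
              gcongr; linarith
          _ = _ := by rw [hY]; field_simp
      have e2 : Real.sqrt L ^ q = L * (L : ℝ) ^ (q / 2 - 1) := by
        rw [Real.sqrt_eq_rpow, ← Real.rpow_mul (by positivity), Real.rpow_sub_one (by positivity)]
        field_simp
      have e3 : (s e.1 + s e.2) ^ q ≤ 2 * 2 ^ q * G := by
        refine (add_rpow_le_two_rpow_mul hs1.le hs2.le hq0.le).trans ?_
        have := hGs e.1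
        have := hGs e.2
        calc (2:ℝ) ^ q * (s e.1 ^ q + s e.2 ^ q) ≤ 2 ^ q * (G + G) := by gcongr
          _ = _ := by ring
      have e4 : (L : ℝ) ^ (q / 2 - 1) ≤ (L : ℝ) ^ q :=
        Real.rpow_le_rpow_of_exponent_le hL1 (by linarith)
      calc R * (C * Real.sqrt L * (s e.1 + s e.2) / Y) ^ q
          ≤ R * (Real.sqrt L * ((s e.1 + s e.2) / y)) ^ q := by
            have : 0 ≤ C * Real.sqrt L * (s e.1 + s e.2) / Y := by positivity
            exact mul_le_mul_of_nonneg_left (Real.rpow_le_rpow this e1 hq0.le) (by positivity)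
        _ = (R * L) * (L : ℝ) ^ (q / 2 - 1) * ((s e.1 + s e.2) ^ q / y ^ q) := by
            rw [Real.mul_rpow (by positivity) (by positivity), e2,
              Real.div_rpow (by positivity) hy.le]
            ring
        _ ≤ (2 * n) * (L : ℝ) ^ q * (2 * 2 ^ q * G / y ^ q) := by gcongr
        _ = c₀ * ((L : ℝ) ^ q * (n * (G / y ^ q))) := by rw [hc₀]; ring
        _ ≤ c₀ * ((L : ℝ) ^ q * (1 / p)) := by gcongr
        _ = _ := by ring
    have hcube : (R * (C * Real.sqrt L * (s e.1 + s e.2) / Y) ^ q) ^ (3:ℝ)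
        ≤ c₀ ^ (3 : ℝ) * ((L : ℝ) ^ q / p) ^ (3 : ℝ) := by
      rw [← Real.mul_rpow hc₀0.le (by positivity)]
      exact Real.rpow_le_rpow (by positivity) hbase (by norm_num)
    exact mul_le_mul_of_nonneg_left (add_le_add hexp hcube) (by linarith)
  -- A partial block has at most `L` terms, each at most `2z` when both lag averages are at most
  -- `z`. This crude bound loses `L ^ q`, but it holds for all pairs at once and gains a factor
  -- `1/p` over the sum of the first bounds of `exists_layer_bound`, which would stay of order one
  -- here.
  set z : ℝ := Y / (2 * L) with hz
  have hz0 : 0 < z := by positivity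
  have hbig : ∀ (k i : ℕ), μ {x | ∃ e, z < |lagAvg law k i (f e i) x|}
      ≤ ENNReal.ofReal (G / z ^ q) := fun k i => hf.measure_lagAvg_gt_le (by linarith) k i hz0
  set T := (R + 1) * L with hT
  have hcov : {x | ∃ e, ∃ m ≤ n + 1, K * y < |∑ i ∈ Finset.range m, g e i x|}
      ⊆ (⋃ i ∈ Finset.range T, ({x | ∃ e, z < |lagAvg law L i (f e i) x|} ∪
          {x | ∃ e, z < |lagAvg law 0 i (f e i) x|})) ∪
        ⋃ e ∈ (Finset.univ : Finset (Fin p × Fin p)),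
        {x | (∀ r ≤ R, ∀ m ≤ L, |∑ i ∈ Finset.range m, g e (r * L + i) x| ≤ Y) ∧
            ∃ m ≤ R * L, 37 * Y < |∑ i ∈ Finset.range m, g e i x|} := by
    rintro x ⟨e, m, hm, hx⟩
    by_cases hsm : ∀ i < T, ∀ e, |lagAvg law L i (f e i) x| ≤ z ∧ |lagAvg law 0 i (f e i) x| ≤ z
    · right
      simp only [Finset.mem_univ, Set.iUnion_true, Set.mem_iUnion]
      refine ⟨e, fun r hr m hm => ?_, m, hm.trans hLR, lt_of_le_of_lt ?_ hx⟩
      · have hi : ∀ i ∈ Finset.range m, |g e (r * L + i) x| ≤ 2 * z := by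
          intro i hi
          have hi' : r * L + i < T := by
            have h1 := Finset.mem_range.1 hi
            have h2 : r * L ≤ R * L := Nat.mul_le_mul_right _ hr
            rw [hT, add_mul]; omega
          obtain ⟨a1, a2⟩ := hsm _ hi' e
          calc |g e (r * L + i) x| ≤ _ := abs_sub _ _
            _ ≤ 2 * z := by linarith
        calc |∑ i ∈ Finset.range m, g e (r * L + i) x| ≤ ∑ i ∈ Finset.range m, 2 * z :=
              (Finset.abs_sum_le_sum_abs _ _).trans (Finset.sum_le_sum hi)
          _ = m * (2 * z) := by simp
          _ ≤ L * (2 * z) := by gcongr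
          _ = Y := by rw [hz]; field_simp
      · rw [hY, ← mul_assoc]
        gcongr
        linarith
    · left
      push Not at hsm
      obtain ⟨i, hi, e, he⟩ := hsm
      simp only [Set.mem_iUnion]
      refine ⟨i, Finset.mem_range.2 hi, ?_⟩
      by_cases h1 : |lagAvg law L i (f e i) x| ≤ z
      · exact Or.inr ⟨e, he h1⟩
      · exact Or.inl ⟨e, not_le.1 h1⟩
  have hTn : (T : ℝ) ≤ 3 * n := by
    have : (L : ℝ) ≤ n := by exact_mod_cast hLn
    rw [hT]; push_cast; nlinarith
  have hGz : T * (G / z ^ q + G / z ^ q) ≤ 6 * 2 ^ q * ((L : ℝ) ^ q / p) := by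
    have h1 : y / (2 * L) ≤ z := by
      rw [hz, hY]; gcongr; nlinarith
    have h2 : (y / (2 * L)) ^ q ≤ z ^ q := by gcongr
    have h3 : G / z ^ q ≤ G / (y / (2 * L)) ^ q := by gcongr
    calc T * (G / z ^ q + G / z ^ q) ≤ (3 * n) * (G / (y / (2 * L)) ^ q + G / (y / (2 * L)) ^ q) := by
          gcongr
      _ = 6 * 2 ^ q * ((L : ℝ) ^ q * (n * (G / y ^ q))) := by
          rw [Real.div_rpow hy.le (by positivity), Real.mul_rpow (by norm_num) (by positivity)]
          field_simp
          ring
      _ ≤ 6 * 2 ^ q * ((L : ℝ) ^ q * (1 / p)) := by gcongr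
      _ = _ := by ring
  have hGz0 : 0 ≤ G / z ^ q := by positivity
  refine (measure_mono hcov).trans ((measure_union_le _ _).trans ?_)
  refine (add_le_add ((measure_biUnion_finset_le _ _).trans (Finset.sum_le_sum fun i _ =>
    (measure_union_le _ _).trans (add_le_add (hbig L i) (hbig 0 i))))
    ((measure_biUnion_finset_le _ _).trans (Finset.sum_le_sum fun e _ => hone e))).trans ?_
  rw [Finset.sum_const, Finset.sum_const, Finset.card_range, Finset.card_univ, Fintype.card_prod,
    Fintype.card_fin, ← ENNReal.ofReal_add hGz0 hGz0, ← ENNReal.ofReal_nsmul,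
    ← ENNReal.ofReal_nsmul, ← ENNReal.ofReal_add (by positivity) (by positivity)]
  refine ENNReal.ofReal_le_ofReal ?_
  rw [nsmul_eq_mul, nsmul_eq_mul]
  push_cast
  have p1 : 0 ≤ (L : ℝ) ^ q / p := by positivity
  have p2 : 0 ≤ (p:ℝ) ^ 2 * ex := by positivity
  have p3 : 0 ≤ (p:ℝ) ^ 2 * ((L : ℝ) ^ q / p) ^ (3 : ℝ) := by positivity
  calc T * (G / z ^ q + G / z ^ q) + p * p * (C * (ex + c₀ ^ (3:ℝ) * ((L : ℝ) ^ q / p) ^ (3:ℝ)))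
      ≤ 6 * 2 ^ q * ((L : ℝ) ^ q / p)
        + p * p * (C * (ex + c₀ ^ (3:ℝ) * ((L : ℝ) ^ q / p) ^ (3:ℝ))) := by linarith
    _ = 6 * 2 ^ q * ((L : ℝ) ^ q / p) + C * (p ^ 2 * ex)
        + (C * c₀ ^ (3:ℝ)) * (p ^ 2 * ((L : ℝ) ^ q / p) ^ (3:ℝ)) := by ring
    _ ≤ K * ((L : ℝ) ^ q / p) + K * (p ^ 2 * ex) + K * (p ^ 2 * ((L : ℝ) ^ q / p) ^ (3:ℝ)) := by
        refine add_le_add (add_le_add ?_ ?_) ?_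
        · exact mul_le_mul_of_nonneg_right (by linarith) p1
        · exact mul_le_mul_of_nonneg_right (by linarith) p2
        · exact mul_le_mul_of_nonneg_right (by linarith) p3
    _ = _ := by ring

/-- The long lags. -/
lemma exists_remainder_bound {q A : ℝ} (hq : 2 < q) (hA : 0 < A) : ∃ C : ℝ, 1 ≤ C ∧
    ∀ {E : Type u} [MeasurableSpace E] {law : Measure E} [IsProbabilityMeasure law] {p : ℕ}
      {f : Fin p × Fin p → ℕ → (ℤ → E) → ℝ} {δ δ₂ : Fin p × Fin p → ℕ → ℝ} {s : Fin p → ℝ}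
      {N : ℝ} {U : ℕ → (ℤ → E) → ℝ≥0∞}, PairArray law p q A f δ δ₂ s N U →
      ∀ (n W : ℕ) (ϖ y : ℝ), 1 ≤ p → 1 ≤ W → W ≤ n → 0 < ϖ → 0 < y →
      p * ϖ * ∑ j, s j ^ q ≤ y ^ q →
      iidLaw law ℤ {x | ∃ e, ∃ r ≤ n / W + 1, ∃ m ≤ W, C * y < |∑ i ∈ Finset.range m,
          (f e (r * W + i) x - lagAvg law W (r * W + i) (f e (r * W + i)) x)|}
        ≤ ENNReal.ofReal (C * (n / ϖ * (W : ℝ) ^ (q / 2 - 1 - A * q))) := by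
  obtain ⟨C₁, hC₁1, hC₁⟩ := exists_measure_max_sum_le.{u} hq
  obtain ⟨C₂, hC₂1, hC₂⟩ := exists_eLpNorm_sum_sub_lagAvg_le.{u} (a := q) hq.le
  set C : ℝ := C₁ * C₂
  have hC1 : 1 ≤ C := by nlinarith
  have hq0 : 0 < q := by linarith
  set K : ℝ := C + 2 ^ q * (2 * 2 ^ q) * 2 with hK
  have hK0 : (0:ℝ) ≤ 2 ^ q * (2 * 2 ^ q) * 2 := by positivity
  refine ⟨K, by linarith, ?_⟩
  intro E _ law _ p f δ δ₂ s N U hf n W ϖ y hp hW hWn hϖ hy hyq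
  set μ := iidLaw law ℤ
  set R := n / W + 1 with hR
  have hW1 : (1:ℝ) ≤ W := by exact_mod_cast hW
  have hW0 : (0:ℝ) < W := by linarith
  have hp1 : (1:ℝ) ≤ p := by exact_mod_cast hp
  have hWn' : (W : ℝ) ≤ n := by exact_mod_cast hWn
  have hRW : (R : ℝ) * W ≤ 2 * n := div_add_one_mul_le hWn
  set G : ℝ := ∑ j, s j ^ q with hG
  have hG0 : 0 < G := by
    have : Nonempty (Fin p) := ⟨⟨0, hp⟩⟩
    exact Finset.sum_pos (fun j _ => by have := hf.s_pos j; positivity) Finset.univ_nonempty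
  set g : Fin p × Fin p → ℕ → (ℤ → E) → ℝ := fun e i x =>
    f e i x - lagAvg law W i (f e i) x with hg
  have hK1 : 0 < K := by linarith
  have hone : ∀ e : Fin p × Fin p, ∀ r, μ {x | ∃ m ≤ W, K * y < |∑ i ∈ Finset.range m, g e (r * W + i) x|}
      ≤ ENNReal.ofReal ((C * Real.sqrt W * ((s e.1 + s e.2) * ((W : ℝ) + 1) ^ (-A)) / (K * 1 * y)) ^ q) := by
    intro e r
    have hs1 := hf.s_pos e.1
    have hs2 := hf.s_pos e.2
    set T := (s e.1 + s e.2) * ((W : ℝ) + 1) ^ (-A) with hT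
    have hT0 : 0 ≤ T := by positivity
    have := hC₁ μ (g e) (C₂ * T) W (r * W) hW (by positivity)
      (fun i => ((hf.lagBound e).measurable i).sub
        (measurable_lagAvg ((hf.lagBound e).measurable i) _ _))
      (fun s' n' => by
        have := hC₂ (hf.lagBound e).measurable (hf.lagBound e).memLp (hf.lagBound e).nonneg
          (hf.lagBound e).increment W s' n' T (hf.sum_le e W)
        rwa [mul_right_comm] at this) (K * y) (by positivity)
    refine this.trans (le_of_eq ?_)
    congr 2
    simp only [C]
    ring
  set β : Fin p × Fin p → ℝ := fun e =>
    2 ^ q * ((2 * n) * (W : ℝ) ^ (q / 2 - 1 - A * q) * 1 ^ (-q)) * ((s e.1 + s e.2) ^ q / y ^ q) with hβ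
  have htwo : ∀ e : Fin p × Fin p, μ (⋃ r ∈ Finset.range (R + 1), {x | ∃ m ≤ W, K * y < |∑ i ∈ Finset.range m, g e (r * W + i) x|})
      ≤ ENNReal.ofReal (β e) := by
    intro e
    have hs1 := hf.s_pos e.1
    have hs2 := hf.s_pos e.2
    refine (measure_biUnion_finset_le _ _).trans ((Finset.sum_le_sum fun r _ => hone e r).trans ?_)
    rw [Finset.sum_const, Finset.card_range, ← ENNReal.ofReal_nsmul, nsmul_eq_mul]
    refine ENNReal.ofReal_le_ofReal ?_
    -- The `R + 1` blocks have total length at most `3n`, hence the use of `2n` in place of `n`.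
    rcases poly_term_le (A := A) (C := C) (B := K) (n := 2 * n) (k := W) (τ := W)
        (R := ((R + 1 : ℕ) : ℝ)) (a := s e.1 + s e.2) (lam := 1) (y := y) hq (by linarith)
        (by linarith) (by linarith) hW1 le_rfl (by linarith) (by push_cast; linarith)
        (by positivity) (by positivity) one_pos hy with h | h
    · exact h
    · linarith
  have hcov : {x | ∃ e, ∃ r ≤ R, ∃ m ≤ W, K * y < |∑ i ∈ Finset.range m, g e (r * W + i) x|}
      ⊆ ⋃ e ∈ (Finset.univ : Finset (Fin p × Fin p)), ⋃ r ∈ Finset.range (R + 1),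
        {x | ∃ m ≤ W, K * y < |∑ i ∈ Finset.range m, g e (r * W + i) x|} := by
    rintro x ⟨e, r, hr, m, hm, hx⟩
    simp only [Finset.mem_univ, Set.iUnion_true, Set.mem_iUnion]
    exact ⟨e, r, Finset.mem_range.2 (by omega), m, hm, hx⟩
  refine (measure_mono hcov).trans ((measure_biUnion_finset_le _ _).trans
    ((Finset.sum_le_sum fun e _ => htwo e).trans ?_))
  rw [← ENNReal.ofReal_sum_of_nonneg fun e _ => by
    have := hf.s_pos e.1
    have := hf.s_pos e.2
    positivity]
  refine ENNReal.ofReal_le_ofReal ?_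
  rw [hβ, ← Finset.mul_sum, ← Finset.sum_div]
  have p2 : 0 ≤ n / ϖ * (W : ℝ) ^ (q / 2 - 1 - A * q) := by positivity
  calc 2 ^ q * ((2 * n) * (W : ℝ) ^ (q / 2 - 1 - A * q) * 1 ^ (-q)) *
        ((∑ e : Fin p × Fin p, (s e.1 + s e.2) ^ q) / y ^ q)
      ≤ 2 ^ q * ((2 * n) * (W : ℝ) ^ (q / 2 - 1 - A * q) * 1 ^ (-q)) *
        ((2 * 2 ^ q * (p * G)) / (p * ϖ * G)) := by
        gcongr
        exact sum_pair_rpow_le hf.s_pos hq0.le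
    _ = 2 ^ q * (2 * 2 ^ q) * 2 * (n / ϖ * (W : ℝ) ^ (q / 2 - 1 - A * q)) := by
        rw [Real.one_rpow]; field_simp
    _ ≤ _ := mul_le_mul_of_nonneg_right (by linarith) p2

end Deviation

/-! ### Assembling the layers of lags -/

section Combine

open Measure

universe u

/-- The difference of two partial sums consists of at most `(b - a)/W + 1` full blocks and two
incomplete ones. For intervals of length comparable to `W` this is a bounded number, so no
cancellation between blocks is needed. -/
lemma abs_sum_Ico_le_of_blocks {g : ℕ → ℝ} {W R : ℕ} (hW : 1 ≤ W) {z : ℝ}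
    (hblk : ∀ r ≤ R, ∀ m ≤ W, |∑ i ∈ Finset.range m, g (r * W + i)| ≤ z) {a b : ℕ} (hab : a ≤ b)
    (hb : b ≤ R * W) : |∑ i ∈ Finset.Ico a b, g i| ≤ (3 + ((b : ℝ) - a) / W) * z := by
  have hz : 0 ≤ z := by simpa using hblk 0 (Nat.zero_le _) 0 (Nat.zero_le _)
  have hW0 : (0:ℝ) < W := by exact_mod_cast hW
  have hbR : b / W ≤ R := Nat.div_le_of_le_mul (by rwa [mul_comm])
  have habW : a / W ≤ b / W := Nat.div_le_div_right hab
  rw [Finset.sum_Ico_eq_sub _ hab, sum_range_mul_add g W b, sum_range_mul_add g W a]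
  have h1 := hblk (b / W) hbR (b % W) (Nat.mod_lt _ hW).le
  have h2 := hblk (a / W) (habW.trans hbR) (a % W) (Nat.mod_lt _ hW).le
  have h3 : |∑ r ∈ Finset.Ico (a / W) (b / W), ∑ i ∈ Finset.range W, g (r * W + i)|
      ≤ (((b / W : ℕ) : ℝ) - ((a / W : ℕ) : ℝ)) * z := by
    refine (Finset.abs_sum_le_sum_abs _ _).trans ((Finset.sum_le_sum fun r hr =>
      hblk r (((Finset.mem_Ico.1 hr).2.le).trans hbR) W le_rfl).trans (le_of_eq ?_))
    rw [Finset.sum_const, Nat.card_Ico, nsmul_eq_mul, Nat.cast_sub habW]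
  rw [Finset.sum_Ico_eq_sub _ habW] at h3
  have h4 : ((b / W : ℕ) : ℝ) ≤ (b : ℝ) / W := Nat.cast_div_le
  have h5 : (a : ℝ) / W ≤ ((a / W : ℕ) : ℝ) + 1 := by
    rw [div_le_iff₀ hW0]
    have := lt_div_add_one_mul (n := a) hW
    have h6 : ((a + 1 : ℕ) : ℝ) ≤ (((a / W + 1) * W : ℕ) : ℝ) := by exact_mod_cast this
    push_cast at h6
    linarith
  have h7 : ((b / W : ℕ) : ℝ) - ((a / W : ℕ) : ℝ) ≤ ((b : ℝ) - a) / W + 1 := by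
    rw [sub_div]; linarith
  have h8 := mul_le_mul_of_nonneg_right h7 hz
  rw [abs_le] at *
  constructor <;> nlinarith [h1.1, h1.2, h2.1, h2.2, h3.1, h3.2]

/-- Uniform deviation bound for sums over intervals. -/
lemma exists_measure_sum_Ico_deviation_le {q A : ℝ} (hq : 2 < q) (hA : 0 < A) : ∃ C : ℝ, 1 ≤ C ∧
    ∀ {E : Type u} [MeasurableSpace E] {law : Measure E} [IsProbabilityMeasure law] {p : ℕ}
      {f : Fin p × Fin p → ℕ → (ℤ → E) → ℝ} {δ δ₂ : Fin p × Fin p → ℕ → ℝ} {s : Fin p → ℝ}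
      {N : ℝ} {U : ℕ → (ℤ → E) → ℝ≥0∞}, PairArray law p q A f δ δ₂ s N U →
      ∀ (n L h : ℕ) (ϖ y Λ : ℝ) (lam : ℕ → ℝ), 1 ≤ p → 1 ≤ L → 2 ^ h * L ≤ n → (n : ℝ) ≤ ϖ →
      0 < y → (∀ l, 0 < lam l) → ∑ l ∈ Finset.range h, lam l ≤ Λ →
      p * ϖ * ∑ j, s j ^ q ≤ y ^ q → N ^ 2 * (n * Real.log p) ≤ y ^ 2 →
      iidLaw law ℤ {x | ∃ e, ∃ a b : ℕ, a ≤ b ∧ b ≤ n + 1 ∧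
          C * (1 + Λ + ((b : ℝ) - a) / (2 ^ h * L)) * y < |∑ i ∈ Finset.Ico a b,
          (f e i x - ∫ z, f e i z ∂(iidLaw law ℤ))|}
        ≤ ENNReal.ofReal (C * ((L : ℝ) ^ q / p + p ^ 2 * Real.exp (-(4 * Real.log p))
          + p ^ 2 * ((L : ℝ) ^ q / p) ^ (3 : ℝ)
          + ∑ l ∈ Finset.range h,
            (p ^ 2 * Real.exp (-(4 * (lam l ^ 2 * (2 ^ l * L : ℝ) ^ (2 * A) * Real.log p)))
              + n / ϖ * (2 ^ l * L : ℝ) ^ (q / 2 - 1 - A * q) * lam l ^ (-q))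
          + n / ϖ * (2 ^ h * L : ℝ) ^ (q / 2 - 1 - A * q))) := by
  obtain ⟨C₁, hC₁1, hC₁⟩ := exists_lower_layer_bound.{u} (A := A) hq
  obtain ⟨C₂, hC₂1, hC₂⟩ := exists_upper_layer_bound.{u} hq hA
  obtain ⟨C₃, hC₃1, hC₃⟩ := exists_remainder_bound.{u} hq hA
  set C : ℝ := 2 * C₁ + 2 * C₂ + 3 * C₃ with hC
  refine ⟨C, by linarith, ?_⟩
  intro E _ law _ p f δ δ₂ s N U hf n L h ϖ y Λ lam hp hL hLn hϖ hy hlam hΛ hyq hy2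
  set μ := iidLaw law ℤ
  set W := 2 ^ h * L with hW
  have h2 : ∀ l, 1 ≤ 2 ^ l := fun l => Nat.one_le_two_pow
  have hWL : L ≤ W := Nat.le_mul_of_pos_left _ (h2 h)
  have hn1 : (1:ℝ) ≤ n := by exact_mod_cast hL.trans (hWL.trans hLn)
  have hϖ0 : 0 < ϖ := by linarith
  have hp1 : (1:ℝ) ≤ p := by exact_mod_cast hp
  have hW1 : 1 ≤ W := hL.trans hWL
  have hWr : ((W : ℕ) : ℝ) = 2 ^ h * L := by rw [hW]; push_cast; ring
  set S₁ : Set (ℤ → E) := {x | ∃ e, ∃ m ≤ n + 1, C₁ * y < |∑ i ∈ Finset.range m,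
          (lagAvg law L i (f e i) x - lagAvg law 0 i (f e i) x)|} with hS₁
  set S₂ : ℕ → Set (ℤ → E) := fun l => {x | ∃ e, ∃ m ≤ n + 1,
        C₂ * lam l * y < |∑ i ∈ Finset.range m, (lagAvg law (2 * (2 ^ l * L)) i (f e i) x
          - lagAvg law (2 ^ l * L) i (f e i) x)|} with hS₂
  set S₃ : Set (ℤ → E) := {x | ∃ e, ∃ r ≤ n / W + 1, ∃ m ≤ W, C₃ * y < |∑ i ∈ Finset.range m,
          (f e (r * W + i) x - lagAvg law W (r * W + i) (f e (r * W + i)) x)|} with hS₃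
  have hb₁ := hC₁ hf n L ϖ y hp hL (hWL.trans hLn) hϖ hy hyq hy2
  have hb₂ : ∀ l ∈ Finset.range h, μ (S₂ l) ≤ ENNReal.ofReal (C₂ *
      (p ^ 2 * Real.exp (-(4 * (lam l ^ 2 * (2 ^ l * L : ℝ) ^ (2 * A) * Real.log p)))
              + n / ϖ * (2 ^ l * L : ℝ) ^ (q / 2 - 1 - A * q) * lam l ^ (-q))) := by
    intro l hl
    have hlh : 2 * (2 ^ l * L) ≤ n := by
      have h1 : 2 ^ (l + 1) ≤ 2 ^ h := Nat.pow_le_pow_right (by norm_num)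
        (by have := Finset.mem_range.1 hl; omega)
      calc 2 * (2 ^ l * L) = 2 ^ (l + 1) * L := by ring
        _ ≤ 2 ^ h * L := Nat.mul_le_mul_right _ h1
        _ ≤ n := hLn
    have := hC₂ hf n (2 ^ l * L) ϖ y (lam l) hp (Nat.one_le_iff_ne_zero.2 (by positivity)) hlh hϖ0 hy
      (hlam l) hyq hy2
    push_cast at this
    exact this
  have hb₃ := hC₃ hf n W ϖ y hp hW1 hLn hϖ0 hy hyq
  rw [hWr] at hb₃
  have hcov : {x | ∃ e, ∃ a b : ℕ, a ≤ b ∧ b ≤ n + 1 ∧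
          C * (1 + Λ + ((b : ℝ) - a) / (2 ^ h * L)) * y < |∑ i ∈ Finset.Ico a b,
          (f e i x - ∫ z, f e i z ∂(iidLaw law ℤ))|} ⊆ S₁ ∪ (⋃ l ∈ Finset.range h, S₂ l) ∪ S₃ := by
    intro x hx
    by_contra hne
    simp only [Set.mem_union, not_or] at hne
    obtain ⟨⟨n₁, n₂⟩, n₃⟩ := hne
    simp only [Set.mem_iUnion, not_exists] at n₂
    obtain ⟨e, a, b, hab, hbn, hx⟩ := hx
    simp only [hS₁, hS₃, Set.mem_ofPred_eq] at n₁ n₃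
    push Not at n₁ n₃
    have n₂' : ∀ l ∈ Finset.range h, ∀ m ≤ n + 1, |∑ i ∈ Finset.range m,
        (lagAvg law (2 * (2 ^ l * L)) i (f e i) x - lagAvg law (2 ^ l * L) i (f e i) x)|
        ≤ C₂ * lam l * y := by
      intro l hl m hm
      have := n₂ l hl
      simp only [hS₂, Set.mem_ofPred_eq] at this
      push Not at this
      exact this e m hm
    have hint : ∀ (g : ℕ → ℝ) (X : ℝ), (∀ m ≤ n + 1, |∑ i ∈ Finset.range m, g i| ≤ X) →
        |∑ i ∈ Finset.Ico a b, g i| ≤ 2 * X := by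
      intro g X hg
      rw [Finset.sum_Ico_eq_sub _ hab]
      refine (abs_sub _ _).trans ?_
      linarith [hg a (hab.trans hbn), hg b hbn]
    have i1 := hint _ _ (n₁ e)
    have i2 : ∀ l ∈ Finset.range h, |∑ i ∈ Finset.Ico a b,
        (lagAvg law (2 * (2 ^ l * L)) i (f e i) x - lagAvg law (2 ^ l * L) i (f e i) x)|
        ≤ 2 * (C₂ * lam l * y) := fun l hl => hint _ _ (n₂' l hl)
    have i3 := abs_sum_Ico_le_of_blocks (g := fun i => f e i x - lagAvg law W i (f e i) x) hW1
      (fun r hr m hm => n₃ e r hr m hm) hab (hbn.trans (lt_div_add_one_mul hW1))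
    -- Telescoping over retained lags `0, L, 2L, …, 2 ^ h L = W` and then all of them; zero lags
    -- give the mean.
    have hdec : ∑ i ∈ Finset.Ico a b, (f e i x - ∫ z, f e i z ∂(iidLaw law ℤ))
        = ∑ i ∈ Finset.Ico a b, (lagAvg law L i (f e i) x - lagAvg law 0 i (f e i) x)
          + ∑ l ∈ Finset.range h, ∑ i ∈ Finset.Ico a b,
            (lagAvg law (2 * (2 ^ l * L)) i (f e i) x - lagAvg law (2 ^ l * L) i (f e i) x)
          + ∑ i ∈ Finset.Ico a b, (f e i x - lagAvg law W i (f e i) x) := by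
      rw [Finset.sum_comm, ← Finset.sum_add_distrib, ← Finset.sum_add_distrib]
      refine Finset.sum_congr rfl fun i _ => ?_
      have ht := Finset.sum_range_sub (fun l => lagAvg law (2 ^ l * L) i (f e i) x) h
      have e2 : ∀ l, 2 ^ (l + 1) * L = 2 * (2 ^ l * L) := fun l => by ring
      simp only [e2, pow_zero, one_mul] at ht
      rw [ht, lagAvg_zero (hf.dependsOn e i), ← hW]
      ring
    have i2s : |∑ l ∈ Finset.range h, ∑ i ∈ Finset.Ico a b,
            (lagAvg law (2 * (2 ^ l * L)) i (f e i) x - lagAvg law (2 ^ l * L) i (f e i) x)|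
        ≤ 2 * C₂ * Λ * y := by
      refine (Finset.abs_sum_le_sum_abs _ _).trans ((Finset.sum_le_sum i2).trans ?_)
      calc ∑ l ∈ Finset.range h, 2 * (C₂ * lam l * y) = 2 * C₂ * y * ∑ l ∈ Finset.range h, lam l := by
            rw [Finset.mul_sum]; exact Finset.sum_congr rfl fun l _ => by ring
        _ ≤ 2 * C₂ * y * Λ := by gcongr
        _ = _ := by ring
    have hΛ0 : 0 ≤ Λ := (Finset.sum_nonneg fun l _ => (hlam l).le).trans hΛ
    rw [hWr] at i3
    rw [hdec] at hx
    set X := ((b : ℝ) - a) / (2 ^ h * L) with hX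
    have hX0 : 0 ≤ X := by
      have : (a : ℝ) ≤ b := by exact_mod_cast hab
      have h2 : 0 ≤ (b : ℝ) - a := by linarith
      positivity
    have hfin : 2 * (C₁ * y) + 2 * C₂ * Λ * y + (3 + X) * (C₃ * y) ≤ C * (1 + Λ + X) * y := by
      have : 2 * C₁ + 2 * C₂ * Λ + (3 + X) * C₃ ≤ C * (1 + Λ + X) := by
        rw [hC]
        have q1 := mul_nonneg (by linarith : 0 ≤ C₁) hX0
        have q2 := mul_nonneg (by linarith : 0 ≤ C₂) hX0
        have q3 := mul_nonneg (by linarith : 0 ≤ C₃) hX0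
        have q4 := mul_nonneg (by linarith : 0 ≤ C₁) hΛ0
        have q5 := mul_nonneg (by linarith : 0 ≤ C₃) hΛ0
        nlinarith
      nlinarith
    exact absurd (lt_of_lt_of_le hx (((abs_add_le _ _).trans
      (add_le_add (abs_add_le _ _) le_rfl)).trans
      (add_le_add (add_le_add i1 i2s) i3))) (not_lt.2 hfin)
  set T₁ : ℝ := (L : ℝ) ^ q / p + p ^ 2 * Real.exp (-(4 * Real.log p))
          + p ^ 2 * ((L : ℝ) ^ q / p) ^ (3 : ℝ) with hT₁
  set T₂ : ℕ → ℝ := fun l =>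
    p ^ 2 * Real.exp (-(4 * (lam l ^ 2 * (2 ^ l * L : ℝ) ^ (2 * A) * Real.log p)))
              + n / ϖ * (2 ^ l * L : ℝ) ^ (q / 2 - 1 - A * q) * lam l ^ (-q) with hT₂
  set T₃ : ℝ := n / ϖ * (2 ^ h * L : ℝ) ^ (q / 2 - 1 - A * q) with hT₃
  have hT₁0 : 0 ≤ T₁ := by positivity
  have hT₂0 : ∀ l, 0 ≤ T₂ l := fun l => by have := hlam l; positivity
  have hT₃0 : 0 ≤ T₃ := by positivity
  have hs0 : 0 ≤ ∑ l ∈ Finset.range h, T₂ l := Finset.sum_nonneg fun l _ => hT₂0 l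
  have hmono : ∀ {c t : ℝ}, c ≤ C → 0 ≤ t → ENNReal.ofReal (c * t) ≤ ENNReal.ofReal (C * t) :=
    fun hc ht => ENNReal.ofReal_le_ofReal (mul_le_mul_of_nonneg_right hc ht)
  refine (measure_mono hcov).trans ((measure_union_le _ _).trans
    ((add_le_add ((measure_union_le _ _).trans (add_le_add (hb₁.trans
      (hmono (by linarith) hT₁0)) ((measure_biUnion_finset_le _ _).trans
        (Finset.sum_le_sum fun l hl => (hb₂ l hl).trans (hmono (by linarith) (hT₂0 l))))))
      (hb₃.trans (hmono (by linarith) hT₃0))).trans (le_of_eq ?_)))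
  have hC0 : 0 ≤ C := by linarith
  rw [← ENNReal.ofReal_sum_of_nonneg fun l _ => mul_nonneg hC0 (hT₂0 l),
    ← ENNReal.ofReal_add (by positivity) (Finset.sum_nonneg fun l _ => mul_nonneg hC0 (hT₂0 l)),
    ← Finset.mul_sum, ← ENNReal.ofReal_add (by positivity) (by positivity), ← mul_add, ← mul_add]

end Combine

/-! ### The causal model on the space of two-sided innovations -/

section Model

open Measure

/-- Distinct coordinates of an i.i.d. family are i.i.d.; applied to `m ↦ i - m`, it identifies the
law of the past at every time `i`. -/
lemma measurePreserving_comp_injective {E ι κ : Type*} [MeasurableSpace E] (law : Measure E)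
    [IsProbabilityMeasure law] {e : κ → ι} (he : Function.Injective e) :
    MeasurePreserving (fun x : ι → E => fun k => x (e k)) (iidLaw law ι) (iidLaw law κ) := by
  classical
  have hm : Measurable (fun x : ι → E => fun k => x (e k)) :=
    measurable_pi_lambda _ fun k => measurable_pi_apply _
  refine ⟨hm, eq_infinitePi _ fun s t ht => ?_⟩
  rcases isEmpty_or_nonempty κ with hκ | hκ
  · have : s = ∅ := Finset.eq_empty_of_isEmpty s
    subst this
    rw [map_apply hm (.pi (Finset.countable_toSet _) fun i _ => ht i)]
    simp
  · have hinv : ∀ k, Function.invFun e (e k) = k := Function.leftInverse_invFun he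
    have hbox : MeasurableSet (Set.pi (s : Set κ) t) := .pi s.countable_toSet fun i _ => ht i
    rw [map_apply hm hbox]
    have heq : (fun x : ι → E => fun k => x (e k)) ⁻¹' (Set.pi (s : Set κ) t)
        = Set.pi ((s.image e : Finset ι) : Set ι) (fun i => t (Function.invFun e i)) := by
      ext x
      simp only [Set.mem_preimage, Set.mem_pi, Finset.mem_coe, Finset.coe_image, Set.mem_image]
      constructor
      · rintro h _ ⟨k, hk, rfl⟩
        rw [hinv]; exact h k hk
      · intro h k hk
        have := h (e k) ⟨k, hk, rfl⟩
        rwa [hinv] at this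
    rw [heq, infinitePi_pi _ fun i _ => ht _, Finset.prod_image fun _ _ _ _ h => he h]
    simp only [hinv]

namespace CausalModel

variable {p : ℕ} (M : CausalModel p)

instance : IsProbabilityMeasure M.pastLaw := by unfold pastLaw; infer_instance

instance : IsProbabilityMeasure M.coupledLaw := by unfold coupledLaw; infer_instance

lemma measurable_H_apply (t : ℝ) (j : Fin p) : Measurable fun s => M.H s t j :=
  (measurable_pi_apply j).comp (M.measurable_H.comp measurable_prodMk_right)

/-- The past of a two-sided sequence at time `i`. -/
def past (i : ℤ) (x : ℤ → Fin p → ℝ) : ℕ → Fin p → ℝ := fun m => x (i - m)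

lemma measurePreserving_past (i : ℤ) :
    MeasurePreserving (past i) (iidLaw M.law ℤ) M.pastLaw :=
  measurePreserving_comp_injective M.law (e := fun m : ℕ => i - (m : ℤ))
    fun a b h => by simpa using h

lemma past_update (i : ℤ) (m : ℕ) (x : ℤ → Fin p → ℝ) (z : Fin p → ℝ) :
    past i (Function.update x (i - m) z) = Function.update (past i x) m z := by
  ext k
  unfold past
  by_cases h : k = m
  · subst h; simp
  · rw [Function.update_of_ne h, Function.update_of_ne]
    intro h'
    exact h (by exact_mod_cast sub_right_injective h')

/-- The process with observation times `τ i` on the canonical space of innovations. -/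
def proc (τ : ℕ → ℝ) (i : ℕ) (j : Fin p) (x : ℤ → Fin p → ℝ) : ℝ := M.H (past i x) (τ i) j

variable {M}
variable {τ : ℕ → ℝ}

lemma measurable_proc (i : ℕ) (j : Fin p) : Measurable (M.proc τ i j) :=
  (M.measurable_H_apply _ j).comp (M.measurePreserving_past i).measurable

lemma dependsOn_proc (i : ℕ) (j : Fin p) : DependsOn (M.proc τ i j) (Set.Iic (i : ℤ)) := by
  intro x y h
  have e : past (i : ℤ) x = past (i : ℤ) y := by
    ext1 m
    exact h _ (by simp)
  rw [proc, proc, e]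

lemma eLpNorm_proc (i : ℕ) (j : Fin p) (a : ℝ≥0∞) :
    eLpNorm (M.proc τ i j) a (iidLaw M.law ℤ) = eLpNorm (fun s => M.H s (τ i) j) a M.pastLaw := by
  rw [← (M.measurePreserving_past i).map_eq, eLpNorm_map_measure
    (M.measurable_H_apply _ j).aestronglyMeasurable
    (M.measurePreserving_past i).measurable.aemeasurable]
  rfl

lemma integral_proc (i : ℕ) (j : Fin p) :
    ∫ x, M.proc τ i j x ∂(iidLaw M.law ℤ) = ∫ s, M.H s (τ i) j ∂M.pastLaw := by
  rw [← (M.measurePreserving_past i).map_eq, integral_map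
    (M.measurePreserving_past i).measurable.aemeasurable
    (M.measurable_H_apply _ j).aestronglyMeasurable]
  rfl

lemma integral_proc_mul (i : ℕ) (j k : Fin p) :
    ∫ x, M.proc τ i j x * M.proc τ i k x ∂(iidLaw M.law ℤ) = M.cov (τ i) j k := by
  unfold cov
  rw [Matrix.of_apply, ← (M.measurePreserving_past i).map_eq, integral_map
    (f := fun s => M.H s (τ i) j * M.H s (τ i) k)
    (M.measurePreserving_past i).measurable.aemeasurable
    ((M.measurable_H_apply _ j).mul (M.measurable_H_apply _ k)).aestronglyMeasurable]
  rfl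

lemma eLpNorm_proc_sub_update_le (hτ : ∀ i, τ i ∈ Set.Icc (0 : ℝ) 1) (a : ℝ) (i m : ℕ)
    (j : Fin p) :
    eLpNorm (fun z : (ℤ → Fin p → ℝ) × (Fin p → ℝ) =>
        M.proc τ i j z.1 - M.proc τ i j (Function.update z.1 ((i : ℤ) - m) z.2))
      (ENNReal.ofReal a) ((iidLaw M.law ℤ).prod M.law) ≤ M.theta m a j := by
  have hmp : MeasurePreserving (Prod.map (past (i : ℤ)) id)
      ((iidLaw M.law ℤ).prod M.law) M.coupledLaw :=
    (M.measurePreserving_past i).prod (MeasurePreserving.id _)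
  have hm : Measurable fun z : (ℕ → Fin p → ℝ) × (Fin p → ℝ) =>
      M.H z.1 (τ i) j - M.H (Function.update z.1 m z.2) (τ i) j :=
    ((M.measurable_H_apply _ j).comp measurable_fst).sub
      ((M.measurable_H_apply _ j).comp (measurable_update_pair m))
  have := eLpNorm_comp_measurePreserving (p := ENNReal.ofReal a) hm.aestronglyMeasurable hmp
  refine le_trans (le_of_eq ?_) (le_iSup₂ (f := fun t (_ : t ∈ Set.Icc (0:ℝ) 1) =>
    eLpNorm (fun z : (ℕ → Fin p → ℝ) × (Fin p → ℝ) =>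
      M.H z.1 t j - M.H (Function.update z.1 m z.2) t j) (ENNReal.ofReal a) M.coupledLaw)
      (τ i) (hτ i))
  rw [← this]
  congr 1
  ext z
  simp only [proc, Function.comp, Prod.map, past_update, id]

lemma theta_mono {a a' : ℝ} (haa : a ≤ a') (m : ℕ) (j : Fin p) :
    M.theta m a j ≤ M.theta m a' j := by
  refine iSup₂_mono fun t _ => ?_
  have hm : Measurable fun z : (ℕ → Fin p → ℝ) × (Fin p → ℝ) =>
      M.H z.1 t j - M.H (Function.update z.1 m z.2) t j :=
    ((M.measurable_H_apply _ j).comp measurable_fst).sub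
      ((M.measurable_H_apply _ j).comp (measurable_update_pair m))
  exact eLpNorm_le_eLpNorm_of_exponent_le (ENNReal.ofReal_le_ofReal haa) hm.aestronglyMeasurable

lemma dan_mono {a a' A : ℝ} (haa : a ≤ a') (j : Fin p) : M.dan a A j ≤ M.dan a' A j :=
  iSup_mono fun _ => mul_le_mul_right (ENNReal.tsum_le_tsum fun _ => theta_mono haa _ j) _

lemma sum_theta_le {a A : ℝ} (j : Fin p) (k k' : ℕ) :
    ∑ m ∈ Finset.Ico k k', M.theta m a j
      ≤ ENNReal.ofReal (((k : ℝ) + 1) ^ (-A)) * M.dan a A j := by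
  have hk : (0:ℝ) < (k : ℝ) + 1 := by positivity
  have h1 : ∑ m ∈ Finset.Ico k k', M.theta m a j ≤ M.bigTheta k a j := by
    rw [Finset.sum_Ico_eq_sum_range]
    exact ENNReal.sum_le_tsum _
  have h2 : ENNReal.ofReal (((k : ℝ) + 1) ^ A) * M.bigTheta k a j ≤ M.dan a A j :=
    le_iSup (fun m : ℕ => ENNReal.ofReal (((m : ℝ) + 1) ^ A) * M.bigTheta m a j) k
  refine h1.trans ?_
  calc M.bigTheta k a j = ENNReal.ofReal (((k : ℝ) + 1) ^ (-A)) *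
        (ENNReal.ofReal (((k : ℝ) + 1) ^ A) * M.bigTheta k a j) := by
        rw [← mul_assoc, ← ENNReal.ofReal_mul (by positivity), ← Real.rpow_add hk]
        simp
    _ ≤ _ := by gcongr

lemma theta_ne_top {a A : ℝ} {j : Fin p} (h : M.dan a A j < ⊤) (m : ℕ) : M.theta m a j ≠ ⊤ := by
  have := sum_theta_le (M := M) (a := a) (A := A) j m (m + 1)
  simp only [Nat.Ico_succ_singleton, Finset.sum_singleton] at this
  exact (this.trans_lt (ENNReal.mul_lt_top ENNReal.ofReal_lt_top h)).ne

lemma sum_toReal_theta_le {a A : ℝ} {j : Fin p} (h : M.dan a A j < ⊤) (k k' : ℕ) :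
    ∑ m ∈ Finset.Ico k k', (M.theta m a j).toReal
      ≤ (M.dan a A j).toReal * ((k : ℝ) + 1) ^ (-A) := by
  rw [← ENNReal.toReal_sum fun m _ => theta_ne_top h m]
  have := ENNReal.toReal_mono (ENNReal.mul_lt_top ENNReal.ofReal_lt_top h).ne
    (sum_theta_le (M := M) (a := a) (A := A) j k k')
  rwa [ENNReal.toReal_mul, ENNReal.toReal_ofReal (by positivity), mul_comm] at this

/-- A moment bound through the dependence adjusted norm. -/
lemma exists_eLpNorm_le_dan {a : ℝ} (ha : 2 ≤ a) : ∃ C : ℝ, 1 ≤ C ∧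
    ∀ {p : ℕ} {M : CausalModel p} {A t : ℝ} {j : Fin p}, t ∈ Set.Icc (0 : ℝ) 1 →
      M.dan a A j < ⊤ → MemLp (fun s => M.H s t j) (ENNReal.ofReal a) M.pastLaw →
      ∫ s, M.H s t j ∂M.pastLaw = 0 →
      eLpNorm (fun s => M.H s t j) (ENNReal.ofReal a) M.pastLaw
        ≤ ENNReal.ofReal (C * (M.dan a A j).toReal) := by
  obtain ⟨C, hC1, hC⟩ := exists_eLpNorm_sum_sub_lagAvg_le.{0} ha
  refine ⟨C, hC1, fun {p M A t j} ht hdan hmem hmean => ?_⟩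
  have hτ : ∀ i : ℕ, (fun _ : ℕ => t) i ∈ Set.Icc (0:ℝ) 1 := fun _ => ht
  -- The variable itself is a sum over one time of the contribution of all lags from `0` on, since
  -- it is centred. Hence `k = 0`, `s = 0`, `n = 1`.
  have key := hC (law := M.law) (f := fun i => M.proc (fun _ => t) i j)
    (δ := fun m => (M.theta m a j).toReal) (fun i => measurable_proc i j)
    (fun i => ⟨(measurable_proc i j).aestronglyMeasurable, by rw [eLpNorm_proc]; exact hmem.2⟩)
    (fun m => ENNReal.toReal_nonneg)
    (fun i m => by
      rw [ENNReal.ofReal_toReal (theta_ne_top hdan m)]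
      exact eLpNorm_proc_sub_update_le hτ a i m j)
    0 0 1 (M.dan a A j).toReal (fun k' => by simpa using sum_toReal_theta_le hdan 0 k')
  simp only [Finset.range_one, Finset.sum_singleton, add_zero, Nat.cast_one, Real.sqrt_one,
    mul_one] at key
  have e : (fun x => M.proc (fun _ => t) 0 j x - lagAvg M.law 0 0 (M.proc (fun _ => t) 0 j) x)
      = M.proc (fun _ => t) 0 j := by
    ext x
    rw [lagAvg_zero (dependsOn_proc 0 j), integral_proc, hmean, sub_zero]
  rw [e, eLpNorm_proc] at key
  exact key

end CausalModel

end Model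

/-! ### Products of coordinates -/

section Products

open Measure

lemma holderTriple_ofReal {a c : ℝ} (ha : 0 < a) (hc : c = 2 * a) :
    ENNReal.HolderTriple (ENNReal.ofReal c) (ENNReal.ofReal c) (ENNReal.ofReal a) := by
  refine ⟨?_⟩
  rw [← ENNReal.ofReal_inv_of_pos (by linarith), ← ENNReal.ofReal_inv_of_pos ha,
    ← ENNReal.ofReal_add (by rw [hc]; positivity) (by rw [hc]; positivity)]
  congr 1
  rw [hc]
  field_simp
  norm_num

lemma eLpNorm_mul_le {Ω : Type*} [MeasurableSpace Ω] {P : Measure Ω} {a c : ℝ} (ha : 0 < a)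
    (hc : c = 2 * a) {f g : Ω → ℝ} (hf : AEStronglyMeasurable f P) (hg : AEStronglyMeasurable g P) :
    eLpNorm (fun ω => f ω * g ω) (ENNReal.ofReal a) P
      ≤ eLpNorm f (ENNReal.ofReal c) P * eLpNorm g (ENNReal.ofReal c) P := by
  have := holderTriple_ofReal ha hc
  simpa using eLpNorm_le_eLpNorm_mul_eLpNorm_of_nnnorm (p := ENNReal.ofReal c)
    (q := ENNReal.ofReal c) (r := ENNReal.ofReal a) hf hg (fun x y : ℝ => x * y) 1
    (.of_forall fun _ => by simp)

namespace CausalModel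

variable {p : ℕ} {M : CausalModel p} {τ : ℕ → ℝ}

/-- Products of coordinates inherit the dependence bounds of the coordinates. -/
lemma lagBound_proc_mul {a c A κ : ℝ} (ha : 1 ≤ a) (hc : c = 2 * a) (hκ : 0 ≤ κ)
    (hτ : ∀ i, τ i ∈ Set.Icc (0 : ℝ) 1)
    (hmom : ∀ t ∈ Set.Icc (0 : ℝ) 1, ∀ j,
      eLpNorm (fun s => M.H s t j) (ENNReal.ofReal c) M.pastLaw ≤ ENNReal.ofReal κ)
    (hdan : ∀ j, M.dan c A j < ⊤) (j k : Fin p) :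
    LagBound M.law a (fun i x => M.proc τ i j x * M.proc τ i k x)
      (fun m => κ * ((M.theta m c j).toReal + (M.theta m c k).toReal)) where
  measurable i := (measurable_proc i j).mul (measurable_proc i k)
  memLp i := by
    refine ⟨((measurable_proc i j).mul (measurable_proc i k)).aestronglyMeasurable, ?_⟩
    refine (eLpNorm_mul_le (by linarith) hc (measurable_proc i j).aestronglyMeasurable
      (measurable_proc i k).aestronglyMeasurable).trans_lt ?_
    rw [eLpNorm_proc, eLpNorm_proc]
    exact ENNReal.mul_lt_top ((hmom _ (hτ i) j).trans_lt ENNReal.ofReal_lt_top)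
      ((hmom _ (hτ i) k).trans_lt ENNReal.ofReal_lt_top)
  nonneg m := by positivity
  increment i m := by
    set μ := (iidLaw M.law ℤ).prod M.law
    set upd : (ℤ → Fin p → ℝ) × (Fin p → ℝ) → (ℤ → Fin p → ℝ) := fun z =>
      Function.update z.1 ((i : ℤ) - m) z.2 with hupd
    have hupdm : Measurable upd := measurable_update_pair _
    have hX : ∀ j, Measurable fun z : (ℤ → Fin p → ℝ) × (Fin p → ℝ) => M.proc τ i j z.1 :=
      fun j => (measurable_proc i j).comp measurable_fst
    have hX' : ∀ j, Measurable fun z => M.proc τ i j (upd z) :=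
      fun j => (measurable_proc i j).comp hupdm
    have e : (fun z : (ℤ → Fin p → ℝ) × (Fin p → ℝ) => M.proc τ i j z.1 * M.proc τ i k z.1
        - M.proc τ i j (upd z) * M.proc τ i k (upd z))
        = (fun z => M.proc τ i j z.1 * (M.proc τ i k z.1 - M.proc τ i k (upd z)))
          + fun z => (M.proc τ i j z.1 - M.proc τ i j (upd z)) * M.proc τ i k (upd z) := by
      ext z; simp only [Pi.add_apply]; ring
    have n1 : eLpNorm (fun z : (ℤ → Fin p → ℝ) × (Fin p → ℝ) => M.proc τ i j z.1)
        (ENNReal.ofReal c) μ ≤ ENNReal.ofReal κ := by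
      refine le_trans (le_of_eq ?_) (hmom _ (hτ i) j)
      have hmp : MeasurePreserving (Prod.fst : (ℤ → Fin p → ℝ) × (Fin p → ℝ) → _) μ
        (iidLaw M.law ℤ) := measurePreserving_fst
      rw [← eLpNorm_proc, ← hmp.map_eq, eLpNorm_map_measure
        (measurable_proc i j).aestronglyMeasurable hmp.measurable.aemeasurable]
      rfl
    have n2 : eLpNorm (fun z => M.proc τ i k (upd z)) (ENNReal.ofReal c) μ ≤ ENNReal.ofReal κ := by
      refine le_trans (le_of_eq ?_) (hmom _ (hτ i) k)
      have hmp : MeasurePreserving upd μ (iidLaw M.law ℤ) := measurePreserving_update M.law _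
      rw [← eLpNorm_proc, ← hmp.map_eq, eLpNorm_map_measure
        (measurable_proc i k).aestronglyMeasurable hmp.measurable.aemeasurable]
      rfl
    have d := fun j => eLpNorm_proc_sub_update_le (M := M) hτ c i m j
    rw [e]
    refine (eLpNorm_add_le ((hX j).mul ((hX k).sub (hX' k))).aestronglyMeasurable
      (((hX j).sub (hX' j)).mul (hX' k)).aestronglyMeasurable
      (by simpa using ha)).trans ?_
    have b1 := (eLpNorm_mul_le (P := μ) (by linarith) hc (hX j).aestronglyMeasurable
      ((hX k).sub (hX' k)).aestronglyMeasurable).trans (mul_le_mul' n1 (d k))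
    have b2 := (eLpNorm_mul_le (P := μ) (by linarith) hc ((hX j).sub (hX' j)).aestronglyMeasurable
      (hX' k).aestronglyMeasurable).trans (mul_le_mul' (d j) n2)
    refine (add_le_add b1 b2).trans (le_of_eq ?_)
    rw [ENNReal.ofReal_mul hκ, ENNReal.ofReal_add ENNReal.toReal_nonneg ENNReal.toReal_nonneg,
      ENNReal.ofReal_toReal (theta_ne_top (hdan _) m),
      ENNReal.ofReal_toReal (theta_ne_top (hdan _) m), mul_add, add_comm, mul_comm (M.theta m c j)]

lemma DependenceCondition.eLpNorm_le {q A ν : ℝ} (h : M.DependenceCondition q A ν) (hq : 0 < q)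
    {t : ℝ} (ht : t ∈ Set.Icc (0 : ℝ) 1) (j : Fin p) :
    eLpNorm (fun s => M.H s t j) (ENNReal.ofReal (2 * q)) M.pastLaw
      ≤ ENNReal.ofReal (max ν 1 ^ (1 / (2 * q))) := by
  have h1 : ∫⁻ s, ‖M.H s t j‖ₑ ^ (2 * q) ∂M.pastLaw ≤ ENNReal.ofReal (max ν 1) := by
    refine le_trans ?_ (h.moment_le.trans (ENNReal.ofReal_le_ofReal (le_max_left _ _)))
    exact le_trans (le_iSup (fun j => ∫⁻ s, ‖M.H s t j‖ₑ ^ (2 * q) ∂M.pastLaw) j)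
      (le_iSup₂ (f := fun t (_ : t ∈ Set.Icc (0:ℝ) 1) =>
        ⨆ j, ∫⁻ s, ‖M.H s t j‖ₑ ^ (2 * q) ∂M.pastLaw) t ht)
  rw [eLpNorm_eq_lintegral_rpow_enorm_toReal (by simpa using hq) ENNReal.ofReal_ne_top,
    ENNReal.toReal_ofReal (by positivity), ← ENNReal.ofReal_rpow_of_nonneg (by positivity)
    (by positivity)]
  exact ENNReal.rpow_le_rpow h1 (by positivity)

lemma DependenceCondition.memLp {q A ν : ℝ} (h : M.DependenceCondition q A ν) (hq : 0 < q)
    {t : ℝ} (ht : t ∈ Set.Icc (0 : ℝ) 1) (j : Fin p) {a : ℝ} (ha : a ≤ 2 * q) :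
    MemLp (fun s => M.H s t j) (ENNReal.ofReal a) M.pastLaw :=
  MemLp.mono_exponent ⟨(M.measurable_H_apply t j).aestronglyMeasurable,
    (h.eLpNorm_le hq ht j).trans_lt ENNReal.ofReal_lt_top⟩ (ENNReal.ofReal_le_ofReal ha)

lemma DependenceCondition.eLpNorm_le' {q A ν : ℝ} (h : M.DependenceCondition q A ν) (hq : 0 < q)
    {t : ℝ} (ht : t ∈ Set.Icc (0 : ℝ) 1) (j : Fin p) {a : ℝ} (ha : a ≤ 2 * q) :
    eLpNorm (fun s => M.H s t j) (ENNReal.ofReal a) M.pastLaw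
      ≤ ENNReal.ofReal (max ν 1 ^ (1 / (2 * q))) :=
  (eLpNorm_le_eLpNorm_of_exponent_le (ENNReal.ofReal_le_ofReal ha)
    (M.measurable_H_apply t j).aestronglyMeasurable).trans (h.eLpNorm_le hq ht j)

/-- A vanishing dependence adjusted norm forces the coordinate to be almost surely zero at time `0`,
and `Σ(0)` would have a zero row. The positivity is required by `PairArray`. -/
lemma toReal_dan_pos {a A ν q : ℝ} (ha : 2 ≤ a) (haq : a ≤ 2 * q)
    (h : M.DependenceCondition q A ν) (hdet : IsUnit (M.cov 0).det) (j : Fin p) :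
    0 < (M.dan a A j).toReal := by
  have hq : 0 < q := by linarith
  obtain ⟨C, -, hC⟩ := exists_eLpNorm_le_dan ha
  by_contra hne
  have h0 : (M.dan a A j).toReal = 0 := le_antisymm (not_lt.1 hne) ENNReal.toReal_nonneg
  have ht : (0:ℝ) ∈ Set.Icc (0:ℝ) 1 := by simp
  have := hC ht ((dan_mono haq j).trans_lt (h.dan_lt_top j)) (h.memLp hq ht j haq)
    (h.mean_zero 0 ht j)
  rw [h0, mul_zero, ENNReal.ofReal_zero, nonpos_iff_eq_zero, eLpNorm_eq_zero_iff
    (M.measurable_H_apply 0 j).aestronglyMeasurable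
    (by simpa using (by linarith : 0 < a))] at this
  refine hdet.ne_zero (Matrix.det_eq_zero_of_row_eq_zero j fun k => ?_)
  rw [cov, Matrix.of_apply]
  rw [integral_congr_ae (g := fun _ => (0:ℝ)) (by
    filter_upwards [this] with s hs
    simp only [Pi.zero_apply] at hs
    rw [hs, zero_mul])]
  simp

lemma iSup_dan_lt_top {a A : ℝ} (h : ∀ j, M.dan a A j < ⊤) : ⨆ j, M.dan a A j < ⊤ :=
  lt_of_le_of_lt (iSup_le fun j => Finset.single_le_sum (f := fun j => M.dan a A j)
    (fun _ _ => zero_le) (Finset.mem_univ j)) (ENNReal.sum_lt_top.2 fun j _ => h j)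

lemma toReal_dan_le_NX {A : ℝ} (h : ∀ j, M.dan 4 A j < ⊤) (j : Fin p) :
    (M.dan 4 A j).toReal ≤ M.NX A :=
  ENNReal.toReal_mono (iSup_dan_lt_top h).ne (le_iSup (fun j => M.dan 4 A j) j)

/-- The array of products of coordinates. -/
lemma exists_pairArray {q : ℝ} (hq : 2 < q) (ν : ℝ) : ∃ C : ℝ, 1 ≤ C ∧
    ∀ {p : ℕ} {M : CausalModel p} {A : ℝ} {τ : ℕ → ℝ}, 1 ≤ p → M.DependenceCondition q A ν →
      IsUnit (M.cov 0).det → (∀ i, τ i ∈ Set.Icc (0 : ℝ) 1) → ∃ δ δ₂ U,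
      PairArray M.law p q A (fun e i x => M.proc τ i e.1 x * M.proc τ i e.2 x) δ δ₂
        (fun j => C * (M.dan (2 * q) A j).toReal) (C * M.NX A) U := by
  obtain ⟨C₀, hC₀1, hC₀⟩ := exists_eLpNorm_le_dan (a := 2 * q) (by linarith)
  have hq0 : 0 < q := by linarith
  set κ : ℝ := max ν 1 ^ (1 / (2 * q)) with hκ
  have hκ1 : 1 ≤ κ := Real.one_le_rpow (le_max_right _ _) (by positivity)
  set C : ℝ := 2 * C₀ * κ with hC
  have hκC : 2 * κ ≤ C := by rw [hC]; nlinarith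
  refine ⟨C, by linarith, fun {p M A τ} hp h hdet hτ => ?_⟩
  have hC0 : 0 < C := by linarith
  have hdan4 : ∀ j, M.dan 4 A j < ⊤ := fun j =>
    (dan_mono (by linarith) j).trans_lt (h.dan_lt_top j)
  refine ⟨fun e m => κ * ((M.theta m (2 * q) e.1).toReal + (M.theta m (2 * q) e.2).toReal),
    fun e m => κ * ((M.theta m 4 e.1).toReal + (M.theta m 4 e.2).toReal),
    fun i x => ∑ j, ‖M.proc τ i j x‖ₑ ^ (2 * q), ?_⟩
  refine
    { dependsOn := fun e i x y hxy => ?_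
      lagBound := fun e => lagBound_proc_mul (by linarith) rfl (by linarith) hτ
        (fun t ht j => h.eLpNorm_le hq0 ht j) h.dan_lt_top _ _
      lagBound₂ := fun e => lagBound_proc_mul (c := 4) (by norm_num) (by norm_num) (by linarith) hτ
        (fun t ht j => h.eLpNorm_le' hq0 ht j (by linarith)) hdan4 _ _
      s_pos := fun j => mul_pos hC0 (toReal_dan_pos (by linarith) le_rfl h hdet j)
      N_pos := mul_pos hC0 (lt_of_lt_of_le (toReal_dan_pos (by norm_num) (by linarith) h hdet
        ⟨0, hp⟩) (toReal_dan_le_NX hdan4 ⟨0, hp⟩))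
      sum_le := fun e k k' => ?_
      sum_le₂ := fun e k k' => ?_
      measurable_U := fun i => Finset.measurable_sum _ fun j _ =>
        (measurable_proc i j).enorm.pow_const _
      le_U := fun e i x => ?_
      lintegral_U := fun i => ?_ }
  · change M.proc τ i e.1 x * M.proc τ i e.2 x = M.proc τ i e.1 y * M.proc τ i e.2 y
    rw [dependsOn_proc i e.1 hxy, dependsOn_proc i e.2 hxy]
  · rw [← Finset.mul_sum, Finset.sum_add_distrib]
    have h1 := sum_toReal_theta_le (h.dan_lt_top e.1) k k'
    have h2 := sum_toReal_theta_le (h.dan_lt_top e.2) k k'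
    calc _ ≤ κ * ((M.dan (2 * q) A e.1).toReal * ((k : ℝ) + 1) ^ (-A)
          + (M.dan (2 * q) A e.2).toReal * ((k : ℝ) + 1) ^ (-A)) := by gcongr
      _ ≤ C * ((M.dan (2 * q) A e.1).toReal * ((k : ℝ) + 1) ^ (-A)
          + (M.dan (2 * q) A e.2).toReal * ((k : ℝ) + 1) ^ (-A)) := by gcongr; linarith
      _ = _ := by ring
  · rw [← Finset.mul_sum, Finset.sum_add_distrib]
    have h1 := sum_toReal_theta_le (hdan4 e.1) k k'
    have h2 := sum_toReal_theta_le (hdan4 e.2) k k'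
    have h3 := toReal_dan_le_NX hdan4 e.1
    have h4 := toReal_dan_le_NX hdan4 e.2
    have hNX : 0 ≤ M.NX A := ENNReal.toReal_nonneg
    calc _ ≤ κ * ((M.dan 4 A e.1).toReal * ((k : ℝ) + 1) ^ (-A)
          + (M.dan 4 A e.2).toReal * ((k : ℝ) + 1) ^ (-A)) := by gcongr
      _ ≤ κ * (M.NX A * ((k : ℝ) + 1) ^ (-A) + M.NX A * ((k : ℝ) + 1) ^ (-A)) := by gcongr
      _ = (2 * κ) * (M.NX A * ((k : ℝ) + 1) ^ (-A)) := by ring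
      _ ≤ C * (M.NX A * ((k : ℝ) + 1) ^ (-A)) := by gcongr
      _ = _ := by ring
  · have hle : ∀ j, ‖M.proc τ i j x‖ₑ ^ (2 * q) ≤ ∑ j, ‖M.proc τ i j x‖ₑ ^ (2 * q) := fun j =>
      Finset.single_le_sum (f := fun j => ‖M.proc τ i j x‖ₑ ^ (2 * q)) (fun _ _ => zero_le)
        (Finset.mem_univ j)
    rw [enorm_mul, ENNReal.mul_rpow_of_nonneg _ _ hq0.le]
    have hsq : ∀ a : ℝ≥0∞, a ^ (2 * q) = a ^ q * a ^ q := fun a => by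
      rw [← ENNReal.rpow_add_of_nonneg _ _ hq0.le hq0.le]; ring_nf
    rcases le_total ‖M.proc τ i e.1 x‖ₑ ‖M.proc τ i e.2 x‖ₑ with hh | hh
    · refine le_trans ?_ (hle e.2)
      rw [hsq]
      gcongr
    · refine le_trans ?_ (hle e.1)
      rw [hsq]
      gcongr
  · rw [lintegral_finsetSum _ fun j _ => (measurable_proc i j).enorm.pow_const _,
      ENNReal.ofReal_sum_of_nonneg fun j _ => by positivity]
    refine Finset.sum_le_sum fun j _ => ?_
    have e1 : ∫⁻ x, ‖M.proc τ i j x‖ₑ ^ (2 * q) ∂(iidLaw M.law ℤ)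
        = (eLpNorm (fun s => M.H s (τ i) j) (ENNReal.ofReal (2 * q)) M.pastLaw) ^ (2 * q) := by
      rw [← eLpNorm_proc, eLpNorm_eq_lintegral_rpow_enorm_toReal (by simpa using hq0)
        ENNReal.ofReal_ne_top, ENNReal.toReal_ofReal (by positivity), ← ENNReal.rpow_mul,
        one_div_mul_cancel (by positivity), ENNReal.rpow_one]
    -- Of the two factors in `‖X‖ * ‖X‖`, one is bounded by the moment constant and only the other
    -- by the dependence adjusted norm. The bound then scales as `s j ^ q`, not as `s j ^ (2q)`.
    have e2 := h.eLpNorm_le hq0 (hτ i) j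
    have e3 := hC₀ (hτ i) (h.dan_lt_top j) (h.memLp hq0 (hτ i) j le_rfl) (h.mean_zero _ (hτ i) j)
    rw [e1, mul_comm 2 q, ENNReal.rpow_mul, ← mul_comm 2 q]
    have e4 := ENNReal.rpow_le_rpow (mul_le_mul' e3 e2) hq0.le
    rw [← ENNReal.ofReal_mul (by positivity), ENNReal.ofReal_rpow_of_nonneg (by positivity)
      hq0.le] at e4
    have e5 : ∀ a : ℝ≥0∞, (a ^ q) ^ (2:ℝ) = (a * a) ^ q := fun a => by
      rw [← ENNReal.rpow_mul, mul_comm q 2, ENNReal.rpow_mul]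
      norm_num [sq]
    rw [e5]
    refine e4.trans (ENNReal.ofReal_le_ofReal (Real.rpow_le_rpow (by positivity) ?_ hq0.le))
    have : 0 ≤ (M.dan (2 * q) A j).toReal := ENNReal.toReal_nonneg
    have h6 : 0 ≤ C₀ * κ * (M.dan (2 * q) A j).toReal := by positivity
    rw [hC]
    nlinarith

end CausalModel

end Products

/-! ### Kernel weights and smoothing bias -/

section Kernel

lemma sum_mul_by_parts (φ ξ : ℕ → ℝ) (k : ℕ) :
    ∑ i ∈ Finset.range (k + 1), φ i * ξ i = φ k * ∑ i ∈ Finset.range (k + 1), ξ i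
      - ∑ i ∈ Finset.range k, (φ (i + 1) - φ i) * ∑ l ∈ Finset.range (i + 1), ξ l := by
  induction k with
  | zero => simp
  | succ k ih =>
    rw [Finset.sum_range_succ, ih, Finset.sum_range_succ ξ (k + 1),
      Finset.sum_range_succ (fun i => (φ (i + 1) - φ i) * ∑ l ∈ Finset.range (i + 1), ξ l) k]
    ring

/-- Riemann sums of a function that is Lipschitz on its support. -/
lemma abs_sum_sub_integral_le {G : ℝ → ℝ} {c : NNReal} (hG : LipschitzOnWith c G (Set.Icc (-1) 1))
    (hGc : ∀ u ∈ Set.Icc (-1 : ℝ) 1, |G u| ≤ c) {x N : ℝ} (hN : 0 < N) {a e : ℕ} (hae : a ≤ e)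
    (ha₁ : x - N ≤ a) (ha₂ : a ≤ x - N + 1) (he₁ : x + N - 1 ≤ e) (he₂ : e ≤ x + N) :
    |∑ i ∈ Finset.Ico a (e + 1), G (((i : ℝ) - x) / N) - N * ∫ u in (-1 : ℝ)..1, G u| ≤ 5 * c := by
  set g : ℝ → ℝ := fun s => G ((s - x) / N) with hg
  have hmem : ∀ s ∈ Set.Icc (x - N) (x + N), (s - x) / N ∈ Set.Icc (-1 : ℝ) 1 := by
    rintro s ⟨h1, h2⟩
    constructor
    · rw [le_div_iff₀ hN]; linarith
    · rw [div_le_iff₀ hN]; linarith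
  have hgc : ∀ s ∈ Set.Icc (x - N) (x + N), |g s| ≤ c := fun s hs => hGc _ (hmem s hs)
  have hcont : ContinuousOn g (Set.Icc (x - N) (x + N)) :=
    hG.continuousOn.comp (by fun_prop) fun s hs => hmem s hs
  have hii : ∀ u v, u ∈ Set.Icc (x - N) (x + N) → v ∈ Set.Icc (x - N) (x + N) →
      IntervalIntegrable g volume u v := fun u v hu hv =>
    (hcont.mono (Set.uIcc_subset_Icc hu hv)).intervalIntegrable
  have hae' : (a : ℝ) ≤ e := by exact_mod_cast hae
  have hcv : N * ∫ u in (-1 : ℝ)..1, G u = ∫ s in (x - N)..(x + N), g s := by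
    have h1 := intervalIntegral.integral_comp_div_sub (a := x - N) (b := x + N)
      (fun u => G u) hN.ne' (x / N)
    rw [← sub_div, ← sub_div, show (x - N - x) / N = -1 by field_simp; ring,
      show (x + N - x) / N = 1 by field_simp; ring, smul_eq_mul] at h1
    rw [← h1]
    simp only [hg, sub_div]
  have hma : (a : ℝ) ∈ Set.Icc (x - N) (x + N) := ⟨ha₁, by linarith⟩
  have hme : (e : ℝ) ∈ Set.Icc (x - N) (x + N) := ⟨by linarith, he₂⟩
  have hml : x - N ∈ Set.Icc (x - N) (x + N) := ⟨le_rfl, by linarith⟩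
  have hmr : x + N ∈ Set.Icc (x - N) (x + N) := ⟨by linarith, le_rfl⟩
  have hsplit : ∫ s in (x - N)..(x + N), g s
      = (∫ s in (x - N)..a, g s) + (∫ s in (a : ℝ)..e, g s) + ∫ s in (e : ℝ)..(x + N), g s := by
    rw [intervalIntegral.integral_add_adjacent_intervals (hii _ _ hml hma) (hii _ _ hma hme),
      intervalIntegral.integral_add_adjacent_intervals (hii _ _ hml hme) (hii _ _ hme hmr)]
  have hend : ∀ u v, u ∈ Set.Icc (x - N) (x + N) → v ∈ Set.Icc (x - N) (x + N) → u ≤ v →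
      v - u ≤ 1 → |∫ s in u..v, g s| ≤ c := by
    intro u v hu hv huv h1
    have := intervalIntegral.norm_integral_le_of_norm_le_const (a := u) (b := v) (f := g) (C := c)
      fun s hs => hgc s (Set.uIcc_subset_Icc hu hv (Set.uIoc_subset_uIcc hs))
    rw [Real.norm_eq_abs, abs_of_nonneg (by linarith : 0 ≤ v - u)] at this
    have hc0 : (0:ℝ) ≤ c := c.2
    nlinarith
  have hcell : ∀ i ∈ Finset.Ico a e, |g i - ∫ s in (i : ℝ)..((i + 1 : ℕ) : ℝ), g s| ≤ c / N := by
    intro i hi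
    rw [Finset.mem_Ico] at hi
    have h1 : (a : ℝ) ≤ i := by exact_mod_cast hi.1
    have h2 : ((i + 1 : ℕ) : ℝ) ≤ e := by exact_mod_cast hi.2
    push_cast at h2 ⊢
    have hmi : (i : ℝ) ∈ Set.Icc (x - N) (x + N) := ⟨by linarith, by linarith⟩
    have hmi' : (i : ℝ) + 1 ∈ Set.Icc (x - N) (x + N) := ⟨by linarith, by linarith⟩
    have e1 : g i - ∫ s in (i : ℝ)..(i + 1), g s = ∫ s in (i : ℝ)..(i + 1), (g i - g s) := by
      rw [intervalIntegral.integral_sub (by simp) (hii _ _ hmi hmi')]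
      simp
    rw [e1]
    have := intervalIntegral.norm_integral_le_of_norm_le_const (a := (i : ℝ)) (b := i + 1)
      (f := fun s => g i - g s) (C := c / N) (fun s hs => by
        rw [Set.uIoc_of_le (by linarith)] at hs
        have hms : s ∈ Set.Icc (x - N) (x + N) := ⟨by linarith [hs.1, hmi.1], by linarith [hs.2, hmi'.2]⟩
        have := hG.dist_le_mul _ (hmem _ hmi) _ (hmem _ hms)
        rw [Real.dist_eq, Real.dist_eq, ← sub_div, abs_div, abs_of_pos hN] at this
        rw [Real.norm_eq_abs]
        refine this.trans ?_
        have h3 : |(i : ℝ) - x - (s - x)| ≤ 1 := by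
          rw [abs_le]; constructor <;> linarith [hs.1, hs.2]
        calc (c : ℝ) * (|(i : ℝ) - x - (s - x)| / N) ≤ c * (1 / N) := by gcongr
          _ = c / N := by ring)
    simpa using this
  have hmid : |∑ i ∈ Finset.Ico a e, g i - ∫ s in (a : ℝ)..e, g s| ≤ 2 * c := by
    have h1 := intervalIntegral.sum_integral_adjacent_intervals_Ico (f := g) (μ := volume)
      (a := fun i : ℕ => (i : ℝ)) hae (fun i hi => by
        have h1 : (a : ℝ) ≤ i := by exact_mod_cast hi.1
        have h2 : ((i + 1 : ℕ) : ℝ) ≤ e := by exact_mod_cast hi.2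
        refine hii _ _ ⟨by linarith, ?_⟩ ⟨?_, by linarith⟩
        · push_cast at h2; linarith
        · push_cast; linarith)
    rw [← h1, ← Finset.sum_sub_distrib]
    refine (Finset.abs_sum_le_sum_abs _ _).trans ((Finset.sum_le_sum hcell).trans ?_)
    rw [Finset.sum_const, Nat.card_Ico, nsmul_eq_mul, Nat.cast_sub hae]
    have hc0 : (0:ℝ) ≤ c := c.2
    calc ((e : ℝ) - a) * (c / N) ≤ (2 * N) * (c / N) := by gcongr; linarith
      _ = 2 * c := by field_simp
  have h1 := hend _ _ hml hma ha₁ (by linarith)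
  have h2 := hend _ _ hme hmr he₂ (by linarith)
  have h3 := hgc _ hme
  rw [hcv, hsplit, Finset.sum_Ico_succ_top hae]
  change |∑ i ∈ Finset.Ico a e, g i + g e - _| ≤ _
  rw [abs_le] at *
  constructor <;> linarith [h1.1, h1.2, h2.1, h2.2, h3.1, h3.2, hmid.1, hmid.2]

/-- Properties of the kernel weights. -/
lemma exists_kernelWeight_bounds {K : ℝ → ℝ} (hK : IsRegularKernel K) : ∃ C : ℝ, 1 ≤ C ∧
    ∀ (n : ℕ) (b t : ℝ), 0 < b → C ≤ n * b → t ∈ Set.Icc b (1 - b) →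
      (∑ i ∈ Finset.Icc 1 n, kernelWeight K n b t i = 1) ∧
      (∀ i, 0 ≤ kernelWeight K n b t i ∧ kernelWeight K n b t i ≤ C / (n * b)) ∧
      (∀ i, kernelWeight K n b t i ≠ 0 → |(i : ℝ) / n - t| ≤ b) ∧
      |∑ i ∈ Finset.Icc 1 n, kernelWeight K n b t i * ((i : ℝ) / n - t)| ≤ C / n ∧
      ∀ (ξ : ℕ → ℝ) (X : ℝ), (∀ a e : ℕ, a ≤ e → e ≤ n + 1 → (e : ℝ) - a ≤ 2 * (n * b) + 1 →
        |∑ i ∈ Finset.Ico a e, ξ i| ≤ X) →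
        |∑ i ∈ Finset.Icc 1 n, kernelWeight K n b t i * ξ i| ≤ C / (n * b) * X := by
  obtain ⟨l, hl⟩ := hK.lipschitz
  have hbd : ∀ u ∈ Set.Icc (-1 : ℝ) 1, |K u| ≤ K 0 + l := by
    intro u hu
    have := hl.dist_le_mul u hu 0 (by simp)
    rw [Real.dist_eq, Real.dist_eq, sub_zero] at this
    have h1 : |u| ≤ 1 := abs_le.2 hu
    have h2 : |K u| ≤ |K u - K 0| + |K 0| := by
      have := abs_add_le (K u - K 0) (K 0); simpa using this
    rw [abs_of_nonneg (hK.nonneg 0)] at h2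
    have : (l : ℝ) * |u| ≤ l * 1 := mul_le_mul_of_nonneg_left h1 l.2
    linarith
  -- One constant for the suprema and the Lipschitz constants of both `K` and `u ↦ u K u` on
  -- `[-1,1]`.
  set c : NNReal := 2 * l + Real.toNNReal (K 0) with hc
  have hcr : (c : ℝ) = 2 * l + K 0 := by
    rw [hc]; push_cast; rw [Real.coe_toNNReal _ (hK.nonneg 0)]
  have hl0 : (0:ℝ) ≤ l := l.2
  have hK0 := hK.nonneg 0
  have hbd' : ∀ u ∈ Set.Icc (-1 : ℝ) 1, |K u| ≤ c := fun u hu => (hbd u hu).trans (by linarith)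
  have hKc : ∀ u, K u ≤ c := fun u => by
    by_cases hu : u ∈ Set.Icc (-1 : ℝ) 1
    · exact (le_abs_self _).trans (hbd' u hu)
    · rw [hK.support u hu]; exact c.2
  have hlc : LipschitzOnWith c K (Set.Icc (-1) 1) := hl.weaken (by
    rw [← NNReal.coe_le_coe, hcr]; linarith)
  have hlu : LipschitzOnWith c (fun u => u * K u) (Set.Icc (-1) 1) := by
    refine LipschitzOnWith.of_dist_le_mul fun u hu v hv => ?_
    rw [Real.dist_eq, Real.dist_eq]
    have h1 := hl.dist_le_mul u hu v hv
    rw [Real.dist_eq, Real.dist_eq] at h1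
    have h2 : |u| ≤ 1 := abs_le.2 hu
    calc |u * K u - v * K v| = |u * (K u - K v) + (u - v) * K v| := by ring_nf
      _ ≤ |u| * |K u - K v| + |u - v| * |K v| := by
          rw [← abs_mul, ← abs_mul]; exact abs_add_le _ _
      _ ≤ 1 * (l * |u - v|) + |u - v| * (K 0 + l) := by gcongr; exact hbd v hv
      _ = c * |u - v| := by rw [hcr]; ring
  have hbu : ∀ u ∈ Set.Icc (-1 : ℝ) 1, |u * K u| ≤ c := fun u hu => by
    rw [abs_mul]
    calc |u| * |K u| ≤ 1 * c := by gcongr; exacts [abs_le.2 hu, hbd' u hu]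
      _ = c := one_mul _
  have hodd : ∫ u in (-1 : ℝ)..1, u * K u = 0 := by
    have h1 := intervalIntegral.integral_comp_neg (a := (-1 : ℝ)) (b := 1) fun u => u * K u
    simp only [hK.symm, neg_neg, neg_mul, intervalIntegral.integral_neg] at h1
    linarith
  have hc0 : (0:ℝ) ≤ c := c.2
  -- Once `n b ≥ 10 c + 1`, the Riemann sum error `5 c` is at most half of `n b`, and the
  -- denominator of the weights is at least `n b / 2`.
  refine ⟨10 * c + 1, by linarith, fun n b t hb hnb ht => ?_⟩
  set C : ℝ := 10 * c + 1 with hC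
  set N : ℝ := n * b with hN
  have hN1 : 1 ≤ N := by linarith
  have hN0 : 0 < N := by linarith
  have hn0 : (0:ℝ) < n := by
    by_contra h
    have : (n : ℝ) = 0 := le_antisymm (not_lt.1 h) (Nat.cast_nonneg n)
    rw [hN, this] at hN0; simp at hN0
  set x : ℝ := n * t with hx
  have hxl : 0 ≤ x - N := by
    have : n * b ≤ n * t := by gcongr; exact ht.1
    linarith
  have hxr : x + N ≤ n := by
    have : n * t ≤ n * (1 - b) := by gcongr; exact ht.2
    rw [hx, hN]; linarith
  set φ : ℕ → ℝ := fun i => K (((i : ℝ) - x) / N) with hφ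
  have habs : ∀ u, K |u| = K u := fun u => by
    rcases abs_choice u with h | h <;> rw [h]
    exact hK.symm u
  have hsc : ∀ i : ℕ, scaledKernel K b ((i : ℝ) / n) t = φ i / b := by
    intro i
    change K (|(i : ℝ) / n - t| / b) / b = K (((i : ℝ) - x) / N) / b
    rw [← habs (((i : ℝ) - x) / N), abs_div, abs_of_pos hN0]
    congr 2
    rw [hx, hN, show (i : ℝ) / n - t = (i - n * t) / n by field_simp, abs_div, abs_of_pos hn0,
      div_div]
  set D : ℝ := ∑ i ∈ Finset.Icc 1 n, φ i with hD
  have hw : ∀ i, kernelWeight K n b t i = φ i / D := by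
    intro i
    rw [kernelWeight, hsc, Finset.sum_congr rfl fun i _ => hsc i, ← Finset.sum_div,
      div_div_div_cancel_right₀ hb.ne']
  -- The maximum with `1` matters when `x = N`: the ceiling is then `0`, an index outside the sum.
  set a : ℕ := max 1 ⌈x - N⌉₊ with ha
  set e : ℕ := ⌊x + N⌋₊ with he
  have ha₁ : x - N ≤ a := (Nat.le_ceil _).trans (by exact_mod_cast le_max_right _ _)
  have ha₂ : a ≤ x - N + 1 := by
    rw [ha, Nat.cast_max]
    exact max_le (by push_cast; linarith) (Nat.ceil_lt_add_one hxl).le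
  have he₁ : x + N - 1 ≤ e := (Nat.sub_one_lt_floor _).le
  have he₂ : e ≤ x + N := Nat.floor_le (by linarith)
  have hae : a ≤ e := by
    rw [ha]
    refine max_le (Nat.le_floor (by push_cast; linarith)) (Nat.ceil_le.2 ?_)
    linarith
  have hen : e ≤ n := by
    have : (e : ℝ) ≤ n := by linarith
    exact_mod_cast this
  have hwin : ∀ ξ : ℕ → ℝ, ∑ i ∈ Finset.Icc 1 n, φ i * ξ i = ∑ i ∈ Finset.Ico a (e + 1), φ i * ξ i := by
    intro ξ
    symm
    refine Finset.sum_subset (fun i hi => ?_) fun i hi hi' => ?_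
    · rw [Finset.mem_Ico] at hi
      rw [Finset.mem_Icc]
      exact ⟨(le_max_left _ _).trans hi.1, by omega⟩
    · rw [Finset.mem_Icc] at hi
      rw [Finset.mem_Ico, not_and_or, not_le, not_lt] at hi'
      have : φ i = 0 := by
        refine hK.support _ fun hmem => ?_
        rw [Set.mem_Icc, le_div_iff₀ hN0, div_le_iff₀ hN0] at hmem
        rcases hi' with h | h
        · have : i < ⌈x - N⌉₊ := by
            rcases lt_max_iff.1 h with h | h
            · omega
            · exact h
          have := Nat.lt_ceil.1 this
          linarith [hmem.1]
        · have : x + N < i := (Nat.floor_lt (by linarith)).1 (by omega)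
          linarith [hmem.2]
      rw [this, zero_mul]
  have hR₁ := abs_sum_sub_integral_le hlc hbd' hN0 hae ha₁ ha₂ he₁ he₂
  have hR₂ := abs_sum_sub_integral_le hlu hbu hN0 hae ha₁ ha₂ he₁ he₂
  rw [hK.integral_eq_one, mul_one] at hR₁
  rw [hodd, mul_zero, sub_zero] at hR₂
  have hDw : D = ∑ i ∈ Finset.Ico a (e + 1), φ i := by
    have := hwin fun _ => 1
    simpa using this
  have hDN : N / 2 ≤ D := by
    rw [hDw]
    have := (abs_le.1 hR₁).1
    change -(5 * (c:ℝ)) ≤ ∑ i ∈ Finset.Ico a (e + 1), φ i - N at this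
    linarith
  have hD0 : 0 < D := by linarith
  have hDinv : ∀ y, 0 ≤ y → y / D ≤ 2 * y / N := by
    intro y hy
    rw [div_le_div_iff₀ hD0 hN0]; nlinarith
  have hφ0 : ∀ i, 0 ≤ φ i := fun i => hK.nonneg _
  refine ⟨?_, fun i => ⟨?_, ?_⟩, fun i hi => ?_, ?_, fun ξ X hX => ?_⟩
  · simp only [hw]
    rw [← Finset.sum_div, div_self hD0.ne']
  · rw [hw]; exact div_nonneg (hφ0 i) hD0.le
  · rw [hw]
    refine (hDinv _ (hφ0 i)).trans ?_
    gcongr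
    linarith [hKc (((i : ℝ) - x) / N)]
  · rw [hw] at hi
    have hφi : φ i ≠ 0 := fun h => hi (by rw [h, zero_div])
    have hmem : ((i : ℝ) - x) / N ∈ Set.Icc (-1 : ℝ) 1 := by
      by_contra h; exact hφi (hK.support _ h)
    rw [show (i : ℝ) / n - t = b * (((i : ℝ) - x) / N) by rw [hx, hN]; field_simp, abs_mul,
      abs_of_pos hb]
    have := abs_le.2 hmem
    nlinarith
  · have e1 : ∑ i ∈ Finset.Icc 1 n, kernelWeight K n b t i * ((i : ℝ) / n - t)
        = b / D * ∑ i ∈ Finset.Ico a (e + 1), ((i : ℝ) - x) / N * K (((i : ℝ) - x) / N) := by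
      have := hwin fun i => b / D * (((i : ℝ) - x) / N)
      rw [Finset.mul_sum]
      calc _ = ∑ i ∈ Finset.Icc 1 n, φ i * (b / D * (((i : ℝ) - x) / N)) := by
            refine Finset.sum_congr rfl fun i _ => ?_
            rw [hw, hx, hN]
            field_simp
        _ = _ := by
            rw [this]
            refine Finset.sum_congr rfl fun i _ => ?_
            rw [hφ]; ring
    rw [e1, abs_mul, abs_of_pos (by positivity)]
    calc b / D * |∑ i ∈ Finset.Ico a (e + 1), ((i : ℝ) - x) / N * K (((i : ℝ) - x) / N)|
        ≤ (2 * b / N) * (5 * c) :=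
          mul_le_mul (hDinv b hb.le) hR₂ (abs_nonneg _) (by positivity)
      _ = 10 * c / n := by rw [hN]; field_simp; ring
      _ ≤ C / n := by gcongr; linarith
  · have hlen : ((e + 1 : ℕ) : ℝ) - a ≤ 2 * N + 1 := by push_cast; linarith
    have e1 : ∑ i ∈ Finset.Icc 1 n, kernelWeight K n b t i * ξ i
        = (∑ i ∈ Finset.Ico a (e + 1), φ i * ξ i) / D := by
      rw [← hwin, Finset.sum_div]
      refine Finset.sum_congr rfl fun i _ => ?_
      rw [hw]; ring
    have hS : ∀ m ≤ e + 1 - a, |∑ i ∈ Finset.range m, ξ (a + i)| ≤ X := by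
      intro m hm
      have := hX a (a + m) (by omega) (by omega) (by
        have : ((a + m : ℕ) : ℝ) ≤ ((e + 1 : ℕ) : ℝ) := by exact_mod_cast (by omega)
        linarith)
      rwa [Finset.sum_Ico_eq_sum_range, Nat.add_sub_cancel_left] at this
    have hX0 : 0 ≤ X := (abs_nonneg _).trans (hS 0 (Nat.zero_le _))
    have hk : e + 1 - a = (e - a) + 1 := by omega
    have hstep : ∀ i ∈ Finset.range (e - a), |φ (a + (i + 1)) - φ (a + i)| ≤ c / N := by
      intro i hi
      have hi' : i < e - a := Finset.mem_range.1 hi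
      have hmem : ∀ m : ℕ, a ≤ m → m ≤ e → ((m : ℝ) - x) / N ∈ Set.Icc (-1 : ℝ) 1 := by
        intro m h1 h2
        have h1' : (a : ℝ) ≤ m := by exact_mod_cast h1
        have h2' : (m : ℝ) ≤ e := by exact_mod_cast h2
        rw [Set.mem_Icc, le_div_iff₀ hN0, div_le_iff₀ hN0]
        constructor <;> linarith
      have := hlc.dist_le_mul _ (hmem (a + (i + 1)) (by omega) (by omega)) _
        (hmem (a + i) (by omega) (by omega))
      rw [Real.dist_eq, Real.dist_eq] at this
      refine this.trans (le_of_eq ?_)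
      rw [← sub_div, abs_div, abs_of_pos hN0]
      push_cast
      rw [show (a : ℝ) + (i + 1) - x - (a + i - x) = 1 by ring, abs_one]
      ring
    -- Summation by parts inside the window, where `K` is Lipschitz: the total variation of `φ`
    -- there is at most `2 c` and its last value at most `c`. The jumps of `K` at `±1` play no role.
    have hmain : |∑ i ∈ Finset.Ico a (e + 1), φ i * ξ i| ≤ 3 * c * X := by
      rw [Finset.sum_Ico_eq_sum_range, hk,
        sum_mul_by_parts (fun i => φ (a + i)) (fun i => ξ (a + i))]
      have t1 : |φ (a + (e - a)) * ∑ i ∈ Finset.range (e - a + 1), ξ (a + i)| ≤ c * X := by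
        rw [abs_mul, abs_of_nonneg (hφ0 _)]
        exact mul_le_mul (hKc _) (hS _ (by omega)) (abs_nonneg _) hc0
      have t2 : |∑ i ∈ Finset.range (e - a), (φ (a + (i + 1)) - φ (a + i))
          * ∑ l ∈ Finset.range (i + 1), ξ (a + l)| ≤ 2 * c * X := by
        refine (Finset.abs_sum_le_sum_abs _ _).trans ((Finset.sum_le_sum
          (g := fun _ => c / N * X) fun i hi => ?_).trans ?_)
        · rw [abs_mul]
          exact mul_le_mul (hstep i hi) (hS _ (by have := Finset.mem_range.1 hi; omega))
            (abs_nonneg _) (by positivity)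
        · rw [Finset.sum_const, Finset.card_range, nsmul_eq_mul, Nat.cast_sub hae]
          calc ((e : ℝ) - a) * (c / N * X) ≤ (2 * N) * (c / N * X) := by gcongr; linarith
            _ = 2 * c * X := by field_simp
      refine (abs_sub _ _).trans ?_
      linarith
    rw [e1, abs_div, abs_of_pos hD0]
    refine (hDinv _ (abs_nonneg _)).trans ?_
    rw [div_mul_eq_mul_div]
    have hcX : 0 ≤ (c : ℝ) * X := by positivity
    refine div_le_div_of_nonneg_right ?_ hN0.le
    rw [hC]
    linarith

/-- The smoothing bias. -/
lemma abs_sum_weight_mul_sub_le {σ w : ℕ → ℝ} {f : ℝ → ℝ} {n : ℕ} {b t L' Lf B C : ℝ}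
    (hn : 1 ≤ n) (hb : 0 < b) (ht : t ∈ Set.Icc b (1 - b)) (hC : 0 ≤ C)
    (hf : ContDiffOn ℝ 2 f (Set.Ico 0 1))
    (hf2 : ∀ s ∈ Set.Ico (0 : ℝ) 1, |iteratedDerivWithin 2 f (Set.Ico 0 1) s| ≤ L')
    (hLf : ∀ s ∈ Set.Ico (0 : ℝ) 1, ∀ s' ∈ Set.Ico (0 : ℝ) 1, |f s - f s'| ≤ Lf * |s - s'|)
    (hB : ∀ s ∈ Set.Icc (0 : ℝ) 1, |f s| ≤ B) (hσ : ∀ i, i ≤ n → σ i = f ((i : ℝ) / n))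
    (hw1 : ∑ i ∈ Finset.Icc 1 n, w i = 1) (hw0 : ∀ i, 0 ≤ w i) (hwC : ∀ i, w i ≤ C / (n * b))
    (hwb : ∀ i, w i ≠ 0 → |(i : ℝ) / n - t| ≤ b)
    (hwm : |∑ i ∈ Finset.Icc 1 n, w i * ((i : ℝ) / n - t)| ≤ C / n) :
    |∑ i ∈ Finset.Icc 1 n, w i * σ i - f t| ≤ L' * b ^ 2 + 2 * C * (B + Lf) / (n * b) := by
  have hn0 : (0:ℝ) < n := by exact_mod_cast hn
  have ht0 : 0 < t := lt_of_lt_of_le hb ht.1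
  have ht1 : t < 1 := by linarith [ht.2]
  have htI : t ∈ Set.Ico (0:ℝ) 1 := ⟨ht0.le, ht1⟩
  have hu : UniqueDiffOn ℝ (Set.Ico (0:ℝ) 1) := uniqueDiffOn_Ico 0 1
  have hd : DifferentiableOn ℝ f (Set.Ico 0 1) := hf.differentiableOn (by norm_num)
  set f' := derivWithin f (Set.Ico 0 1) with hf'
  have hB0 : 0 ≤ B := (abs_nonneg _).trans (hB t ⟨ht0.le, ht1.le⟩)
  have hder : ∀ s ∈ Set.Ico (0:ℝ) 1, HasDerivWithinAt f (f' s) (Set.Ico 0 1) s := fun s hs =>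
    (hd s hs).hasDerivWithinAt
  have hd' : DifferentiableOn ℝ f' (Set.Ico 0 1) :=
    ((contDiffOn_succ_iff_derivWithin (n := 1) hu).1 hf).2.2.differentiableOn (by norm_num)
  have hf'' : ∀ s ∈ Set.Ico (0:ℝ) 1, ‖derivWithin f' (Set.Ico 0 1) s‖ ≤ L' := by
    intro s hs
    have := hf2 s hs
    rwa [iteratedDerivWithin_succ, iteratedDerivWithin_one] at this
  have hlip' : ∀ s ∈ Set.Ico (0:ℝ) 1, |f' s - f' t| ≤ L' * |s - t| := fun s hs =>
    (convex_Ico (0:ℝ) 1).norm_image_sub_le_of_norm_derivWithin_le hd' hf'' htI hs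
  have hL'0 : 0 ≤ L' := (norm_nonneg _).trans (hf'' t htI)
  have htaylor : ∀ s ∈ Set.Ico (0:ℝ) 1, |f s - f t - f' t * (s - t)| ≤ L' * |s - t| ^ 2 := by
    intro s hs
    have hsub : Set.uIcc t s ⊆ Set.Ico 0 1 := (convex_Ico (0:ℝ) 1).ordConnected.uIcc_subset htI hs
    have := (convex_uIcc t s).norm_image_sub_le_of_norm_hasDerivWithin_le
      (f := fun v => f v - f' t * v) (f' := fun v => f' v - f' t) (C := L' * |s - t|)
      (fun v hv => by
        have h1 := ((hder v (hsub hv)).mono hsub).sub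
          (((hasDerivWithinAt_id v (Set.uIcc t s)).const_mul (f' t)))
        rw [mul_one] at h1
        exact h1)
      (fun v hv => by
        refine (hlip' v (hsub hv)).trans ?_
        have : |v - t| ≤ |s - t| := by
          have := Set.abs_sub_left_of_mem_uIcc hv
          simpa using this
        gcongr) Set.left_mem_uIcc Set.right_mem_uIcc
    rw [Real.norm_eq_abs, Real.norm_eq_abs] at this
    calc |f s - f t - f' t * (s - t)| = |f s - f' t * s - (f t - f' t * t)| := by ring_nf
      _ ≤ _ := this
      _ = _ := by ring
  have hLf0 : 0 ≤ Lf := by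
    have h1 := hLf 0 (by simp) (1 / 2) (by norm_num)
    have h2 := (abs_nonneg _).trans h1
    norm_num at h2
    linarith
  have hf't : |f' t| ≤ Lf := by
    have hnhds : Set.Ico (0:ℝ) 1 ∈ 𝓝 t := Ico_mem_nhds ht0 ht1
    rw [hf', derivWithin_of_mem_nhds hnhds]
    have hlip : LipschitzOnWith Lf.toNNReal f (Set.Ico 0 1) :=
      LipschitzOnWith.of_dist_le_mul fun u hu v hv => by
        rw [Real.dist_eq, Real.dist_eq, Real.coe_toNNReal _ hLf0]
        exact hLf u hu v hv
    have := norm_deriv_le_of_lipschitzOn hnhds hlip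
    rwa [Real.coe_toNNReal _ hLf0] at this
  have hnb : 0 < n * b := by positivity
  have hb1 : b ≤ 1 := by linarith [ht.1, ht.2]
  have hσn : σ n = f 1 := by rw [hσ n le_rfl, div_self hn0.ne']
  have hi : ∀ i ∈ Finset.Icc 1 (n - 1), (i : ℝ) / n ∈ Set.Ico (0:ℝ) 1 := by
    intro i hi
    rw [Finset.mem_Icc] at hi
    refine ⟨by positivity, ?_⟩
    rw [div_lt_one hn0]
    exact_mod_cast (by omega : i < n)
  have hsplit : ∀ F : ℕ → ℝ, ∑ i ∈ Finset.Icc 1 n, F i = ∑ i ∈ Finset.Icc 1 (n - 1), F i + F n := by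
    intro F
    obtain ⟨m, rfl⟩ := Nat.exists_eq_add_of_le' hn
    rw [Finset.sum_Icc_succ_top (by omega)]
    simp
  -- The index `i = n` sits at time `1`, outside the interval of smoothness. It is split off and
  -- estimated by the size of its weight, of order `1/(nb)`.
  have hid : ∑ i ∈ Finset.Icc 1 n, w i * σ i - f t
      = ∑ i ∈ Finset.Icc 1 (n - 1), w i * (f ((i : ℝ) / n) - f t - f' t * ((i : ℝ) / n - t))
        + f' t * ∑ i ∈ Finset.Icc 1 n, w i * ((i : ℝ) / n - t)
        + w n * (f 1 - f t) - f' t * (w n * (1 - t)) := by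
    have h1 : f t = ∑ i ∈ Finset.Icc 1 n, w i * f t := by rw [← Finset.sum_mul, hw1, one_mul]
    have h2 : ∑ i ∈ Finset.Icc 1 n, w i * σ i - f t = ∑ i ∈ Finset.Icc 1 n, w i * (σ i - f t) := by
      rw [h1, ← Finset.sum_sub_distrib, ← h1]
      exact Finset.sum_congr rfl fun i _ => by ring
    rw [h2, hsplit, hsplit fun i => w i * ((i : ℝ) / n - t), mul_add, hσn, div_self hn0.ne',
      Finset.mul_sum, ← add_assoc, ← Finset.sum_add_distrib]
    have h3 : ∑ i ∈ Finset.Icc 1 (n - 1), w i * (σ i - f t)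
        = ∑ i ∈ Finset.Icc 1 (n - 1), (w i * (f ((i : ℝ) / n) - f t - f' t * ((i : ℝ) / n - t))
          + f' t * (w i * ((i : ℝ) / n - t))) := by
      refine Finset.sum_congr rfl fun i hi => ?_
      rw [hσ i (by have := (Finset.mem_Icc.1 hi).2; omega)]
      ring
    rw [h3]
    ring
  have t1 : |∑ i ∈ Finset.Icc 1 (n - 1), w i * (f ((i : ℝ) / n) - f t - f' t * ((i : ℝ) / n - t))|
      ≤ L' * b ^ 2 := by
    calc _ ≤ ∑ i ∈ Finset.Icc 1 (n - 1), w i * (L' * b ^ 2) := by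
          refine (Finset.abs_sum_le_sum_abs _ _).trans (Finset.sum_le_sum fun i hin => ?_)
          rw [abs_mul, abs_of_nonneg (hw0 i)]
          by_cases hwi : w i = 0
          · rw [hwi]; simp
          · refine mul_le_mul_of_nonneg_left ((htaylor _ (hi i hin)).trans ?_) (hw0 i)
            have := hwb i hwi
            gcongr
      _ ≤ ∑ i ∈ Finset.Icc 1 n, w i * (L' * b ^ 2) := by
          rw [hsplit]
          have := hw0 n
          have : 0 ≤ w n * (L' * b ^ 2) := by positivity
          linarith
      _ = L' * b ^ 2 := by rw [← Finset.sum_mul, hw1, one_mul]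
  have t2 : |f' t * ∑ i ∈ Finset.Icc 1 n, w i * ((i : ℝ) / n - t)| ≤ C * Lf / (n * b) := by
    rw [abs_mul]
    calc _ ≤ Lf * (C / n) := mul_le_mul hf't hwm (abs_nonneg _) hLf0
      _ = C * Lf / n := by ring
      _ ≤ C * Lf / (n * b) := by
          gcongr
          nlinarith
  have t3 : |w n * (f 1 - f t)| ≤ 2 * C * B / (n * b) := by
    rw [abs_mul, abs_of_nonneg (hw0 n)]
    have h1 : |f 1 - f t| ≤ 2 * B := (abs_sub _ _).trans (by
      linarith [hB 1 (by simp), hB t ⟨ht0.le, ht1.le⟩])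
    calc _ ≤ C / (n * b) * (2 * B) := mul_le_mul (hwC n) h1 (abs_nonneg _) (by positivity)
      _ = _ := by ring
  have t4 : |f' t * (w n * (1 - t))| ≤ C * Lf / (n * b) := by
    rw [abs_mul, abs_mul, abs_of_nonneg (hw0 n), abs_of_nonneg (by linarith : 0 ≤ 1 - t)]
    calc _ ≤ Lf * (C / (n * b) * 1) := by
          refine mul_le_mul hf't (mul_le_mul (hwC n) (by linarith) (by linarith) (by positivity))
            (mul_nonneg (hw0 n) (by linarith)) hLf0
      _ = _ := by ring
  rw [hid]
  have h5 : 2 * C * (B + Lf) / (n * b) = 2 * C * B / (n * b) + C * Lf / (n * b) + C * Lf / (n * b) := by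
    ring
  rw [h5]
  rw [abs_le] at *
  constructor <;> linarith [t1.1, t1.2, t2.1, t2.2, t3.1, t3.2, t4.1, t4.2]

end Kernel

/-! ### Uniform error of the covariance estimator -/

section CovarianceEstimate

open Measure

lemma abs_integral_mul_le {Ω : Type*} [MeasurableSpace Ω] {P : Measure Ω} {f g : Ω → ℝ} {u v : ℝ}
    (hf : AEStronglyMeasurable f P) (hg : AEStronglyMeasurable g P) (hu : 0 ≤ u) (hv : 0 ≤ v)
    (hfu : eLpNorm f (ENNReal.ofReal 2) P ≤ ENNReal.ofReal u)
    (hgv : eLpNorm g (ENNReal.ofReal 2) P ≤ ENNReal.ofReal v) :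
    |∫ ω, f ω * g ω ∂P| ≤ u * v := by
  have h1 : ‖∫ ω, f ω * g ω ∂P‖ₑ ≤ ENNReal.ofReal (u * v) := by
    refine (enorm_integral_le_lintegral_enorm _).trans ?_
    rw [← eLpNorm_one_eq_lintegral_enorm, ← ENNReal.ofReal_one, ENNReal.ofReal_mul hu]
    exact (eLpNorm_mul_le one_pos (by norm_num) hf hg).trans (mul_le_mul' hfu hgv)
  rw [Real.enorm_eq_ofReal_abs] at h1
  exact (ENNReal.ofReal_le_ofReal_iff (by positivity)).1 h1

/-- The boundary part of the bias is of order `N / B`, below the stochastic rate because `R ≥ 1`.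
This is why the covariances have to be bounded by a multiple of `N_X` and not merely by a constant.
-/
lemma deviation_add_bias_le {c₃ c₄ c Y J N R B b L' : ℝ} (hB : 0 < B) (hN : 0 ≤ N) (hJ : 0 ≤ J)
    (hR : 1 ≤ R) (hc₃ : 0 ≤ c₃) (hc₄ : 0 ≤ c₄) (hc : Y + 4 * c₃ * c₄ ≤ c)
    (hL' : |L'| ≤ c) :
    Y * ((J + N * R) / B) + (L' * b ^ 2 + 2 * c₃ * (c₄ * N + c₄ * N) / B)
      ≤ c * (b ^ 2 + (J + N * R) / B) := by
  have hNJ : N ≤ J + N * R :=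
    (le_mul_of_one_le_right hN hR).trans (le_add_of_nonneg_left hJ)
  have e3 : 2 * c₃ * (c₄ * N + c₄ * N) / B ≤ 4 * c₃ * c₄ * ((J + N * R) / B) := by
    calc _ = 4 * c₃ * c₄ * (N / B) := by ring
      _ ≤ _ := by gcongr
  have f1 : L' * b ^ 2 ≤ c * b ^ 2 :=
    mul_le_mul_of_nonneg_right ((le_abs_self _).trans hL') (sq_nonneg b)
  have r0 : 0 ≤ (J + N * R) / B := by positivity
  have f2 := mul_le_mul_of_nonneg_right hc r0
  linarith

namespace CausalModel

variable {p : ℕ} {M : CausalModel p}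

lemma NX_nonneg (A : ℝ) : 0 ≤ M.NX A := ENNReal.toReal_nonneg

/-- The covariance function and its increments are bounded by the dependence adjusted norm. -/
lemma exists_abs_cov_le {q : ℝ} (hq : 2 < q) (ν L L' : ℝ) : ∃ C : ℝ, 1 ≤ C ∧
    ∀ {p : ℕ} {M : CausalModel p} {A : ℝ}, M.DependenceCondition q A ν →
      M.SmoothnessCondition L L' →
      (∀ t ∈ Set.Icc (0 : ℝ) 1, ∀ j k, |M.cov t j k| ≤ C * M.NX A) ∧
      ∀ s ∈ Set.Ico (0 : ℝ) 1, ∀ t ∈ Set.Ico (0 : ℝ) 1, ∀ j k,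
        |M.cov s j k - M.cov t j k| ≤ C * M.NX A * |s - t| := by
  obtain ⟨C₀, hC₀1, hC₀⟩ := exists_eLpNorm_le_dan (a := 4) (by norm_num)
  have hq0 : 0 < q := by linarith
  set κ : ℝ := max ν 1 ^ (1 / (2 * q)) with hκ
  have hκ1 : 1 ≤ κ := Real.one_le_rpow (le_max_right _ _) (by positivity)
  set C : ℝ := C₀ * κ + 2 * C₀ * |L| with hC
  have hL0 : 0 ≤ |L| := abs_nonneg L
  have hC1 : C₀ * κ ≤ C := by rw [hC]; nlinarith [mul_nonneg (by linarith : 0 ≤ C₀) hL0]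
  have hC2 : 2 * C₀ * |L| ≤ C := by rw [hC]; nlinarith
  refine ⟨C, by nlinarith, fun {p M A} h hS => ?_⟩
  have hN := M.NX_nonneg A
  have hdan4 : ∀ j, M.dan 4 A j < ⊤ := fun j =>
    (dan_mono (by linarith) j).trans_lt (h.dan_lt_top j)
  have hm := fun t j => (M.measurable_H_apply t j).aestronglyMeasurable (μ := M.pastLaw)
  have h2 : ∀ t ∈ Set.Icc (0:ℝ) 1, ∀ j, eLpNorm (fun s => M.H s t j) (ENNReal.ofReal 2) M.pastLaw
      ≤ ENNReal.ofReal (C₀ * M.NX A) := fun t ht j =>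
    ((eLpNorm_le_eLpNorm_of_exponent_le (ENNReal.ofReal_le_ofReal (by norm_num)) (hm t j)).trans
      (hC₀ ht (hdan4 j) (h.memLp hq0 ht j (by linarith)) (h.mean_zero t ht j))).trans
      (ENNReal.ofReal_le_ofReal (by gcongr; exact toReal_dan_le_NX hdan4 j))
  have h2' : ∀ t ∈ Set.Icc (0:ℝ) 1, ∀ j, eLpNorm (fun s => M.H s t j) (ENNReal.ofReal 2) M.pastLaw
      ≤ ENNReal.ofReal κ := fun t ht j => h.eLpNorm_le' hq0 ht j (by linarith)
  have hint : ∀ (f g : (ℕ → Fin p → ℝ) → ℝ), MemLp f 2 M.pastLaw → MemLp g 2 M.pastLaw →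
      Integrable (fun s => f s * g s) M.pastLaw := fun f g hf hg => hf.integrable_mul hg
  have hmem : ∀ t ∈ Set.Icc (0:ℝ) 1, ∀ j, MemLp (fun s => M.H s t j) 2 M.pastLaw := by
    intro t ht j
    have := h.memLp hq0 ht j (a := 2) (by linarith)
    simpa using this
  refine ⟨fun t ht j k => ?_, fun s hs t ht j k => ?_⟩
  · rw [cov, Matrix.of_apply]
    calc _ ≤ (C₀ * M.NX A) * κ := abs_integral_mul_le (hm t j) (hm t k) (by positivity) (by positivity)
          (h2 t ht j) (h2' t ht k)
      _ = C₀ * κ * M.NX A := by ring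
      _ ≤ C * M.NX A := by gcongr
  · have hs' : s ∈ Set.Icc (0:ℝ) 1 := ⟨hs.1, hs.2.le⟩
    have ht' : t ∈ Set.Icc (0:ℝ) 1 := ⟨ht.1, ht.2.le⟩
    have hlip : ∀ j, eLpNorm (fun z => M.H z s j - M.H z t j) (ENNReal.ofReal 2) M.pastLaw
        ≤ ENNReal.ofReal (|L| * |s - t|) := by
      intro j
      have := hS.lipschitz s hs t ht j
      rw [ENNReal.ofReal_ofNat]
      refine this.trans (ENNReal.ofReal_le_ofReal ?_)
      gcongr
      exact le_abs_self L
    have e : M.cov s j k - M.cov t j k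
        = ∫ z, M.H z s j * (M.H z s k - M.H z t k) ∂M.pastLaw
          + ∫ z, (M.H z s j - M.H z t j) * M.H z t k ∂M.pastLaw := by
      have i1 : Integrable (fun z => M.H z s j * (M.H z s k - M.H z t k)) M.pastLaw :=
        hint _ _ (hmem s hs' j) ((hmem s hs' k).sub (hmem t ht' k))
      have i2 : Integrable (fun z => (M.H z s j - M.H z t j) * M.H z t k) M.pastLaw :=
        hint _ _ ((hmem s hs' j).sub (hmem t ht' j)) (hmem t ht' k)
      rw [cov, cov, Matrix.of_apply, Matrix.of_apply,
        ← integral_sub (hint _ _ (hmem s hs' j) (hmem s hs' k))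
          (hint _ _ (hmem t ht' j) (hmem t ht' k)), ← integral_add i1 i2]
      refine integral_congr_ae (.of_forall fun z => ?_)
      ring
    rw [e]
    have b1 := abs_integral_mul_le (hm s j) ((hm s k).sub (hm t k)) (by positivity)
      (by positivity) (h2 s hs' j) (hlip k)
    have b2 := abs_integral_mul_le ((hm s j).sub (hm t j)) (hm t k) (by positivity)
      (by positivity) (hlip j) (h2 t ht' k)
    refine (abs_add_le _ _).trans ((add_le_add b1 b2).trans ?_)
    calc _ = 2 * C₀ * |L| * (M.NX A * |s - t|) := by ring
      _ ≤ C * (M.NX A * |s - t|) := by gcongr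
      _ = _ := by ring

lemma MX_rpow {q A ν : ℝ} (hq : 0 < q) (h : M.DependenceCondition q A ν) :
    M.MX q A ^ q = ∑ j, (M.dan (2 * q) A j).toReal ^ q := by
  unfold MX
  rw [ENNReal.toReal_rpow, ← ENNReal.rpow_mul, one_div_mul_cancel hq.ne', ENNReal.rpow_one,
    ENNReal.toReal_sum fun j _ => (ENNReal.rpow_lt_top_of_nonneg hq.le (h.dan_lt_top j).ne).ne]
  exact Finset.sum_congr rfl fun j _ => (ENNReal.toReal_rpow _ _).symm

lemma JqA_nonneg {q A : ℝ} {n : ℕ} (hϖ : 0 ≤ varpi q A n) : 0 ≤ JqA M q A n := by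
  unfold JqA MX
  have := ENNReal.toReal_nonneg (a := (∑ j : Fin p, M.dan (2 * q) A j ^ q) ^ (1 / q))
  positivity

/-- Shows that a threshold of order `JqA` satisfies the moment condition of the interval bound. -/
lemma JqA_rpow {q A ν : ℝ} {n : ℕ} (hq : 0 < q) (h : M.DependenceCondition q A ν)
    (hϖ : 0 ≤ varpi q A n) :
    JqA M q A n ^ q = p * varpi q A n * ∑ j, (M.dan (2 * q) A j).toReal ^ q := by
  have hM : 0 ≤ M.MX q A := ENNReal.toReal_nonneg
  rw [JqA, Real.mul_rpow hM (by positivity), MX_rpow hq h, ← Real.rpow_mul (by positivity),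
    one_div_mul_cancel hq.ne', Real.rpow_one, mul_comm]

lemma IsInnovations.map_eq_iidLaw {Ω : Type*} [MeasurableSpace Ω] {P : Measure Ω}
    {ε : ℤ → Ω → Fin p → ℝ} (h : M.IsInnovations P ε) :
    P.map (fun ω i => ε i ω) = iidLaw M.law ℤ := by
  have := h.indep.isProbabilityMeasure
  rw [(iIndepFun_iff_map_fun_eq_infinitePi_map h.measurable).1 h.indep]
  congr 1
  ext1 i
  exact h.map_eq i

/-- The observation times, kept in `[0,1]`. -/
def obsTime (n : ℕ) (i : ℕ) : ℝ := min ((i : ℝ) / n) 1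

lemma obsTime_mem (n i : ℕ) : obsTime n i ∈ Set.Icc (0 : ℝ) 1 :=
  ⟨le_min (by positivity) zero_le_one, min_le_right _ _⟩

lemma obsTime_eq {n i : ℕ} (hi : i ≤ n) : obsTime n i = (i : ℝ) / n :=
  min_eq_left (div_le_one_of_le₀ (by exact_mod_cast hi) (Nat.cast_nonneg n))

lemma covHat_apply (K : ℝ → ℝ) (n : ℕ) (b t : ℝ) {Ω : Type*}
    (ε : ℤ → Ω → Fin p → ℝ) (ω : Ω) (j k : Fin p) :
    covHat K n b (M.obs ε n ω) t j k = ∑ i ∈ Finset.Icc 1 n, kernelWeight K n b t i *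
      (M.proc (obsTime n) i j (fun i => ε i ω) * M.proc (obsTime n) i k (fun i => ε i ω)) := by
  rw [covHat, Matrix.sum_apply]
  refine Finset.sum_congr rfl fun i hi => ?_
  rw [Matrix.smul_apply, Matrix.vecMulVec_apply, smul_eq_mul, proc, proc,
    obsTime_eq (Finset.mem_Icc.1 hi).2]
  rfl

set_option maxHeartbeats 800000 in
/-- Uniform deviation of the kernel estimator of the covariance matrix function. -/
lemma exists_measure_covHat_deviation_le {q A : ℝ} (hq : 2 < q) (hA : 0 < A) {K : ℝ → ℝ}
    (hK : IsRegularKernel K) (ν L L' Λ : ℝ) : ∃ C : ℝ, 1 ≤ C ∧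
    ∀ {p : ℕ} {M : CausalModel p} {κ : ℝ}, M.DependenceCondition q A ν →
      M.SmoothnessCondition L L' → M.SparsityCondition κ →
      ∀ (n l h : ℕ) (b : ℝ) (lam : ℕ → ℝ), 1 ≤ p → 1 ≤ l → 2 ^ h * l ≤ n →
      (n : ℝ) ≤ varpi q A n → 0 < b → C ≤ n * b → n * b ≤ 4 * (2 ^ h * l) →
      1 ≤ n * Real.log p → (∀ m, 0 < lam m) → ∑ m ∈ Finset.range h, lam m ≤ Λ →
      ∀ {Ω : Type*} [MeasurableSpace Ω] (P : Measure Ω) (ε : ℤ → Ω → Fin p → ℝ),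
      M.IsInnovations P ε →
      P {ω | ∃ t ∈ Set.Icc b (1 - b), ∃ j k, C * uniformRate M q A n b
          < |covHat K n b (M.obs ε n ω) t j k - M.cov t j k|}
        ≤ ENNReal.ofReal (C * ((l : ℝ) ^ q / p + p ^ 2 * Real.exp (-(4 * Real.log p))
          + p ^ 2 * ((l : ℝ) ^ q / p) ^ (3 : ℝ)
          + ∑ m ∈ Finset.range h,
            (p ^ 2 * Real.exp (-(4 * (lam m ^ 2 * (2 ^ m * l : ℝ) ^ (2 * A) * Real.log p)))
              + n / varpi q A n * (2 ^ m * l : ℝ) ^ (q / 2 - 1 - A * q) * lam m ^ (-q))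
          + n / varpi q A n * (2 ^ h * l : ℝ) ^ (q / 2 - 1 - A * q))) := by
  obtain ⟨C₁, hC₁1, hC₁⟩ := exists_pairArray hq ν
  obtain ⟨C₂, hC₂1, hC₂⟩ := exists_measure_sum_Ico_deviation_le.{0} hq hA
  obtain ⟨C₃, hC₃1, hC₃⟩ := exists_kernelWeight_bounds hK
  obtain ⟨C₄, hC₄1, hC₄⟩ := exists_abs_cov_le hq ν L L'
  have hq0 : 0 < q := by linarith
  -- The `12` bounds the ratio of the window length `2nb + 1 ≤ 3nb` to the block length `2 ^ h l ≥
  -- nb/4`.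
  set Y : ℝ := C₃ * (C₂ * (1 + |Λ| + 12) * C₁) with hY
  have hΛ0 := abs_nonneg Λ
  have hY0 : 0 ≤ Y := by positivity
  set C : ℝ := C₂ + C₃ + Y + 4 * C₃ * C₄ + |L'| with hC
  have hL'0 := abs_nonneg L'
  have hCC : 0 ≤ 4 * C₃ * C₄ := by positivity
  refine ⟨C, by linarith, ?_⟩
  intro p M κ hD hS hSp n l h b lam hp hl hln hϖ hb hnb hbl hnp hlam hΛ Ω _ P ε hε
  have hn1 : 1 ≤ n := hl.trans ((Nat.le_mul_of_pos_left l (by positivity)).trans hln)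
  have hn0 : (0:ℝ) < n := by exact_mod_cast hn1
  have hϖ0 : 0 < varpi q A n := by linarith
  have hp1 : (1:ℝ) ≤ p := by exact_mod_cast hp
  obtain ⟨δ, δ₂, U, hPA⟩ := hC₁ hp hD (hSp.isUnit_det 0 (by simp)) (obsTime_mem n)
  have hN0 : 0 < M.NX A := by
    have := hPA.N_pos
    exact pos_of_mul_pos_right this (by linarith)
  set R := Real.sqrt (n * Real.log p) with hR
  have hR1 : 1 ≤ R := Real.one_le_sqrt.2 hnp
  have hJ0 := M.JqA_nonneg (q := q) (A := A) (n := n) hϖ0.le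
  set J := JqA M q A n with hJ
  set N := M.NX A with hN
  set y : ℝ := C₁ * (J + N * R) with hy
  have hNR : 0 < N * R := by positivity
  have hy0 : 0 < y := by positivity
  have hyq : p * varpi q A n * ∑ j, (C₁ * (M.dan (2 * q) A j).toReal) ^ q ≤ y ^ q := by
    have e1 : ∑ j, (C₁ * (M.dan (2 * q) A j).toReal) ^ q
        = C₁ ^ q * ∑ j, (M.dan (2 * q) A j).toReal ^ q := by
      rw [Finset.mul_sum]
      exact Finset.sum_congr rfl fun j _ => Real.mul_rpow (by linarith) ENNReal.toReal_nonneg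
    rw [e1, hy, Real.mul_rpow (by linarith) (by positivity), mul_left_comm, ← JqA_rpow hq0 hD hϖ0.le]
    have : J ^ q ≤ (J + N * R) ^ q := Real.rpow_le_rpow hJ0 (by linarith) hq0.le
    exact mul_le_mul_of_nonneg_left this (by positivity)
  have hy2 : (C₁ * N) ^ 2 * (n * Real.log p) ≤ y ^ 2 := by
    have e1 : R ^ 2 = n * Real.log p := Real.sq_sqrt (by linarith)
    rw [← e1, hy]
    have : C₁ * N * R ≤ C₁ * (J + N * R) := by nlinarith
    calc (C₁ * N) ^ 2 * R ^ 2 = (C₁ * N * R) ^ 2 := by ring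
      _ ≤ _ := by gcongr
  have key := hC₂ hPA n l h (varpi q A n) y Λ lam hp hl hln hϖ hy0 hlam hΛ hyq hy2
  set Bad : Set (ℤ → Fin p → ℝ) := {x | ∃ e : Fin p × Fin p, ∃ a b : ℕ, a ≤ b ∧ b ≤ n + 1 ∧
          C₂ * (1 + Λ + ((b : ℝ) - a) / (2 ^ h * l)) * y < |∑ i ∈ Finset.Ico a b,
          (M.proc (obsTime n) i e.1 x * M.proc (obsTime n) i e.2 x
            - ∫ z, M.proc (obsTime n) i e.1 z * M.proc (obsTime n) i e.2 z ∂(iidLaw M.law ℤ))|}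
    with hBad
  -- An inequality suffices, and it holds without showing `Bad` to be measurable.
  have hPm : P (( fun ω i => ε i ω) ⁻¹' Bad) ≤ iidLaw M.law ℤ Bad := by
    rw [← hε.map_eq_iidLaw]
    exact le_map_apply (measurable_pi_lambda _ hε.measurable).aemeasurable _
  have hsub : {ω | ∃ t ∈ Set.Icc b (1 - b), ∃ j k, C * uniformRate M q A n b
          < |covHat K n b (M.obs ε n ω) t j k - M.cov t j k|} ⊆ (fun ω i => ε i ω) ⁻¹' Bad := by
    rintro ω ⟨t, ht, j, k, hlt⟩
    by_contra hne
    simp only [Set.mem_preimage, hBad, Set.mem_ofPred_eq] at hne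
    push Not at hne
    obtain ⟨w1, w2, w3, w4, w5⟩ := hC₃ n b t hb (by linarith) ht
    set x : ℤ → Fin p → ℝ := fun i => ε i ω
    set f : ℕ → ℝ := fun i => M.proc (obsTime n) i j x * M.proc (obsTime n) i k x with hf
    have hE : ∀ i, ∫ z, M.proc (obsTime n) i j z * M.proc (obsTime n) i k z ∂(iidLaw M.law ℤ)
        = M.cov (obsTime n i) j k := fun i => integral_proc_mul i j k
    have hnb1 : 1 ≤ n * b := by linarith
    have hnb0 : 0 < n * b := by linarith
    have hW0 : (0:ℝ) < 2 ^ h * l := by linarith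
    have hX := w5 (fun i => f i - M.cov (obsTime n i) j k) (C₂ * (1 + |Λ| + 12) * y)
      (fun a e hae hen hlen => by
        have := hne (j, k) a e hae hen
        simp only [hE] at this
        refine this.trans ?_
        have h1 : ((e : ℝ) - a) / (2 ^ h * l) ≤ 12 := by
          rw [div_le_iff₀ hW0]; linarith
        have h2 := le_abs_self Λ
        gcongr)
    have hcov := hC₄ hD hS
    have hbias := abs_sum_weight_mul_sub_le (σ := fun i => M.cov (obsTime n i) j k)
      (w := kernelWeight K n b t) (f := fun s => M.cov s j k) (n := n) (b := b) (t := t)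
      (L' := L') (Lf := C₄ * N) (B := C₄ * N) (C := C₃) hn1 hb ht (by linarith)
      (hS.contDiffOn j k) (hS.deriv2_le j k) (fun s hs s' hs' => hcov.2 s hs s' hs' j k)
      (fun s hs => hcov.1 s hs j k) (fun i hi => by rw [obsTime_eq hi]) w1 (fun i => (w2 i).1)
      (fun i => (w2 i).2) w3 w4
    have hdec : covHat K n b (M.obs ε n ω) t j k - M.cov t j k
        = ∑ i ∈ Finset.Icc 1 n, kernelWeight K n b t i * (f i - M.cov (obsTime n i) j k)
          + (∑ i ∈ Finset.Icc 1 n, kernelWeight K n b t i * M.cov (obsTime n i) j k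
            - M.cov t j k) := by
      rw [covHat_apply, ← add_sub_assoc, ← Finset.sum_add_distrib]
      congr 1
      refine Finset.sum_congr rfl fun i _ => ?_
      rw [hf]; ring
    have hfin : C₃ / (n * b) * (C₂ * (1 + |Λ| + 12) * y)
        + (L' * b ^ 2 + 2 * C₃ * (C₄ * N + C₄ * N) / (n * b)) ≤ C * uniformRate M q A n b := by
      have e' : uniformRate M q A n b = b ^ 2 + (J + N * R) / (n * b) := by
        rw [uniformRate, add_div, ← add_assoc]
      rw [e', hy]
      have e : C₃ / (n * b) * (C₂ * (1 + |Λ| + 12) * (C₁ * (J + N * R)))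
          = Y * ((J + N * R) / (n * b)) := by rw [hY]; ring
      rw [e]
      exact deviation_add_bias_le hnb0 hN0.le hJ0 hR1 (by linarith) (by linarith)
        (by linarith) (by linarith)
    rw [hdec] at hlt
    exact absurd (hlt.trans_le ((abs_add_le _ _).trans ((add_le_add hX hbias).trans hfin)))
      (lt_irrefl _)
  refine (measure_mono hsub).trans (hPm.trans (key.trans (ENNReal.ofReal_le_ofReal ?_)))
  refine mul_le_mul_of_nonneg_right (by linarith) ?_
  have : 0 ≤ ∑ m ∈ Finset.range h,
            (p ^ 2 * Real.exp (-(4 * (lam m ^ 2 * (2 ^ m * l : ℝ) ^ (2 * A) * Real.log p)))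
              + n / varpi q A n * (2 ^ m * l : ℝ) ^ (q / 2 - 1 - A * q) * lam m ^ (-q)) :=
    Finset.sum_nonneg fun m _ => by have := hlam m; positivity
  positivity

end CausalModel

end CovarianceEstimate

/-! ### Choice of the weights of the layers -/

section Asymptotics

lemma sum_two_rpow_neg_le {x : ℝ} (hx : 0 < x) (h : ℕ) :
    ∑ m ∈ Finset.range h, (2 : ℝ) ^ (-(x * m)) ≤ (1 - (2 : ℝ) ^ (-x))⁻¹ := by
  have h1 : (2:ℝ) ^ (-x) < 1 := Real.rpow_lt_one_of_one_lt_of_neg (by norm_num) (by linarith)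
  have h0 : 0 ≤ (2:ℝ) ^ (-x) := by positivity
  have e : ∀ m : ℕ, (2 : ℝ) ^ (-(x * m)) = ((2 : ℝ) ^ (-x)) ^ m := fun m => by
    rw [← Real.rpow_natCast, ← Real.rpow_mul (by norm_num)]; ring_nf
  simp only [e]
  rw [← tsum_geometric_of_lt_one h0 h1]
  exact (summable_geometric_of_lt_one h0 h1).sum_le_tsum _ fun m _ => by positivity

lemma sum_two_rpow_neg_reflect_le {x : ℝ} (hx : 0 < x) (h : ℕ) :
    ∑ m ∈ Finset.range h, (2 : ℝ) ^ (-(x * ((h : ℝ) - m))) ≤ (1 - (2 : ℝ) ^ (-x))⁻¹ := by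
  rw [← Finset.sum_range_reflect]
  refine le_trans (Finset.sum_le_sum fun m hm => ?_) (sum_two_rpow_neg_le hx h)
  have hm' := Finset.mem_range.1 hm
  refine Real.rpow_le_rpow_of_exponent_le (by norm_num) (neg_le_neg ?_)
  have : ((h - 1 - m : ℕ) : ℝ) = h - 1 - m := by
    rw [Nat.cast_sub (by omega), Nat.cast_sub (by omega)]; simp
  rw [this]
  gcongr
  linarith

/-- The condition `n ≥ 3` ensures `log n ≥ 1` in the critical case; below it, `q/2 - A q > 1`. -/
lemma le_varpi {q A : ℝ} (hq : 2 < q) {n : ℕ} (hn : 3 ≤ n) : (n : ℝ) ≤ varpi q A n := by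
  have hn3 : (3:ℝ) ≤ n := by exact_mod_cast hn
  have hlog : 1 ≤ Real.log n := by
    rw [Real.le_log_iff_exp_le (by linarith)]
    linarith [Real.exp_one_lt_d9]
  unfold varpi
  split_ifs with h1 h2
  · exact le_rfl
  · exact le_mul_of_one_le_right (by linarith) (Real.one_le_rpow hlog (by linarith))
  · have h3 : A < 1 / 2 - 1 / q := lt_of_le_of_ne (not_lt.1 h1) h2
    have h4 : A * q < (1 / 2 - 1 / q) * q := by gcongr
    have h5 : (1 / 2 - 1 / q) * q = q / 2 - 1 := by field_simp
    calc (n : ℝ) = (n : ℝ) ^ (1 : ℝ) := (Real.rpow_one _).symm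
      _ ≤ _ := Real.rpow_le_rpow_of_exponent_le (by linarith) (by linarith)

/-- The contributions of the layers of long lags vanish, for suitable weights of the layers. -/
lemma exists_layer_weights {q A : ℝ} (hq : 2 < q) (hA : 0 < A) : ∃ Λ : ℝ,
    ∀ (n l h : ℕ → ℕ) (b : ℕ → ℝ), Tendsto n atTop atTop → Tendsto l atTop atTop →
      Tendsto b atTop (𝓝 0) → (∀ᶠ r in atTop, (2 : ℝ) ^ h r * l r ≤ n r * b r) →
      ∃ lam : ℕ → ℕ → ℝ, (∀ r (m : ℕ), (2 : ℝ) ^ (-(A / 2 * m)) ≤ lam r m) ∧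
        (∀ r, ∑ m ∈ Finset.range (h r), lam r m ≤ Λ) ∧
        Tendsto (fun r => ∑ m ∈ Finset.range (h r),
            n r / varpi q A (n r) * (2 ^ m * l r : ℝ) ^ (q / 2 - 1 - A * q) * lam r m ^ (-q)
          + n r / varpi q A (n r) * (2 ^ h r * l r : ℝ) ^ (q / 2 - 1 - A * q)) atTop (𝓝 0) := by
  have hq0 : 0 < q := by linarith
  have h5 : (1 / 2 - 1 / q) * q = q / 2 - 1 := by field_simp
  set κ : ℝ := q / 2 - 1 - A * q with hκ
  have hA2 : 0 < A / 2 := by linarith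
  have two0 : (0:ℝ) < 2 := by norm_num
  rcases lt_trichotomy (1 / 2 - 1 / q) A with hAc | hAc | hAc
  · have hκ0 : κ < 0 := by
      have : (1 / 2 - 1 / q) * q < A * q := by gcongr
      linarith
    -- Weak dependence, `κ < 0`: the polynomial terms decay geometrically in the layer, and this `η`
    -- spends at most half of the decay on `lam ^ (-q)`. The sum is of order `l ^ κ` and vanishes
    -- because the first layer starts at `l → ∞`.
    set η : ℝ := min (A / 2) (-κ / (2 * q)) with hη
    have hη0 : 0 < η := lt_min hA2 (div_pos (by linarith) (by linarith))
    have hηq : η * q ≤ -κ / 2 := by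
      have : η ≤ -κ / (2 * q) := min_le_right _ _
      calc η * q ≤ -κ / (2 * q) * q := by gcongr
        _ = -κ / 2 := by field_simp
    set G : ℝ := (1 - (2:ℝ) ^ (-(-κ / 2)))⁻¹ with hG
    refine ⟨(1 - (2:ℝ) ^ (-η))⁻¹, fun n l h b hn hl hb hbl => ⟨fun _ m => (2:ℝ) ^ (-(η * m)),
      fun r m => ?_, fun r => sum_two_rpow_neg_le hη0 _, ?_⟩⟩
    · refine Real.rpow_le_rpow_of_exponent_le (by norm_num) (neg_le_neg ?_)
      gcongr
      exact min_le_left _ _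
    · have hlim : Tendsto (fun r => (G + 1) * (l r : ℝ) ^ κ) atTop (𝓝 0) := by
        rw [← mul_zero (G + 1)]
        refine Tendsto.const_mul _ ?_
        have := (tendsto_rpow_neg_atTop (by linarith : 0 < -κ)).comp
          (tendsto_natCast_atTop_atTop.comp hl)
        simpa [Function.comp_def] using this
      refine squeeze_zero' (.of_forall fun r => ?_) ?_ hlim
      · have : 0 ≤ varpi q A (n r) := by rw [varpi, if_pos hAc]; positivity
        positivity
      · filter_upwards [hn.eventually_ge_atTop 1, hl.eventually_ge_atTop 1] with r hn1 hl1
        have hn1' : (0:ℝ) < n r := by exact_mod_cast hn1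
        have hl1' : (1:ℝ) ≤ l r := by exact_mod_cast hl1
        have hl0 : (0:ℝ) < l r := by linarith
        rw [varpi, if_pos hAc, div_self hn1'.ne', add_mul, one_mul]
        refine add_le_add ?_ ?_
        · have := sum_two_rpow_neg_le (x := -κ / 2) (by linarith) (h r)
          calc _ ≤ ∑ m ∈ Finset.range (h r), (2:ℝ) ^ (-(-κ / 2 * m)) * (l r : ℝ) ^ κ := by
                refine Finset.sum_le_sum fun m _ => ?_
                rw [one_mul, Real.mul_rpow (by positivity) hl0.le, ← Real.rpow_natCast,
                  ← Real.rpow_mul two0.le, ← Real.rpow_mul two0.le, mul_right_comm,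
                  ← Real.rpow_add two0]
                gcongr
                · norm_num
                · have : η * q * m ≤ -κ / 2 * m := by gcongr
                  linarith
            _ ≤ G * (l r : ℝ) ^ κ := by rw [← Finset.sum_mul]; gcongr
        · rw [one_mul]
          refine Real.rpow_le_rpow_of_nonpos hl0 ?_ hκ0.le
          exact le_mul_of_one_le_left hl0.le (one_le_pow₀ (by norm_num))
  · have hκ0 : κ = 0 := by rw [hκ, ← hAc, h5]; ring
    -- Critical case, `κ = 0`: all layers weigh the same, and an equal share `1/(h + 1)` costs a
    -- power `q` of the number of layers, which is of order `log n`. Summing costs one more power,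
    -- and `(log n) ^ (1 + 2q)` in `varpi` leaves `(log n) ^ (-q)`.
    refine ⟨(1 - (2:ℝ) ^ (-(A / 2)))⁻¹ + 1, fun n l h b hn hl hb hbl =>
      ⟨fun r m => (2:ℝ) ^ (-(A / 2 * m)) + 1 / (h r + 1), fun r m => ?_, fun r => ?_, ?_⟩⟩
    · have : (0:ℝ) ≤ 1 / (h r + 1) := by positivity
      linarith
    · rw [Finset.sum_add_distrib]
      refine add_le_add (sum_two_rpow_neg_le hA2 _) ?_
      rw [Finset.sum_const, Finset.card_range, nsmul_eq_mul, mul_one_div, div_le_one (by positivity)]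
      linarith
    · have hlogn : Tendsto (fun r => Real.log (n r)) atTop atTop :=
        Real.tendsto_log_atTop.comp (tendsto_natCast_atTop_atTop.comp hn)
      have hlim : Tendsto (fun r => (3:ℝ) ^ (1 + q) * Real.log (n r) ^ (-q)
          + Real.log (n r) ^ (-(1 + 2 * q))) atTop (𝓝 0) := by
        have h1 := (tendsto_rpow_neg_atTop hq0).comp hlogn
        have h2 := (tendsto_rpow_neg_atTop (by linarith : 0 < 1 + 2 * q)).comp hlogn
        simpa [Function.comp_def] using (h1.const_mul ((3:ℝ) ^ (1 + q))).add h2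
      refine squeeze_zero' ?_ ?_ hlim
      · filter_upwards [hn.eventually_ge_atTop 3] with r hn3
        have : 0 ≤ varpi q A (n r) := le_trans (by positivity) (le_varpi hq hn3)
        positivity
      · filter_upwards [hn.eventually_ge_atTop 3, hl.eventually_ge_atTop 1, hbl,
          hb.eventually (eventually_le_nhds (by norm_num : (0:ℝ) < 1))] with r hn3 hl1 hbl hb1
        have hn3' : (3:ℝ) ≤ n r := by exact_mod_cast hn3
        have hl1' : (1:ℝ) ≤ l r := by exact_mod_cast hl1
        have hlog : 1 ≤ Real.log (n r) := by
          rw [Real.le_log_iff_exp_le (by linarith)]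
          linarith [Real.exp_one_lt_d9]
        set ℓ := Real.log (n r) with hℓ
        have hℓ0 : 0 < ℓ := by linarith
        have hh : (h r : ℝ) + 1 ≤ 3 * ℓ := by
          have h1 : (2:ℝ) ^ h r ≤ n r := by
            calc (2:ℝ) ^ h r ≤ 2 ^ h r * l r := le_mul_of_one_le_right (by positivity) hl1'
              _ ≤ n r * b r := hbl
              _ ≤ n r := mul_le_of_le_one_right (by linarith) hb1
          have h2 := Real.log_le_log (by positivity) h1
          rw [Real.log_pow] at h2
          have := Real.log_two_gt_d9
          have h3 : (h r : ℝ) * (1 / 2) ≤ h r * Real.log 2 := by gcongr; linarith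
          linarith
        have hv : (n r : ℝ) / varpi q A (n r) = ℓ ^ (-(1 + 2 * q)) := by
          rw [varpi, if_neg (by rw [hAc]; exact lt_irrefl _), if_pos hAc.symm, Real.rpow_neg hℓ0.le]
          exact div_mul_cancel_left₀ (by positivity) _
        rw [hv, hκ0]
        simp only [Real.rpow_zero, mul_one]
        gcongr
        have hlam : ∀ m ∈ Finset.range (h r), ℓ ^ (-(1 + 2 * q))
            * ((2:ℝ) ^ (-(A / 2 * m)) + 1 / ((h r : ℝ) + 1)) ^ (-q)
            ≤ ℓ ^ (-(1 + 2 * q)) * (3 * ℓ) ^ q := by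
          intro m _
          refine mul_le_mul_of_nonneg_left ?_ (by positivity)
          have h1 : (3 * ℓ)⁻¹ ≤ (2:ℝ) ^ (-(A / 2 * m)) + 1 / ((h r : ℝ) + 1) := by
            have h2 : (0:ℝ) ≤ (2:ℝ) ^ (-(A / 2 * m)) := by positivity
            have h3 : (3 * ℓ)⁻¹ ≤ 1 / ((h r : ℝ) + 1) := by
              rw [one_div]; gcongr
            linarith
          calc _ ≤ ((3 * ℓ)⁻¹) ^ (-q) := Real.rpow_le_rpow_of_nonpos (by positivity) h1 (by linarith)
            _ = (3 * ℓ) ^ q := by rw [Real.inv_rpow (by positivity), Real.rpow_neg (by positivity),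
                inv_inv]
        refine (Finset.sum_le_sum hlam).trans ?_
        rw [Finset.sum_const, Finset.card_range, nsmul_eq_mul]
        calc (h r : ℝ) * (ℓ ^ (-(1 + 2 * q)) * (3 * ℓ) ^ q)
            ≤ (3 * ℓ) * (ℓ ^ (-(1 + 2 * q)) * (3 * ℓ) ^ q) := by gcongr; linarith
          _ = 3 ^ (1 + q) * (ℓ ^ (-(1 + 2 * q)) * (ℓ * ℓ ^ q)) := by
              rw [Real.mul_rpow (by norm_num) hℓ0.le, Real.rpow_add (by norm_num), Real.rpow_one]
              ring
          _ = 3 ^ (1 + q) * ℓ ^ (-q) := by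
              congr 1
              rw [← Real.rpow_one_add' hℓ0.le (by linarith), ← Real.rpow_add hℓ0]
              congr 1; ring
  · have hκ0 : 0 < κ := by
      have : A * q < (1 / 2 - 1 / q) * q := by gcongr
      linarith
    -- Strong dependence, `κ > 0`: the last layers dominate, so the share is largest at `m = h`. The
    -- total is of order `(2 ^ h l / n) ^ κ ≤ b ^ κ`. In this and the preceding case the extra
    -- summand `2 ^ (-A m / 2)` serves the Gaussian terms.
    set η : ℝ := κ / (2 * q) with hη
    have hη0 : 0 < η := by positivity
    have hηq : η * q = κ / 2 := by rw [hη]; field_simp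
    set G : ℝ := (1 - (2:ℝ) ^ (-(κ / 2)))⁻¹ with hG
    refine ⟨(1 - (2:ℝ) ^ (-(A / 2)))⁻¹ + (1 - (2:ℝ) ^ (-η))⁻¹, fun n l h b hn hl hb hbl =>
      ⟨fun r m => (2:ℝ) ^ (-(A / 2 * m)) + (2:ℝ) ^ (-(η * (h r - m))), fun r m => ?_, fun r => ?_,
        ?_⟩⟩
    · have : (0:ℝ) ≤ (2:ℝ) ^ (-(η * (h r - m))) := by positivity
      linarith
    · rw [Finset.sum_add_distrib]
      exact add_le_add (sum_two_rpow_neg_le hA2 _) (sum_two_rpow_neg_reflect_le hη0 _)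
    · have hlim : Tendsto (fun r => (G + 1) * |b r| ^ κ) atTop (𝓝 0) := by
        have h1 : Tendsto (fun r => |b r| ^ κ) atTop (𝓝 (|0| ^ κ)) :=
          (hb.abs).rpow_const (Or.inr hκ0.le)
        rw [abs_zero, Real.zero_rpow hκ0.ne'] at h1
        simpa using h1.const_mul (G + 1)
      refine squeeze_zero' ?_ ?_ hlim
      · filter_upwards [hn.eventually_ge_atTop 3] with r hn3
        have : 0 ≤ varpi q A (n r) := le_trans (by positivity) (le_varpi hq hn3)
        positivity
      · filter_upwards [hn.eventually_ge_atTop 3, hl.eventually_ge_atTop 1, hbl] with r hn3 hl1 hbl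
        have hn0 : (0:ℝ) < n r := by exact_mod_cast (by omega : 0 < n r)
        have hl0 : (0:ℝ) < l r := by exact_mod_cast hl1
        have hv : (n r : ℝ) / varpi q A (n r) = (n r : ℝ) ^ (-κ) := by
          rw [varpi, if_neg (by linarith), if_neg hAc.ne, Real.rpow_neg hn0.le,
            show q / 2 - A * q = κ + 1 by rw [hκ]; ring, Real.rpow_add_one hn0.ne']
          have := Real.rpow_pos_of_pos hn0 κ
          field_simp
        have hW : (n r : ℝ) ^ (-κ) * (2 ^ h r * l r : ℝ) ^ κ ≤ |b r| ^ κ := by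
          have h1 : (2 ^ h r * l r : ℝ) ≤ n r * |b r| :=
            hbl.trans (by gcongr; exact le_abs_self _)
          calc _ ≤ (n r : ℝ) ^ (-κ) * (n r * |b r|) ^ κ := by gcongr
            _ = |b r| ^ κ := by
                rw [Real.mul_rpow hn0.le (abs_nonneg _), ← mul_assoc, ← Real.rpow_add hn0]
                simp
        rw [hv, add_mul, one_mul]
        refine add_le_add ?_ hW
        have hlam : ∀ m ∈ Finset.range (h r), (n r : ℝ) ^ (-κ) * (2 ^ m * l r : ℝ) ^ κ
            * ((2:ℝ) ^ (-(A / 2 * m)) + (2:ℝ) ^ (-(η * (h r - m)))) ^ (-q)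
            ≤ |b r| ^ κ * (2:ℝ) ^ (-(κ / 2 * (h r - m))) := by
          intro m _
          have h1 : ((2:ℝ) ^ (-(A / 2 * m)) + (2:ℝ) ^ (-(η * (h r - m)))) ^ (-q)
              ≤ ((2:ℝ) ^ (-(η * (h r - m)))) ^ (-q) := by
            refine Real.rpow_le_rpow_of_nonpos (by positivity) ?_ (by linarith)
            have : (0:ℝ) ≤ (2:ℝ) ^ (-(A / 2 * m)) := by positivity
            linarith
          have h2 : ((2:ℝ) ^ (-(η * (h r - m)))) ^ (-q) = (2:ℝ) ^ (κ / 2 * (h r - m)) := by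
            rw [← Real.rpow_mul two0.le, ← hηq]; ring_nf
          have h3 : (2 ^ m * l r : ℝ) ^ κ = (2 ^ h r * l r : ℝ) ^ κ * (2:ℝ) ^ (-(κ * (h r - m))) := by
            rw [Real.mul_rpow (by positivity) hl0.le, Real.mul_rpow (by positivity) hl0.le,
              ← Real.rpow_natCast, ← Real.rpow_natCast, ← Real.rpow_mul two0.le,
              ← Real.rpow_mul two0.le, mul_right_comm, ← Real.rpow_add two0]
            congr 2; ring
          calc _ ≤ (n r : ℝ) ^ (-κ) * (2 ^ m * l r : ℝ) ^ κ * (2:ℝ) ^ (κ / 2 * (h r - m)) := by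
                rw [← h2]; gcongr
            _ = ((n r : ℝ) ^ (-κ) * (2 ^ h r * l r : ℝ) ^ κ)
                * ((2:ℝ) ^ (-(κ * (h r - m))) * (2:ℝ) ^ (κ / 2 * (h r - m))) := by rw [h3]; ring
            _ = ((n r : ℝ) ^ (-κ) * (2 ^ h r * l r : ℝ) ^ κ) * (2:ℝ) ^ (-(κ / 2 * (h r - m))) := by
                rw [← Real.rpow_add two0]; congr 2; ring
            _ ≤ _ := by gcongr
        refine (Finset.sum_le_sum hlam).trans ?_
        rw [← Finset.mul_sum, mul_comm]
        gcongr
        exact sum_two_rpow_neg_reflect_le (by positivity) _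

end Asymptotics

/-! ### Consistency of the covariance estimator -/

section Consistency

/-- The variance in layer `m` decays like `2 ^ (-2Am)`, while the squared weight is at least `2 ^
(-Am)`. The exponent thus gains `X = 2 ^ (Am)`: the factor `4` pays for `p ^ 2`, and `exp (-X) ≤
1/X` makes the layers summable. -/
lemma exp_layer_term_le {A p l lam : ℝ} (hp : Real.exp 1 ≤ p) (hl : 1 ≤ l) (hA : 0 < A) {m : ℕ}
    (hlam : (2 : ℝ) ^ (-(A / 2 * m)) ≤ lam) :
    p ^ 2 * Real.exp (-(4 * (lam ^ 2 * (2 ^ m * l) ^ (2 * A) * Real.log p)))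
      ≤ p⁻¹ * (2 : ℝ) ^ (-(A * m)) := by
  have two0 : (0:ℝ) < 2 := by norm_num
  have hp0 : 0 < p := (Real.exp_pos 1).trans_le hp
  set ℓ := Real.log p with hℓ
  have hℓ1 : 1 ≤ ℓ := (Real.le_log_iff_exp_le hp0).2 hp
  have hpe : p = Real.exp ℓ := (Real.exp_log hp0).symm
  set X : ℝ := (2:ℝ) ^ (A * m) with hX
  have hX1 : 1 ≤ X := Real.one_le_rpow (by norm_num) (by positivity)
  have hXle : X ≤ lam ^ 2 * (2 ^ m * l) ^ (2 * A) := by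
    calc X = ((2 : ℝ) ^ (-(A / 2 * m))) ^ 2 * (2 ^ m : ℝ) ^ (2 * A) := by
          rw [hX, ← Real.rpow_natCast, ← Real.rpow_mul two0.le, ← Real.rpow_natCast,
            ← Real.rpow_mul two0.le, ← Real.rpow_add two0]
          congr 1; push_cast; ring
      _ ≤ lam ^ 2 * (2 ^ m * l) ^ (2 * A) := by
          have h1 : (2 ^ m : ℝ) ≤ 2 ^ m * l := le_mul_of_one_le_right (by positivity) hl
          have h2 : (2 ^ m : ℝ) ^ (2 * A) ≤ (2 ^ m * l) ^ (2 * A) :=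
            Real.rpow_le_rpow (by positivity) h1 (by positivity)
          have h3 : ((2 : ℝ) ^ (-(A / 2 * m))) ^ 2 ≤ lam ^ 2 := by gcongr
          exact mul_le_mul h3 h2 (by positivity) (by positivity)
  have h4 : 2 * ℓ - 4 * (lam ^ 2 * (2 ^ m * l) ^ (2 * A) * ℓ) ≤ -ℓ - X := by
    have : X * ℓ ≤ lam ^ 2 * (2 ^ m * l) ^ (2 * A) * ℓ := by gcongr
    nlinarith
  calc p ^ 2 * Real.exp (-(4 * (lam ^ 2 * (2 ^ m * l) ^ (2 * A) * ℓ)))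
      = Real.exp (2 * ℓ - 4 * (lam ^ 2 * (2 ^ m * l) ^ (2 * A) * ℓ)) := by
        rw [sub_eq_add_neg, Real.exp_add, two_mul ℓ, Real.exp_add, ← hpe, sq]
    _ ≤ Real.exp (-ℓ - X) := Real.exp_le_exp.2 h4
    _ = p⁻¹ * Real.exp (-X) := by rw [sub_eq_add_neg, Real.exp_add, Real.exp_neg, ← hpe]
    _ ≤ p⁻¹ * X⁻¹ := by
        rw [Real.exp_neg]
        gcongr
        linarith [Real.add_one_le_exp X]
    _ = p⁻¹ * (2 : ℝ) ^ (-(A * m)) := by rw [hX, Real.rpow_neg two0.le]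

/-- The growth restriction on `l` gives `l ^ q / p ≤ p ^ (-5/6)`, and its cube beats the `p ^ 2`
pairs: `2 - 5/2 = -1/2`. -/
lemma lower_layer_terms_le {q p l : ℝ} (hq : 0 < q) (hp : 1 ≤ p) (hl : 0 ≤ l)
    (hlp : l ≤ p ^ (1 / (6 * q))) :
    l ^ q / p + p ^ 2 * Real.exp (-(4 * Real.log p)) + p ^ 2 * (l ^ q / p) ^ (3 : ℝ)
      ≤ 3 * p ^ (-(1 / 2) : ℝ) := by
  have hp0 : 0 < p := by linarith
  have hle : ∀ {x : ℝ}, x ≤ -(1 / 2) → p ^ x ≤ p ^ (-(1 / 2) : ℝ) := fun hx =>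
    Real.rpow_le_rpow_of_exponent_le hp hx
  have h1 : l ^ q / p ≤ p ^ (-(5 / 6) : ℝ) := by
    have : l ^ q ≤ p ^ (1 / 6 : ℝ) := by
      calc l ^ q ≤ (p ^ (1 / (6 * q))) ^ q := by gcongr
        _ = p ^ (1 / 6 : ℝ) := by rw [← Real.rpow_mul hp0.le]; congr 1; field_simp
    calc l ^ q / p ≤ p ^ (1 / 6 : ℝ) / p := by gcongr
      _ = p ^ (-(5 / 6) : ℝ) := by rw [← Real.rpow_sub_one hp0.ne']; norm_num
  have h2 : p ^ 2 * Real.exp (-(4 * Real.log p)) = p ^ (-2 : ℝ) := by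
    have e1 : Real.exp (-(4 * Real.log p)) = p ^ (-4 : ℝ) := by
      rw [Real.rpow_def_of_pos hp0]; congr 1; ring
    rw [e1, ← Real.rpow_natCast, ← Real.rpow_add hp0]
    norm_num
  have h3 : p ^ 2 * (l ^ q / p) ^ (3 : ℝ) ≤ p ^ (-(1 / 2) : ℝ) := by
    calc p ^ 2 * (l ^ q / p) ^ (3 : ℝ) ≤ p ^ 2 * (p ^ (-(5 / 6) : ℝ)) ^ (3 : ℝ) := by gcongr
      _ = p ^ (-(1 / 2) : ℝ) := by
          rw [← Real.rpow_natCast, ← Real.rpow_mul hp0.le, ← Real.rpow_add hp0]; norm_num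
  have h4 := hle (x := -(5 / 6)) (by norm_num)
  have h5 := hle (x := -2) (by norm_num)
  linarith

namespace CausalModel

/-- The kernel estimator of the covariance matrix function attains the uniform rate. -/
lemma exists_tendsto_measure_covHat_deviation {q A : ℝ} (hq : 2 < q) (hA : 0 < A) {K : ℝ → ℝ}
    (hK : IsRegularKernel K) (ν L L' : ℝ) : ∃ C : ℝ, 1 ≤ C ∧
    ∀ (n p : ℕ → ℕ), Tendsto n atTop atTop → Tendsto p atTop atTop →
    ∀ (M : ∀ r, CausalModel (p r)) (κ : ℕ → ℝ),
    (∀ r, (M r).DependenceCondition q A ν) → (∀ r, (M r).SmoothnessCondition L L') →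
    (∀ r, (M r).SparsityCondition (κ r)) → ∀ b : ℕ → ℝ, Tendsto b atTop (𝓝 0) →
    Tendsto (fun r => (n r : ℝ) * b r) atTop atTop →
    ∀ (Ω : ℕ → Type*) [∀ r, MeasurableSpace (Ω r)] (P : ∀ r, Measure (Ω r))
      (ε : ∀ r, ℤ → Ω r → Fin (p r) → ℝ), (∀ r, (M r).IsInnovations (P r) (ε r)) →
    Tendsto (fun r => P r {ω | ∃ t ∈ Set.Icc (b r) (1 - b r), ∃ j k,
      C * uniformRate (M r) q A (n r) (b r)
        < |covHat K (n r) (b r) ((M r).obs (ε r) (n r) ω) t j k - (M r).cov t j k|})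
      atTop (𝓝 0) := by
  have hq0 : 0 < q := by linarith
  obtain ⟨Λ, hΛ⟩ := exists_layer_weights hq hA
  obtain ⟨C, hC1, hC⟩ := exists_measure_covHat_deviation_le hq hA hK ν L L' Λ
  refine ⟨C, hC1, ?_⟩
  intro n p hn hp M κ hD hS hSp b hb hnb Ω _ P ε hε
  have hpr : Tendsto (fun r => (p r : ℝ)) atTop atTop := tendsto_natCast_atTop_atTop.comp hp
  -- The first layer must start at a diverging lag, slow against `p` and not beyond `nb`; `h` then
  -- brings `2 ^ h l` within a constant factor of `nb`.
  set l : ℕ → ℕ := fun r => ⌊min ((p r : ℝ) ^ (1 / (6 * q))) (n r * b r)⌋₊ with hl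
  set h : ℕ → ℕ := fun r => Nat.log 2 ⌊n r * b r / l r⌋₊ with hh
  have hlim_l : Tendsto l atTop atTop := by
    refine tendsto_nat_floor_atTop.comp (tendsto_atTop.2 fun c => ?_)
    have h1 := ((tendsto_rpow_atTop (by positivity : 0 < 1 / (6 * q))).comp hpr).eventually_ge_atTop c
    filter_upwards [h1, hnb.eventually_ge_atTop c] with r h1 h2
    exact le_min h1 h2
  have hlh : ∀ᶠ r in atTop, (2 : ℝ) ^ h r * l r ≤ n r * b r ∧ n r * b r ≤ 4 * (2 ^ h r * l r) := by
    filter_upwards [hlim_l.eventually_ge_atTop 1, hnb.eventually_ge_atTop 0] with r hl1 hnb0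
    have hl1' : (0:ℝ) < l r := by exact_mod_cast hl1
    have hlnb : (l r : ℝ) ≤ n r * b r :=
      (Nat.floor_le (le_min (by positivity) hnb0)).trans (min_le_right _ _)
    have hf1 : 1 ≤ ⌊n r * b r / l r⌋₊ := by
      refine Nat.le_floor ?_
      rw [Nat.cast_one, one_le_div hl1']
      exact hlnb
    have h1 : (2:ℝ) ^ h r ≤ n r * b r / l r := by
      have : 2 ^ h r ≤ ⌊n r * b r / l r⌋₊ := Nat.pow_log_le_self 2 (by omega)
      have h2 : ((2 ^ h r : ℕ) : ℝ) ≤ (⌊n r * b r / l r⌋₊ : ℝ) := by exact_mod_cast this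
      push_cast at h2
      exact h2.trans (Nat.floor_le (by positivity))
    have h3 : n r * b r / l r ≤ 2 * 2 ^ h r := by
      have : ⌊n r * b r / l r⌋₊ + 1 ≤ 2 ^ (h r + 1) := Nat.lt_pow_succ_log_self (by norm_num) _
      have h2 : (⌊n r * b r / l r⌋₊ : ℝ) + 1 ≤ 2 ^ (h r + 1) := by exact_mod_cast this
      rw [pow_succ] at h2
      linarith [Nat.lt_floor_add_one (n r * b r / l r)]
    rw [le_div_iff₀ hl1'] at h1
    rw [div_le_iff₀ hl1'] at h3
    refine ⟨h1, ?_⟩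
    have : (0:ℝ) ≤ 2 ^ h r * l r := by positivity
    linarith
  obtain ⟨lam, hlam, hlamΛ, hV⟩ := hΛ n l h b hn hlim_l hb (hlh.mono fun r hr => hr.1)
  set V : ℕ → ℝ := fun r => ∑ m ∈ Finset.range (h r),
            n r / varpi q A (n r) * (2 ^ m * l r : ℝ) ^ (q / 2 - 1 - A * q) * lam r m ^ (-q)
          + n r / varpi q A (n r) * (2 ^ h r * l r : ℝ) ^ (q / 2 - 1 - A * q) with hVdef
  set G : ℝ := (1 - (2:ℝ) ^ (-A))⁻¹ with hG
  have hlim : Tendsto (fun r => ENNReal.ofReal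
      (C * ((3 + G) * (p r : ℝ) ^ (-(1 / 2) : ℝ) + V r))) atTop (𝓝 0) := by
    rw [← ENNReal.ofReal_zero]
    refine ENNReal.tendsto_ofReal ?_
    have h1 := (tendsto_rpow_neg_atTop (by norm_num : (0:ℝ) < 1 / 2)).comp hpr
    simpa [Function.comp_def] using ((h1.const_mul (3 + G)).add hV).const_mul C
  refine tendsto_of_tendsto_of_tendsto_of_le_of_le' tendsto_const_nhds hlim
    (.of_forall fun r => zero_le) ?_
  filter_upwards [hn.eventually_ge_atTop 3, hp.eventually_ge_atTop 3, hlim_l.eventually_ge_atTop 1,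
    hlh, hnb.eventually_ge_atTop C, hb.eventually (eventually_le_nhds (by norm_num : (0:ℝ) < 1))]
    with r hn3 hp3 hl1 hlh hCnb hb1
  have hn3' : (3:ℝ) ≤ n r := by exact_mod_cast hn3
  have hp3' : (3:ℝ) ≤ p r := by exact_mod_cast hp3
  have hl1' : (1:ℝ) ≤ l r := by exact_mod_cast hl1
  have hpe : Real.exp 1 ≤ p r := by linarith [Real.exp_one_lt_d9]
  have hlogp : 1 ≤ Real.log (p r) := (Real.le_log_iff_exp_le (by linarith)).2 hpe
  have hb0 : 0 < b r := by
    by_contra hne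
    have : n r * b r ≤ 0 := mul_nonpos_of_nonneg_of_nonpos (by linarith) (not_lt.1 hne)
    linarith
  have hln : 2 ^ h r * l r ≤ n r := by
    have : ((2 ^ h r * l r : ℕ) : ℝ) ≤ n r := by
      push_cast
      exact hlh.1.trans (mul_le_of_le_one_right (by linarith) hb1)
    exact_mod_cast this
  refine (hC (hD r) (hS r) (hSp r) (n r) (l r) (h r) (b r) (lam r) (by omega) hl1 hln
    (le_varpi hq hn3) hb0 hCnb hlh.2 (by nlinarith)
    (fun m => lt_of_lt_of_le (by positivity) (hlam r m)) (hlamΛ r) (P r) (ε r) (hε r)).trans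
    (ENNReal.ofReal_le_ofReal ?_)
  refine mul_le_mul_of_nonneg_left ?_ (by linarith)
  have hlp : (l r : ℝ) ≤ (p r : ℝ) ^ (1 / (6 * q)) :=
    (Nat.floor_le (le_min (by positivity) (by linarith))).trans (min_le_left _ _)
  have t1 := lower_layer_terms_le hq0 (by linarith : (1:ℝ) ≤ p r) (by linarith) hlp
  have t2 : ∑ m ∈ Finset.range (h r), (p r : ℝ) ^ 2 * Real.exp (-(4 * (lam r m ^ 2 *
      (2 ^ m * l r : ℝ) ^ (2 * A) * Real.log (p r)))) ≤ G * (p r : ℝ) ^ (-(1 / 2) : ℝ) := by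
    have hG0 : 0 ≤ G := by
      have : (2:ℝ) ^ (-A) < 1 := Real.rpow_lt_one_of_one_lt_of_neg (by norm_num) (by linarith)
      exact inv_nonneg.2 (by linarith)
    calc _ ≤ ∑ m ∈ Finset.range (h r), (p r : ℝ)⁻¹ * (2 : ℝ) ^ (-(A * m)) :=
          Finset.sum_le_sum fun m _ => exp_layer_term_le hpe hl1' hA (hlam r m)
      _ ≤ (p r : ℝ)⁻¹ * G := by
          rw [← Finset.mul_sum]
          exact mul_le_mul_of_nonneg_left (sum_two_rpow_neg_le hA _) (by positivity)
      _ = G * (p r : ℝ) ^ (-1 : ℝ) := by rw [Real.rpow_neg_one, mul_comm]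
      _ ≤ _ := by
          refine mul_le_mul_of_nonneg_left ?_ hG0
          exact Real.rpow_le_rpow_of_exponent_le (by linarith) (by norm_num)
  rw [Finset.sum_add_distrib, hVdef]
  linarith

end CausalModel

end Consistency

/-! ### Graph recovery -/

section Recovery

namespace CausalModel

variable {p : ℕ} {M : CausalModel p}

lemma cov_transpose (t : ℝ) : (M.cov t).transpose = M.cov t := by
  ext j k
  simp only [cov, Matrix.transpose_apply, Matrix.of_apply]
  exact integral_congr_ae (.of_forall fun s => mul_comm _ _)

lemma prec_transpose (t : ℝ) : (M.prec t).transpose = M.prec t := by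
  rw [prec, Matrix.transpose_nonsing_inv, cov_transpose]

/-- Otherwise a column of `Ω(0)` vanishes, against invertibility. Positivity makes the comparison of
`2 κ λ` with the threshold strict. -/
lemma SparsityCondition.pos {κ : ℝ} (h : M.SparsityCondition κ) (hp : 1 ≤ p) : 0 < κ := by
  have h0 : (0:ℝ) ∈ Set.Icc (0:ℝ) 1 := by simp
  set k : Fin p := ⟨0, hp⟩
  by_contra hne
  have hz : ∀ j, M.prec 0 j k = 0 := by
    intro j
    have h1 := h.colSum_le 0 h0 k
    have h2 := Finset.single_le_sum (f := fun j => |M.prec 0 j k|) (fun _ _ => abs_nonneg _)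
      (Finset.mem_univ j)
    exact abs_nonpos_iff.1 (h2.trans (h1.trans (not_lt.1 hne)))
  have h1 := congrFun (congrFun (Matrix.mul_nonsing_inv (M.cov 0) (h.isUnit_det 0 h0)) k) k
  rw [Matrix.one_apply_eq, Matrix.mul_apply, Finset.sum_eq_zero fun j _ => by
    rw [show (M.cov 0)⁻¹ j k = 0 from hz j, mul_zero]] at h1
  exact zero_ne_one h1

/-- Recovery of the graph from an entrywise approximation of the covariance matrix. -/
lemma SparsityCondition.counts_eq_zero {κ δ lam u t : ℝ} (h : M.SparsityCondition κ)
    (ht : t ∈ Set.Icc (0 : ℝ) 1) {S Θ : Matrix (Fin p) (Fin p) ℝ} (hδ : 0 ≤ δ)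
    (hS : ∀ j k, |S j k - M.cov t j k| ≤ δ) (hlam : δ * κ ≤ lam)
    (hΘ : (∃ Θ, IsClimeSolution S lam Θ) → IsClimeSolution S lam Θ) (hu : 2 * κ * lam < u) :
    falseCount (M.edges t) (gHat Θ u) = 0 ∧ missedCount (M.sigEdges t (2 * u)) (gHat Θ u) = 0 := by
  have hdet := h.isUnit_det t ht
  have hmul : M.cov t * M.prec t = 1 := Matrix.mul_nonsing_inv _ hdet
  have hmul' : M.prec t * M.cov t = 1 := Matrix.nonsing_inv_mul _ hdet
  have hcol := h.colSum_le t ht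
  have hsol := hΘ (exists_isClimeSolution (climeFeasible_of_approx hmul hcol hδ hS hlam))
  have hclose := abs_omegaTilde_sub_le (prec_transpose t) fun j k =>
    hsol.abs_sub_le (prec_transpose t) hmul' hcol hδ hS hlam j k
  constructor
  · refine falseCount_eq_zero fun e he => ?_
    have h0 : M.prec t e.1 e.2 = 0 := by
      by_contra hne; exact he hne
    have := hclose e
    rw [h0, sub_zero] at this
    rw [gHat, if_neg (by linarith)]
  · refine missedCount_eq_zero fun e he => ?_
    have h1 := hclose e
    have h2 : 2 * u < |M.prec t e.1 e.2| := he
    have h3 : |M.prec t e.1 e.2| ≤ |omegaTilde Θ e - M.prec t e.1 e.2| + |omegaTilde Θ e| := by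
      rw [abs_sub_comm]
      have := abs_add_le (M.prec t e.1 e.2 - omegaTilde Θ e) (omegaTilde Θ e)
      rwa [sub_add_cancel] at this
    rw [gHat, if_pos (by linarith)]
    exact one_ne_zero

end CausalModel

end Recovery

end

theorem proposition2
    (q A : ℝ) (hq : 2 < q) (hA : 0 < A)
    (K : ℝ → ℝ) (hK : IsRegularKernel K)
    (ν L L' C₁ C₂ : ℝ) (hC₁ : 0 < C₁) (hC₂ : 0 < C₂) :
    ∃ Clam : ℝ, 0 < Clam ∧ ∀ Clam' : ℝ, ∃ C₀min : ℝ, 0 < C₀min ∧ ∀ C₀ : ℝ, C₀min ≤ C₀ →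
    ∀ (n p : ℕ → ℕ), Tendsto n atTop atTop → Tendsto p atTop atTop →
    ∀ (M : ∀ r, CausalModel (p r)) (κ : ℕ → ℝ),
    (∀ r, (M r).DependenceCondition q A ν) →
    (∀ r, (M r).SmoothnessCondition L L') →
    (∀ r, (M r).SparsityCondition (κ r)) →
    ∀ (b u lam : ℕ → ℝ),
    (∀ r, b r = bSharp (M r) q A C₁ C₂ (n r)) →
    Tendsto b atTop (𝓝 0) →
    Tendsto (fun r => (n r : ℝ) * b r) atTop atTop →
    (∀ r, u r = C₀ * κ r ^ 2 * b r ^ 2) →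
    Tendsto u atTop (𝓝 0) →
    (∀ r, Clam * κ r * uniformRate (M r) q A (n r) (b r) ≤ lam r) →
    (∀ r, lam r ≤ Clam' * κ r * b r ^ 2) →
    ∀ (Ω : ℕ → Type*) [∀ r, MeasurableSpace (Ω r)]
      (P : ∀ r, Measure (Ω r)) [∀ r, IsProbabilityMeasure (P r)]
      (ε : ∀ r, ℤ → Ω r → Fin (p r) → ℝ),
    (∀ r, (M r).IsInnovations (P r) (ε r)) →
    ∀ (Ωhat : ∀ r, Ω r → ℝ → Matrix (Fin (p r)) (Fin (p r)) ℝ),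
    (∀ r ω, ∀ t ∈ Set.Icc (b r) (1 - b r),
      (∃ Θ, IsClimeSolution (covHat K (n r) (b r) ((M r).obs (ε r) (n r) ω) t) (lam r) Θ) →
      IsClimeSolution (covHat K (n r) (b r) ((M r).obs (ε r) (n r) ω) t) (lam r)
        (Ωhat r ω t)) →
    Tendsto (fun r => P r {ω |
        (⨆ t ∈ Set.Icc (b r) (1 - b r),
          (falseCount ((M r).edges t) (gHat (Ωhat r ω t) (u r)) : ℕ∞)) ≠ 0})
      atTop (𝓝 0) ∧
    Tendsto (fun r => P r {ω |
        (⨆ t ∈ Set.Icc (b r) (1 - b r),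
          (missedCount ((M r).sigEdges t (2 * u r)) (gHat (Ωhat r ω t) (u r)) : ℕ∞)) ≠ 0})
      atTop (𝓝 0) := by
  obtain ⟨C, hC1, hC⟩ := CausalModel.exists_tendsto_measure_covHat_deviation hq hA hK ν L L'
  -- The entrywise error `2 κ λ` is at most `2 Clam' κ² b²`, so any `C₀ > 2 Clam'` puts it strictly
  -- below `u`; the maximum with `0` keeps the constant positive for negative `Clam'`.
  refine ⟨C, by linarith, fun Clam' => ⟨max (2 * Clam') 0 + 1, by positivity, ?_⟩⟩
  intro C₀ hC₀ n p hn hp M κ hD hS hSp b u lam _ hb hnb hu _ hlam hlam' Ω _ P _ ε hε Ωhat hΩhat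
  have hlim := hC n p hn hp M κ hD hS hSp b hb hnb Ω P ε hε
  have hgood : ∀ᶠ r in atTop, ∀ ω, ω ∉ {ω | ∃ t ∈ Set.Icc (b r) (1 - b r), ∃ j k,
      C * uniformRate (M r) q A (n r) (b r)
        < |covHat K (n r) (b r) ((M r).obs (ε r) (n r) ω) t j k - (M r).cov t j k|} →
      ∀ t ∈ Set.Icc (b r) (1 - b r), falseCount ((M r).edges t) (gHat (Ωhat r ω t) (u r)) = 0 ∧
        missedCount ((M r).sigEdges t (2 * u r)) (gHat (Ωhat r ω t) (u r)) = 0 := by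
    filter_upwards [hn.eventually_ge_atTop 3, hp.eventually_ge_atTop 1,
      hnb.eventually_ge_atTop 1] with r hn3 hp1 hnb1 ω hω t ht
    have hb0 : 0 < b r := by
      by_contra hne
      have : n r * b r ≤ 0 := mul_nonpos_of_nonneg_of_nonpos (Nat.cast_nonneg _) (not_lt.1 hne)
      linarith
    have hκ := (hSp r).pos hp1
    have ht' : t ∈ Set.Icc (0:ℝ) 1 := ⟨hb0.le.trans ht.1, by linarith [ht.2]⟩
    have hJ := (M r).JqA_nonneg (q := q) (A := A) (n := n r)
      ((Nat.cast_nonneg _).trans (le_varpi hq hn3))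
    have hN := (M r).NX_nonneg A
    have hrate : 0 ≤ uniformRate (M r) q A (n r) (b r) := by
      unfold uniformRate
      positivity
    refine (hSp r).counts_eq_zero ht' (by positivity)
      (fun j k => not_lt.1 fun hlt => hω ⟨t, ht, j, k, hlt⟩)
      ((mul_right_comm _ _ _).trans_le (hlam r)) (hΩhat r ω t ht) ?_
    have hκb : 0 < κ r ^ 2 * b r ^ 2 := by positivity
    calc 2 * κ r * lam r ≤ 2 * κ r * (Clam' * κ r * b r ^ 2) :=
          mul_le_mul_of_nonneg_left (hlam' r) (by positivity)
      _ = 2 * Clam' * (κ r ^ 2 * b r ^ 2) := by ring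
      _ < C₀ * (κ r ^ 2 * b r ^ 2) :=
          mul_lt_mul_of_pos_right (by linarith [le_max_left (2 * Clam') 0]) hκb
      _ = u r := by rw [hu r]; ring
  constructor
  -- Each failure event lies in the exceptional set of the covariance estimate, so monotonicity of
  -- the outer measure suffices.
  all_goals
    refine tendsto_of_tendsto_of_tendsto_of_le_of_le' tendsto_const_nhds hlim
      (.of_forall fun r => zero_le) ?_
    filter_upwards [hgood] with r hr
    refine measure_mono fun ω hω => ?_
    by_contra hne
    refine hω (le_antisymm (iSup₂_le fun t ht => ?_) zero_le)
  · rw [(hr ω hne t ht).1, Nat.cast_zero]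
  · rw [(hr ω hne t ht).2, Nat.cast_zero]
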